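/- Write $\lg=\log_2$. A comparator network on $n$ wires is a sequence of layers of comparators acting on pairwise distinct wires within a layer; a comparator on the wires $(i,j)$ puts the minimum of the two items on $i$ and the maximum on $j$. The depth is the number of layers. An *$\varepsilon$-halver* is a comparator network on $m=2k$ wires such that, for all inputs with distinct values and all integers $1\le z\le m/2$, the left half of the output holds at most $\varepsilon z$ of the $z$ largest inputs, and the right half at most $\varepsilon z$ of the $z$ smallest. It is *given by a $(d_0,\varepsilon)$-expander* if its depth is at most $d_0$, every comparator joins a wire of the left half $V_1$ (receiving the minimum) to a wire of the right half $V_2$, every wire is in exactly $d_0$ comparators, and $\varepsilon|\Gamma(U)|\ge(1-\varepsilon)\min(\varepsilon|V_i|,|U|)$ for every $U\subseteq V_i$ ($i=1,2$), where $\Gamma(U)$ is the set of wires compared with some wire of $U$. A *separator* on an array of $m$ wires consists of seven halvers in four layers: $H_0$ on the whole array; $H_1,H_2$ on its left and right halves; $H_3,H_4$ on the leftmost and rightmost quarters; $H_5,H_6$ on the leftmost and rightmost eighths. Its outputs, from left to right, are arrays $A_1,A_2,A_3,A_4$ of sizes $\frac m{16},\frac{7m}{16},\frac{7m}{16},\frac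 m{16}$. The *AKS sorting network of reduced depth* with parameters $j_{\max}\le d_{\max}$ has, for each $0\le j\le j_{\max}$, a complete binary tree of separators of depth $d_{\max}-j$ (tree $j$). The $n$ inputs enter the root of tree $0$. $A_2$ and $A_3$ of a non-leaf separator go to its left and right child. If $j<j_{\max}$, then $A_1$ and $A_4$ of the root of tree $j$ go to the left and right of the root of tree $j+1$, and $A_1\cup A_4$ of a left (right) child in tree $j$ goes to the left (right) end of the input of the copy of its parent in tree $j+1$. The remaining outputs ($A_2,A_3$ of all leaves, and $A_1,A_4$ of all separators of tree $j_{\max}$) form two arrays $L$ and $R$: the outputs of separators in the left subtree of a root go to $L$, those of separators in the right subtree go to $R$, and of a root $A_1,A_2$ go to $L$ and $A_3,A_4$ to $R$. The output array is $L$ followed by $R$. **Theorem 2 (Halver).** There is a constant $d_0$ such that for each $c>0$ and every sufficiently large power of two $n$ there is a comparator network $\mathcal H$ re-ordering $n$ inputs with the following properties. 1. $\mathcal H$ is an AKS sorting network of reduced depth with $$j_{\max}=\Big\lceil \tfrac{c}{\lg(4/e)}\lg\lg n\Big\rceil,\qquad d_{\max}=\Big\lceil \tfrac c5\lg\lg n\Big\rceil+j_{\max},$$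 all of whose separators consist of $\frac1{175}$-halvers given by $(d_0,\frac1{175})$-expanders. 2. $\mathcal H$ is a weak $\lg^{-c}n$-halver: for every input, the first half of the $n$ ordered outputs includes at most $n\lg^{-c}n$ items larger than the median, and the second half at most $n\lg^{-c}n$ items smaller than the median. (This holds for every median $g$, i.e. every real $g$ such that at least half of the items are $\le g$ and at least half are $\ge g$.) 3. $\mathcal H$ has at most $22.34\,c\lg\lg n$ layers of $\frac1{175}$-halvers; hence its depth is at most $d_0\cdot 22.34\,c\lg\lg n=O(\log\log n)$. -/

import Mathlib

/-! ## Comparator networks -/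

/-- The effect of a comparator on the contents of the wires: the comparator `(i, j)` puts the minimum
of the two items on wire `i` and their maximum on wire `j`. -/
def applyComparator {n : ℕ} {α : Type*} [LinearOrder α] (x : Fin n → α) (c : Fin n × Fin n) :
    Fin n → α := fun w =>
  if w = c.1 then min (x c.1) (x c.2) else if w = c.2 then max (x c.1) (x c.2) else x w

/-- A comparator network on `n` wires: a list of layers, each of which is a list of comparators that
act in parallel, that is, on pairwise distinct wires (a wire that a layer does not use is copied). -/
structure ComparatorNetwork (n : ℕ) where
  layers : List (List (Fin n × Fin n))
  disjoint : ∀ ℓ ∈ layers, (ℓ.flatMap fun c => [c.1, c.2]).Nodup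

/-- The depth of a comparator network: its number of layers of comparators. -/
def ComparatorNetwork.depth {n : ℕ} (N : ComparatorNetwork n) : ℕ := N.layers.length

/-- `N.run x w` is the item on wire `w` after `N` has processed the input `x`. -/
def ComparatorNetwork.run {n : ℕ} {α : Type*} [LinearOrder α] (N : ComparatorNetwork n)
    (x : Fin n → α) : Fin n → α :=
  N.layers.foldl (fun y ℓ => ℓ.foldl applyComparator y) x

/-! ## Halvers -/

/-- `N`, on `2 * k` wires, is an `ε`-halver: for every `1 ≤ z ≤ k`, the left half of the output holds
at most `ε z` of the `z` largest inputs, and the right half at most `ε z` of the `z` smallest. (An item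
of an input with distinct values is among the `z` largest iff fewer than `z` inputs exceed it.) -/
def IsHalver (ε : ℝ) {k : ℕ} (N : ComparatorNetwork (2 * k)) : Prop :=
  ∀ x : Fin (2 * k) → ℝ, Function.Injective x → ∀ z : ℕ, 1 ≤ z → z ≤ k →
    (({w | w.val < k ∧ {i | N.run x w < x i}.ncard < z} : Set (Fin (2 * k))).ncard : ℝ) ≤ ε * z ∧
    (({w | k ≤ w.val ∧ {i | x i < N.run x w}.ncard < z} : Set (Fin (2 * k))).ncard : ℝ) ≤ ε * z

/-- The wires that `N` compares with some wire of `U`: the neighbour set of `U` in the graph whose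
edges are the comparisons of `N`. -/
def ComparatorNetwork.neighbors {n : ℕ} (N : ComparatorNetwork n) (U : Set (Fin n)) : Set (Fin n) :=
  {w | ∃ u ∈ U, (u, w) ∈ N.layers.flatten ∨ (w, u) ∈ N.layers.flatten}

/-- The comparisons of `N`, on `2 * k` wires, form a `(d₀, ε)`-expander graph between the left half
and the right half of the wires, and are carried out in at most `d₀` parallel layers: every comparator
joins a left wire (which gets the minimum) and a right wire, every wire is in exactly `d₀` comparators,
and every set `U` of wires on one side satisfies `ε |Γ(U)| ≥ (1 - ε) min (ε k, |U|)`. -/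
structure IsExpanderNetwork (d₀ : ℕ) (ε : ℝ) {k : ℕ} (N : ComparatorNetwork (2 * k)) : Prop where
  depth_le : N.depth ≤ d₀
  bipartite : ∀ c ∈ N.layers.flatten, c.1.val < k ∧ k ≤ c.2.val
  regular : ∀ w, N.layers.flatten.countP (fun c => decide (c.1 = w ∨ c.2 = w)) = d₀
  expansion : ∀ U : Set (Fin (2 * k)), ((∀ u ∈ U, u.val < k) ∨ (∀ u ∈ U, k ≤ u.val)) →
    (1 - ε) * min (ε * k) (U.ncard : ℝ) ≤ ε * ((N.neighbors U).ncard : ℝ)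

/-! ## Separators

An array is a list of wires. A halver leaves its left output on the first half of its array and its
right output on the second half. -/

/-- Left half of an array. -/
def leftHalf {β : Type*} (a : List β) : List β := a.take (a.length / 2)

/-- Right half of an array. -/
def rightHalf {β : Type*} (a : List β) : List β := a.drop (a.length / 2)

/-- The seven halvers of a separator on the array `a`, in their four layers: the arrays on which
`H₀`; `H₁, H₂`; `H₃, H₄`; `H₅, H₆` work. -/
def separatorStages {β : Type*} (a : List β) : List (List (List β)) :=
  [[a],
   [leftHalf a, rightHalf a],
   [leftHalf (leftHalf a), rightHalf (rightHalf a)],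
   [leftHalf (leftHalf (leftHalf a)), rightHalf (rightHalf (rightHalf a))]]

/-- The output `A₁` of a separator: the left `1/16` of the array. -/
def outA1 {β : Type*} (a : List β) : List β := leftHalf (leftHalf (leftHalf (leftHalf a)))

/-- The output `A₂` of a separator: the rest of the left half. -/
def outA2 {β : Type*} (a : List β) : List β := (leftHalf a).drop (outA1 a).length

/-- The output `A₄` of a separator: the right `1/16` of the array. -/
def outA4 {β : Type*} (a : List β) : List β := rightHalf (rightHalf (rightHalf (rightHalf a)))

/-- The output `A₃` of a separator: the rest of the right half. -/
def outA3 {β : Type*} (a : List β) : List β :=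
  (rightHalf a).take ((rightHalf a).length - (outA4 a).length)

/-! ## The AKS sorting network of reduced depth

A node of depth `d` in the complete binary tree of a layer is a list `p` of `d` Booleans, `false` for
a left child and `true` for a right child; the head of the list is the last step, so that the parent of
`b :: p` is `p`, and the root is `[]`. -/

/-- `A₂` goes to the left child and `A₃` to the right child. -/
def toChild {β : Type*} (b : Bool) (a : List β) : List β := if b then outA3 a else outA2 a

/-- Input arrays of the separators of layer `0`. -/
def inputZero (n : ℕ) : List Bool → List (Fin n)
  | [] => List.finRange n
  | b :: p => toChild b (inputZero n p)

/-- Input arrays of the separators of layer `j + 1`, from those (`prev`) of layer `j`: the separator at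
`p` gets `A₁ ∪ A₄` of the left child of its copy in layer `j` on its left, `A₁ ∪ A₄` of the right child
on its right, and in between what its parent sends (the root: `A₁` and `A₄` of its own copy). -/
def inputSucc {n : ℕ} (prev : List Bool → List (Fin n)) : List Bool → List (Fin n)
  | [] => (outA1 (prev [false]) ++ outA4 (prev [false])) ++ (outA1 (prev []) ++ outA4 (prev [])) ++
      (outA1 (prev [true]) ++ outA4 (prev [true]))
  | b :: p => (outA1 (prev (false :: b :: p)) ++ outA4 (prev (false :: b :: p))) ++
      toChild b (inputSucc prev p) ++
      (outA1 (prev (true :: b :: p)) ++ outA4 (prev (true :: b :: p)))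

/-- `sepInput n j p` is the input array of the separator at node `p` of layer `j`. -/
def sepInput (n : ℕ) : ℕ → List Bool → List (Fin n)
  | 0 => inputZero n
  | j + 1 => inputSucc (sepInput n j)

/-- All nodes of depth `d`. -/
def nodesAt : ℕ → List (List Bool)
  | 0 => [[]]
  | d + 1 => (nodesAt d).flatMap fun p => [false :: p, true :: p]

/-- The separators that work in time slot `t`: those at depth `d` of layer `j` with `d + 2 j = t`, where
`j ≤ J` and `d ≤ D - j`. -/
def separatorsAt (J D t : ℕ) : List (ℕ × List Bool) :=
  (List.range (J + 1)).flatMap fun j =>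
    (List.range (D - j + 1)).flatMap fun d =>
      if d + 2 * j = t then (nodesAt d).map fun p => (j, p) else []

/-- The layers of halvers of the network with parameters `J = j_max` and `D = d_max` (`J ≤ D`), each
given by the arrays on which its halvers work. There are `D + J + 1` time slots, as
`d + 2 j ≤ D + j ≤ D + J`, and four layers of halvers in each. -/
def halverLayers (n J D : ℕ) : List (List (List (Fin n))) :=
  (List.range (D + J + 1)).flatMap fun t =>
    (List.range 4).map fun s =>
      (separatorsAt J D t).flatMap fun q => (separatorStages (sepInput n q.1 q.2)).getD s []

/-- Layer number `r` of the network `N` placed on the array `a` (if `a` has odd length, its last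
wire is not compared). -/
def placeLayer {n : ℕ} (a : List (Fin n)) (N : ComparatorNetwork (2 * (a.length / 2))) (r : ℕ) :
    List (Fin n × Fin n) :=
  (N.layers.getD r []).map fun c =>
    (a.get ⟨c.1.val, by have := c.1.isLt; omega⟩, a.get ⟨c.2.val, by have := c.2.isLt; omega⟩)

/-- The layers of comparators: every layer of halvers is expanded into `d₀` layers of comparators, the
halver on an array of size `2 k` being `hal k`. -/
def aksLayers (n J D d₀ : ℕ) (hal : (k : ℕ) → ComparatorNetwork (2 * k)) :
    List (List (Fin n × Fin n)) :=
  (halverLayers n J D).flatMap fun ℓ =>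
    (List.range d₀).map fun r => ℓ.flatMap fun a => placeLayer a (hal (a.length / 2)) r

/-- What an outermost separator at node `p` with the final outputs `x` and `y` (`x` left of `y`) adds to
`L`: the root splits them, a node in the left subtree of the root sends both to `L`, and a node in the
right subtree sends both to `R`. -/
def toL {β : Type*} (p : List Bool) (x y : List β) : List β :=
  match p.getLast? with
  | none => x
  | some false => x ++ y
  | some true => []

/-- What it adds to `R`. -/
def toR {β : Type*} (p : List Bool) (x y : List β) : List β :=
  match p.getLast? with
  | none => y
  | some false => []
  | some true => x ++ y

/-- The left or right half of the output, according to `side`: the outputs `A₂, A₃` of the separators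
at the leaves (depth `D - j`) of each layer `j ≤ J`, and the outputs `A₁, A₄` of all separators of
layer `J`. -/
def collect (n J D : ℕ) (side : List Bool → List (Fin n) → List (Fin n) → List (Fin n)) :
    List (Fin n) :=
  ((List.range (J + 1)).flatMap fun j => (nodesAt (D - j)).flatMap fun p =>
      side p (outA2 (sepInput n j p)) (outA3 (sepInput n j p))) ++
  ((List.range (D - J + 1)).flatMap fun d => (nodesAt d).flatMap fun p =>
      side p (outA1 (sepInput n J p)) (outA4 (sepInput n J p)))

/-- `H`, with its output read off in the order `out` (position `i` of the output array is wire
`out i`), is an AKS sorting network of reduced depth with layers `0, …, J` of separators, layer `j`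
being a complete binary tree of depth `D - j`, whose separators consist of `ε`-halvers that are given
by `(d₀, ε)`-expander graphs. -/
def IsReducedAKS (ε : ℝ) (d₀ J D : ℕ) {n : ℕ} (H : ComparatorNetwork n)
    (out : Equiv.Perm (Fin n)) : Prop :=
  (∃ hal : (k : ℕ) → ComparatorNetwork (2 * k),
    (∀ k, IsHalver ε (hal k) ∧ IsExpanderNetwork d₀ ε (hal k)) ∧
    H.layers = aksLayers n J D d₀ hal) ∧
  List.ofFn out = collect n J D toL ++ collect n J D toR

/-- `lg lg n`, with logarithms to base `2`. -/
noncomputable def lglg (n : ℕ) : ℝ := Real.logb 2 (Real.logb 2 n)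

/-- `j_max = (c / lg (4 / e)) lg lg n`, rounded up. -/
noncomputable def jMax (c : ℝ) (n : ℕ) : ℕ := ⌈c / Real.logb 2 (4 / Real.exp 1) * lglg n⌉₊

/-- `d_max = (c / 5) lg lg n + j_max`, rounded up. -/
noncomputable def dMax (c : ℝ) (n : ℕ) : ℕ := ⌈c / 5 * lglg n⌉₊ + jMax c n

/-! ## Weak halvers -/

/-- `g` is a median of `x`: at least half of the items are `≤ g` and at least half are `≥ g`. -/
def IsMedian {n : ℕ} (x : Fin n → ℝ) (g : ℝ) : Prop :=
  n ≤ 2 * {i | x i ≤ g}.ncard ∧ n ≤ 2 * {i | g ≤ x i}.ncard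

/-- `H` with output order `out` is a weak `δ`-halver: the first half of the output holds at most `δ n`
items larger than the median, and the second half at most `δ n` items smaller than the median. -/
def IsWeakHalver (δ : ℝ) {n : ℕ} (H : ComparatorNetwork n) (out : Equiv.Perm (Fin n)) : Prop :=
  ∀ (x : Fin n → ℝ) (g : ℝ), IsMedian x g →
    (({i | 2 * i.val < n ∧ g < H.run x (out i)} : Set (Fin n)).ncard : ℝ) ≤ n * δ ∧
    (({i | n ≤ 2 * i.val ∧ H.run x (out i) < g} : Set (Fin n)).ncard : ℝ) ≤ n * δ

/-! The proof counts zeros and ones. Comparators commute with monotone maps, so thresholding at the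
median turns every input into a 0-1 input. The network is also monotone in its input, so it suffices
to treat inputs with exactly as many zeros as ones. Zeros belong on the left and ones on the right;
an item below a root on the wrong side is a stranger.

The separators at depth `d` of tree `j` work in time slot `d + 2 * j` on `n * sepSize j d` wires
each, whatever the input. A separator in which at most a sixteenth of the items are strangers sends
all but a fraction `4 / 175` of them to its extreme outputs, that is, back towards the root
(`IsArrayHalver.count_children_le`). The root creates strangers for two reasons: its halver errs,
and its input need not be balanced. Since the items in a time slot are conserved, the imbalance is
at most the number of strangers further down in earlier trees (`count_root_le`). A double induction
then gives at most `n / 200 * 32 ^ (-d) * sepSize j 0` strangers on each side at depth `d + 1` of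
tree `j` (`strangers_le`). It closes because strangers sent down shrink by `4 / 175`, while those
arriving from the previous tree were one level deeper, where the bound is smaller by `1 / 32`.

The wrong items of the output are the strangers that leave at the leaves, at most `n / 100 * 32 ^
(-(D - J))`, and those in the extreme outputs of the last tree. The latter outputs are all counted
as wrong; they hold at most `n / 4 * 2 ^ (D - J) * 2 ^ (-J)` items (`count_wrong_le`). The
parameters make both small compared with `n * (lg n) ^ (-c)`.

The halvers come from expanders. If a left wire ends with a one, then so do all its neighbours on
the right, so a set of misplaced ones together with its neighbourhood fits among the ones, and
expansion keeps the set small. The expanders are unions of random perfect matchings.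

It remains to see that the comparator network does what this analysis assumes. One recursion,
`treeArray`, describes both the wires and their contents. Counting the occurrences of a single wire
with the same conservation law shows that separators working at the same time use disjoint wires. -/

/-! ### Expanders from random permutations -/

open Finset in
/-- The permutations that map `U` into `T`. -/
def permsInto {k : ℕ} (U T : Finset (Fin k)) : Finset (Equiv.Perm (Fin k)) :=
  univ.filter fun σ => U.map σ.toEmbedding ⊆ T

open Finset in
theorem card_permsInto_eq {k : ℕ} {U U' : Finset (Fin k)} (h : U.card = U'.card)
    (T : Finset (Fin k)) : (permsInto U T).card = (permsInto U' T).card := by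
  obtain ⟨τ, hτ⟩ : ∃ τ : Equiv.Perm (Fin k), U.map τ.toEmbedding = U' := by
    obtain ⟨e⟩ : Nonempty ((U : Set (Fin k)) ≃ (U' : Set (Fin k))) := by
      exact ⟨Finset.equivOfCardEq h⟩
    refine ⟨e.extendSubtype, ?_⟩
    apply Finset.eq_of_subset_of_card_le
    · intro x hx
      simp only [mem_map, Equiv.coe_toEmbedding] at hx
      obtain ⟨a, ha, rfl⟩ := hx
      exact e.extendSubtype_mem a ha
    · simp [h]
  apply Finset.card_bij' (fun σ _ => σ * τ⁻¹) (fun σ _ => σ * τ)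
  · intro σ hσ
    simp only [permsInto, mem_filter, mem_univ, true_and] at hσ ⊢
    intro x hx
    simp only [← hτ, mem_map, Equiv.coe_toEmbedding] at hx
    obtain ⟨y, ⟨a, ha, rfl⟩, rfl⟩ := hx
    apply hσ
    simpa using ha
  · intro σ hσ
    simp only [permsInto, mem_filter, mem_univ, true_and] at hσ ⊢
    intro x hx
    simp only [mem_map, Equiv.coe_toEmbedding] at hx
    obtain ⟨a, ha, rfl⟩ := hx
    apply hσ
    simp only [← hτ, mem_map, Equiv.coe_toEmbedding]
    exact ⟨τ a, ⟨a, ha, rfl⟩, rfl⟩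
  · intro σ _; simp
  · intro σ _; simp

-- Double counting of the pairs of a permutation and a set of size `U.card` that it maps into `T`:
-- every set of that size has equally many permutations, and every permutation pulls back the
-- subsets of `T`.
open Finset in
theorem card_permsInto_mul_choose {k : ℕ} (U T : Finset (Fin k)) :
    (permsInto U T).card * k.choose U.card = k.factorial * T.card.choose U.card := by
  have h1 : ∑ U' ∈ powersetCard U.card (univ : Finset (Fin k)), (permsInto U' T).card =
      (permsInto U T).card * k.choose U.card := by
    rw [Finset.sum_congr rfl (fun U' hU' => card_permsInto_eq
      (Finset.mem_powersetCard.1 hU').2 T)]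
    simp [mul_comm]
  have h2 : ∑ U' ∈ powersetCard U.card (univ : Finset (Fin k)), (permsInto U' T).card =
      ∑ σ : Equiv.Perm (Fin k), T.card.choose U.card := by
    simp only [permsInto, card_filter]
    rw [Finset.sum_comm]
    refine Finset.sum_congr rfl fun σ _ => ?_
    rw [← card_filter]
    rw [← Finset.card_powersetCard]
    refine Finset.card_bij' (fun V _ => V.map σ.toEmbedding)
      (fun V _ => V.map σ.symm.toEmbedding) ?_ ?_ ?_ ?_
    · intro V hV
      simp only [mem_filter, mem_powersetCard] at hV ⊢
      exact ⟨hV.2, by simpa using hV.1.2⟩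
    · intro V hV
      simp only [mem_filter, mem_powersetCard] at hV ⊢
      refine ⟨⟨subset_univ _, by simpa using hV.2⟩, ?_⟩
      simpa [Finset.map_map] using hV.1
    · intro V hV
      simp [Finset.map_map]
    · intro V hV
      simp [Finset.map_map]
  rw [← h1, h2]
  simp [Fintype.card_perm]

theorem descFactorial_mul_pow_le {t k : ℕ} (h : t ≤ k) (s : ℕ) :
    t.descFactorial s * k ^ s ≤ k.descFactorial s * t ^ s := by
  induction s with
  | zero => simp
  | succ s ih =>
    have h1 : (t - s) * k ≤ (k - s) * t := by
      rcases le_total t s with hs | hs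
      · simp [Nat.sub_eq_zero_of_le hs]
      · obtain ⟨a, rfl⟩ := Nat.exists_eq_add_of_le hs
        obtain ⟨b, rfl⟩ := Nat.exists_eq_add_of_le h
        have e1 : s + a - s = a := by omega
        have e2 : s + a + b - s = a + b := by omega
        rw [e1, e2]
        nlinarith [Nat.zero_le (s * b)]
    calc t.descFactorial (s + 1) * k ^ (s + 1)
        = ((t - s) * k) * (t.descFactorial s * k ^ s) := by
          rw [Nat.descFactorial_succ, pow_succ]; ring
      _ ≤ ((k - s) * t) * (k.descFactorial s * t ^ s) := Nat.mul_le_mul h1 ih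
      _ = _ := by rw [Nat.descFactorial_succ, pow_succ]; ring

theorem choose_mul_pow_le {t k : ℕ} (h : t ≤ k) (s : ℕ) :
    t.choose s * k ^ s ≤ k.choose s * t ^ s := by
  have := descFactorial_mul_pow_le h s
  rw [Nat.descFactorial_eq_factorial_mul_choose, Nat.descFactorial_eq_factorial_mul_choose,
    mul_assoc, mul_assoc] at this
  exact Nat.le_of_mul_le_mul_left this (Nat.factorial_pos s)

/-- A random permutation maps `U` into `T` with probability at most `(|T| / k) ^ |U|`. -/
theorem card_permsInto_le {k : ℕ} (U T : Finset (Fin k)) :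
    ((permsInto U T).card : ℝ) ≤ k.factorial * ((T.card : ℝ) / k) ^ U.card := by
  have hU : U.card ≤ k := by simpa using Finset.card_le_univ U
  have hT : T.card ≤ k := by simpa using Finset.card_le_univ T
  have h1 := card_permsInto_mul_choose U T
  have h2 := choose_mul_pow_le hT U.card
  have hc : 0 < k.choose U.card := Nat.choose_pos hU
  rcases Nat.eq_zero_or_pos k with rfl | hk
  · have hU0 : U.card = 0 := by omega
    have : (permsInto U T).card ≤ Fintype.card (Equiv.Perm (Fin 0)) := Finset.card_le_univ _
    rw [Fintype.card_perm, Fintype.card_fin] at this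
    rw [hU0, pow_zero, mul_one]
    exact_mod_cast this
  rw [div_pow, ← mul_div_assoc, le_div_iff₀ (by positivity)]
  have h3 : (permsInto U T).card * k ^ U.card * k.choose U.card ≤
      k.factorial * T.card ^ U.card * k.choose U.card := by
    calc _ = ((permsInto U T).card * k.choose U.card) * k ^ U.card := by ring
      _ = k.factorial * (T.card.choose U.card * k ^ U.card) := by rw [h1]; ring
      _ ≤ k.factorial * (k.choose U.card * T.card ^ U.card) := Nat.mul_le_mul_left _ h2
      _ = _ := by ring
  exact_mod_cast Nat.le_of_mul_le_mul_right h3 hc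

/-- A single term of the binomial expansion of `(1 + y) ^ k ≤ exp (y * k)`. Leaving `y` free allows
the same `y` for both binomial coefficients in the union bound. -/
theorem choose_le_exp_mul_inv_pow (k m : ℕ) {y : ℝ} (hy : 0 < y) :
    (k.choose m : ℝ) ≤ Real.exp (y * k) * y⁻¹ ^ m := by
  have h1 : (k.choose m : ℝ) * y ^ m ≤ (1 + y) ^ k := by
    rcases lt_or_ge k m with h | h
    · rw [Nat.choose_eq_zero_of_lt h]; simp; positivity
    rw [add_comm, add_pow]
    refine le_trans (le_of_eq ?_) (Finset.single_le_sum (f := fun i => y ^ i * 1 ^ (k - i) *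
      (k.choose i : ℝ)) (fun i _ => by positivity) (Finset.mem_range.2 (Nat.lt_succ_of_le h)))
    simp [mul_comm]
  have h2 : (1 + y) ^ k ≤ Real.exp (y * k) := by
    rw [mul_comm, Real.exp_nat_mul]
    exact pow_le_pow_left₀ (by positivity) (by linarith [Real.add_one_le_exp y]) k
  rw [inv_pow, ← div_eq_mul_inv, le_div_iff₀ (by positivity)]
  exact h1.trans h2

/-- The expansion threshold: neighbourhoods of sets of size `s` should be larger than this. -/
noncomputable def expThreshold (A k s : ℕ) : ℕ := ⌈(A : ℝ) * min ((k : ℝ) / (A + 1)) s⌉₊ - 1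

/-- The share of sets of size `s` in the union bound: choices of `U`, choices of a target `T` for
its neighbourhood, and the probability that all permutations map `U` into `T`. Of the `A + 1 + d'`
permutations, `A + 1` pay for the two binomial coefficients and the other `d'` give the decay. -/
theorem expThreshold_term_le (A : ℕ) (d' : ℕ)
    (hd : Real.exp 2 * (A : ℝ) ^ (A + 1) * ((A : ℝ) / (A + 1)) ^ d' ≤ 1 / 4)
    {k s : ℕ} (hA : 0 < A) (hk : 0 < k) (hs : 0 < s) :
    (k.choose s : ℝ) * k.choose (expThreshold A k s) *
      (((expThreshold A k s : ℝ) / k) ^ s) ^ (A + 1 + d') ≤ (1 / 4) ^ s := by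
  set τ := expThreshold A k s with hτ
  -- `y * k` is the size of `U` capped at `k / (A + 1)`, so that `A * y * k` bounds the size of the
  -- target.
  set y : ℝ := min (1 / (A + 1)) (s / k) with hy
  have hA' : (0 : ℝ) < A := by exact_mod_cast hA
  have hk' : (0 : ℝ) < k := by exact_mod_cast hk
  have hs' : (0 : ℝ) < s := by exact_mod_cast hs
  have hy0 : 0 < y := by rw [hy]; positivity
  have hy1 : y ≤ 1 / (A + 1) := min_le_left _ _
  have hy1' : y ≤ 1 := hy1.trans (by rw [div_le_one (by positivity)]; linarith)
  have hys : y * k ≤ s := by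
    have : y ≤ s / k := min_le_right _ _
    rwa [le_div_iff₀ hk'] at this
  have hmin : min ((k : ℝ) / (A + 1)) s = y * k := by
    rw [hy, min_mul_of_nonneg _ _ hk'.le, div_mul_cancel₀ _ hk'.ne']; congr 1; ring
  have hτle : (τ : ℝ) ≤ A * (y * k) := by
    have h0 : 0 < A * (y * k) := by positivity
    have h1 : τ + 1 = ⌈(A : ℝ) * (y * k)⌉₊ := by
      rw [hτ, expThreshold, hmin]
      have := Nat.ceil_pos.2 h0
      omega
    have h2 := Nat.ceil_lt_add_one h0.le
    rw [← h1] at h2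
    push_cast at h2
    linarith
  have hτA : τ ≤ A * s := by
    have : (τ : ℝ) ≤ A * s := hτle.trans (by gcongr)
    exact_mod_cast this
  have hyi : 1 ≤ y⁻¹ := (one_le_inv₀ hy0).2 hy1'
  have hexp : Real.exp (y * k) ≤ Real.exp 1 ^ s := by
    rw [← Real.exp_nat_mul]; exact Real.exp_le_exp.2 (by simpa using hys)
  have c1 : (k.choose s : ℝ) ≤ Real.exp 1 ^ s * y⁻¹ ^ s :=
    (choose_le_exp_mul_inv_pow k s hy0).trans (by gcongr)
  have c2 : (k.choose τ : ℝ) ≤ Real.exp 1 ^ s * y⁻¹ ^ (A * s) :=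
    (choose_le_exp_mul_inv_pow k τ hy0).trans
      (mul_le_mul hexp (pow_le_pow_right₀ hyi hτA) (by positivity) (by positivity))
  have c3 : (τ : ℝ) / k ≤ A * y := by rw [div_le_iff₀ hk']; linarith
  have hAy : A * y ≤ A / (A + 1) := by
    calc A * y ≤ A * (1 / (A + 1)) := by gcongr
      _ = _ := by ring
  calc (k.choose s : ℝ) * k.choose τ * (((τ : ℝ) / k) ^ s) ^ (A + 1 + d')
      ≤ (Real.exp 1 ^ s * y⁻¹ ^ s) * (Real.exp 1 ^ s * y⁻¹ ^ (A * s)) *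
        ((A * y) ^ s) ^ (A + 1 + d') := by gcongr
    _ = (Real.exp 2 * (A : ℝ) ^ (A + 1) * (A * y) ^ d') ^ s := by
        have e2 : Real.exp 2 = Real.exp 1 * Real.exp 1 := by rw [← Real.exp_add]; norm_num
        have e3 : y⁻¹ ^ s * y⁻¹ ^ (A * s) * ((A * y) ^ s) ^ (A + 1 + d') =
            ((A : ℝ) ^ (A + 1) * (A * y) ^ d') ^ s := by
          have : ((A * y) ^ s) ^ (A + 1 + d') =
              ((A : ℝ) ^ (A + 1) * (A * y) ^ d') ^ s * (y ^ s * y ^ (A * s)) := by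
            rw [← pow_mul, mul_comm s, pow_mul, pow_add, mul_pow, ← pow_add y,
              show s + A * s = (A + 1) * s by ring, pow_mul y, ← mul_pow]
            ring
          rw [this, inv_pow, inv_pow]
          field_simp
        rw [e2]
        calc _ = (Real.exp 1 * Real.exp 1) ^ s *
              (y⁻¹ ^ s * y⁻¹ ^ (A * s) * ((A * y) ^ s) ^ (A + 1 + d')) := by
              rw [mul_pow]; ring
          _ = _ := by rw [e3, ← mul_pow]; congr 1; ring
    _ ≤ (1 / 4) ^ s := by
        refine pow_le_pow_left₀ (by positivity) (le_trans ?_ hd) s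
        gcongr

open Finset in
/-- The `d`-tuples of permutations for which some nonempty set expands too little. -/
noncomputable def badTuples (A d k : ℕ) : Finset (Fin d → Equiv.Perm (Fin k)) :=
  univ.filter fun σ => ∃ U : Finset (Fin k), U.Nonempty ∧
    ((univ.biUnion fun i => U.map (σ i).toEmbedding).card : ℝ) <
      A * min ((k : ℝ) / (A + 1)) U.card

open Finset in
theorem card_badTuples_le (A d' : ℕ) (hA : 0 < A)
    (hd : Real.exp 2 * (A : ℝ) ^ (A + 1) * ((A : ℝ) / (A + 1)) ^ d' ≤ 1 / 4) {k : ℕ} (hk : 0 < k) :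
    ((badTuples A (A + 1 + d') k).card : ℝ) ≤ (1 / 3) * (k.factorial : ℝ) ^ (A + 1 + d') := by
  classical
  set d := A + 1 + d' with hdd
  let F : ℕ → Finset (Fin d → Equiv.Perm (Fin k)) := fun s =>
    (powersetCard s (univ : Finset (Fin k))).biUnion fun U =>
      (powersetCard (expThreshold A k s) (univ : Finset (Fin k))).biUnion fun T =>
        Fintype.piFinset fun _ : Fin d => permsInto U T
  have hsub : badTuples A d k ⊆ (Icc 1 k).biUnion F := by
    intro σ hσ
    simp only [badTuples, mem_filter, mem_univ, true_and] at hσ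
    obtain ⟨U, hU, hlt⟩ := hσ
    have hUk : U.card ≤ k := by simpa using Finset.card_le_univ U
    have hle : (univ.biUnion fun i => U.map (σ i).toEmbedding).card ≤ expThreshold A k U.card := by
      have := Nat.lt_ceil.2 hlt
      unfold expThreshold
      omega
    have hle2 : expThreshold A k U.card ≤ (univ : Finset (Fin k)).card := by
      rw [card_univ, Fintype.card_fin, expThreshold]
      have : ⌈(A : ℝ) * min ((k : ℝ) / (A + 1)) U.card⌉₊ ≤ k := by
        apply Nat.ceil_le.2
        calc (A : ℝ) * min ((k : ℝ) / (A + 1)) U.card ≤ A * ((k : ℝ) / (A + 1)) := by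
              gcongr; exact min_le_left _ _
          _ ≤ k := by rw [← mul_div_assoc, div_le_iff₀ (by positivity)]; nlinarith
      omega
    -- Enlarging the neighbourhood to exactly the threshold size leaves one size of `T` to sum over
    -- for each size of `U`.
    obtain ⟨T, hT1, -, hT2⟩ := exists_subsuperset_card_eq (subset_univ _) hle hle2
    refine mem_biUnion.2 ⟨U.card, mem_Icc.2 ⟨hU.card_pos, hUk⟩, ?_⟩
    refine mem_biUnion.2 ⟨U, by simp [mem_powersetCard], ?_⟩
    refine mem_biUnion.2 ⟨T, by simp [mem_powersetCard, hT2], ?_⟩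
    rw [Fintype.mem_piFinset]
    intro i
    simp only [permsInto, mem_filter, mem_univ, true_and]
    exact (subset_biUnion_of_mem (fun i => U.map (σ i).toEmbedding) (mem_univ i)).trans hT1
  have hF : ∀ s ∈ Icc 1 k, ((F s).card : ℝ) ≤ (k.factorial : ℝ) ^ d * (1 / 4) ^ s := by
    intro s hs
    rw [mem_Icc] at hs
    have h1 : ((F s).card : ℝ) ≤ ∑ U ∈ powersetCard s (univ : Finset (Fin k)),
        ∑ T ∈ powersetCard (expThreshold A k s) (univ : Finset (Fin k)),
          (k.factorial * ((expThreshold A k s : ℝ) / k) ^ s) ^ d := by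
      have : (F s).card ≤ ∑ U ∈ powersetCard s (univ : Finset (Fin k)),
          ∑ T ∈ powersetCard (expThreshold A k s) (univ : Finset (Fin k)),
            (permsInto U T).card ^ d := by
        refine card_biUnion_le.trans (sum_le_sum fun U _ => card_biUnion_le.trans
          (sum_le_sum fun T _ => ?_))
        simp [Fintype.card_piFinset]
      refine le_trans (Nat.cast_le (α := ℝ).2 this) ?_
      push_cast
      refine sum_le_sum fun U hU => sum_le_sum fun T hT => ?_
      rw [mem_powersetCard] at hU hT
      refine pow_le_pow_left₀ (by positivity) ?_ d
      have := card_permsInto_le U T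
      rwa [hU.2, hT.2] at this
    refine h1.trans ?_
    rw [sum_const, sum_const, card_powersetCard, card_powersetCard, card_univ, Fintype.card_fin,
      nsmul_eq_mul, nsmul_eq_mul, mul_pow]
    have := expThreshold_term_le A d' hd hA hk (s := s) (by omega)
    calc _ = (k.factorial : ℝ) ^ d * ((k.choose s : ℝ) * k.choose (expThreshold A k s) *
          (((expThreshold A k s : ℝ) / k) ^ s) ^ d) := by ring
      _ ≤ _ := by gcongr
  have hgeom : ∑ s ∈ Icc 1 k, (1 / 4 : ℝ) ^ s ≤ 1 / 3 := by
    have h : ∀ k : ℕ, ∑ s ∈ Icc 1 k, (1 / 4 : ℝ) ^ s = 1 / 3 - (1 / 3) * (1 / 4) ^ k := by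
      intro k
      induction k with
      | zero => simp
      | succ k ih => rw [Finset.sum_Icc_succ_top (by omega), ih, pow_succ]; ring
    rw [h]
    have : (0 : ℝ) ≤ (1 / 3) * (1 / 4) ^ k := by positivity
    linarith
  calc ((badTuples A d k).card : ℝ) ≤ ((Icc 1 k).biUnion F).card := by
        exact_mod_cast card_le_card hsub
    _ ≤ ∑ s ∈ Icc 1 k, ((F s).card : ℝ) := by exact_mod_cast card_biUnion_le
    _ ≤ ∑ s ∈ Icc 1 k, (k.factorial : ℝ) ^ d * (1 / 4) ^ s := sum_le_sum hF
    _ = (k.factorial : ℝ) ^ d * ∑ s ∈ Icc 1 k, (1 / 4 : ℝ) ^ s := by rw [mul_sum]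
    _ ≤ (k.factorial : ℝ) ^ d * (1 / 3) := by gcongr
    _ = _ := by ring

open Finset in
/-- Existence of bounded-degree bipartite expanders, as unions of permutations. -/
theorem exists_expander (A : ℕ) (hA : 0 < A) : ∃ d : ℕ, ∀ k : ℕ,
    ∃ σ : Fin d → Equiv.Perm (Fin k), ∀ U : Finset (Fin k),
      (A * min ((k : ℝ) / (A + 1)) U.card ≤
        (univ.biUnion fun i => U.map (σ i).toEmbedding).card) ∧
      (A * min ((k : ℝ) / (A + 1)) U.card ≤
        (univ.biUnion fun i => U.map (σ i).symm.toEmbedding).card) := by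
  classical
  have hA' : (0 : ℝ) < A := by exact_mod_cast hA
  -- The choice of `d'` depends on `A` only, which makes the degree independent of `k`.
  obtain ⟨d', hd'⟩ : ∃ d' : ℕ,
      Real.exp 2 * (A : ℝ) ^ (A + 1) * ((A : ℝ) / (A + 1)) ^ d' ≤ 1 / 4 := by
    have hr : (A : ℝ) / (A + 1) < 1 := by rw [div_lt_one (by positivity)]; linarith
    obtain ⟨d', h⟩ := exists_pow_lt_of_lt_one
      (show (0 : ℝ) < 1 / 4 / (Real.exp 2 * (A : ℝ) ^ (A + 1)) by positivity) hr
    refine ⟨d', ?_⟩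
    rw [lt_div_iff₀ (by positivity)] at h
    linarith
  refine ⟨A + 1 + d', fun k => ?_⟩
  set d := A + 1 + d' with hd
  rcases Nat.eq_zero_or_pos k with rfl | hk
  · refine ⟨fun _ => 1, fun U => ?_⟩
    simp
  let B := badTuples A d k
  let B' := B.map ⟨fun σ : Fin d → Equiv.Perm (Fin k) => fun i => (σ i).symm, by
    intro σ τ h
    funext i
    have := congrFun h i
    simpa using congrArg Equiv.symm this⟩
  have hB : (B.card : ℝ) ≤ 1 / 3 * (k.factorial : ℝ) ^ d := card_badTuples_le A d' hA hd' hk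
  have hB' : B'.card = B.card := card_map _
  have hlt : (B ∪ B').card < (univ : Finset (Fin d → Equiv.Perm (Fin k))).card := by
    have h1 : ((B ∪ B').card : ℝ) ≤ B.card + B.card := by
      have := card_union_le B B'
      rw [hB'] at this
      exact_mod_cast this
    have h2 : ((univ : Finset (Fin d → Equiv.Perm (Fin k))).card : ℝ) =
        (k.factorial : ℝ) ^ d := by
      simp [Fintype.card_perm]
    have h3 : (0 : ℝ) < (k.factorial : ℝ) ^ d := by positivity
    have : ((B ∪ B').card : ℝ) < (univ : Finset (Fin d → Equiv.Perm (Fin k))).card := by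
      rw [h2]; linarith
    exact_mod_cast this
  obtain ⟨σ, -, hσ⟩ := exists_mem_notMem_of_card_lt_card hlt
  rw [mem_union, not_or] at hσ
  obtain ⟨h1, h2⟩ := hσ
  have key : ∀ τ : Fin d → Equiv.Perm (Fin k), τ ∉ B → ∀ U : Finset (Fin k),
      A * min ((k : ℝ) / (A + 1)) U.card ≤
        (univ.biUnion fun i => U.map (τ i).toEmbedding).card := by
    intro τ hτ U
    rcases U.eq_empty_or_nonempty with rfl | hU
    · have : (0 : ℝ) ≤ (k : ℝ) / (A + 1) := by positivity
      simp [this]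
    · by_contra hcon
      exact hτ (by simpa [B, badTuples] using ⟨U, hU, not_le.1 hcon⟩)
  refine ⟨σ, fun U => ⟨key σ h1 U, key (fun i => (σ i).symm) (fun hmem => h2 ?_) U⟩⟩
  exact mem_map.2 ⟨_, hmem, rfl⟩

/-! ### Comparator networks: monotone maps, monotonicity, conservation of items -/

section Networks

variable {n : ℕ} {α β : Type*} [LinearOrder α] [LinearOrder β]

theorem ComparatorNetwork.run_eq_foldl_flatten (N : ComparatorNetwork n) (x : Fin n → α) :
    N.run x = N.layers.flatten.foldl applyComparator x := by
  rw [ComparatorNetwork.run, List.foldl_flatten]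

theorem applyComparator_map {f : α → β} (hf : Monotone f) (x : Fin n → α) (c : Fin n × Fin n) :
    applyComparator (f ∘ x) c = f ∘ applyComparator x c := by
  funext w
  simp only [applyComparator, Function.comp]
  split_ifs
  · rw [hf.map_min]
  · rw [hf.map_max]
  · rfl

theorem foldl_applyComparator_map {f : α → β} (hf : Monotone f) (cs : List (Fin n × Fin n))
    (x : Fin n → α) :
    cs.foldl applyComparator (f ∘ x) = f ∘ cs.foldl applyComparator x := by
  induction cs generalizing x with
  | nil => rfl
  | cons c cs ih => rw [List.foldl_cons, List.foldl_cons, applyComparator_map hf, ih]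

theorem ComparatorNetwork.run_map {f : α → β} (hf : Monotone f) (N : ComparatorNetwork n)
    (x : Fin n → α) : N.run (f ∘ x) = f ∘ N.run x := by
  rw [run_eq_foldl_flatten, run_eq_foldl_flatten, foldl_applyComparator_map hf]

theorem applyComparator_mono {x y : Fin n → α} (h : x ≤ y) (c : Fin n × Fin n) :
    applyComparator x c ≤ applyComparator y c := by
  intro w
  simp only [applyComparator]
  split_ifs
  · exact min_le_min (h _) (h _)
  · exact max_le_max (h _) (h _)
  · exact h w

theorem ComparatorNetwork.run_mono (N : ComparatorNetwork n) {x y : Fin n → α} (h : x ≤ y) :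
    N.run x ≤ N.run y := by
  rw [run_eq_foldl_flatten, run_eq_foldl_flatten]
  generalize N.layers.flatten = cs
  induction cs generalizing x y with
  | nil => exact h
  | cons c cs ih => exact ih (applyComparator_mono h c)

theorem applyComparator_eq_comp_perm (x : Fin n → α) (c : Fin n × Fin n) :
    ∃ π : Equiv.Perm (Fin n), applyComparator x c = x ∘ π := by
  rcases le_total (x c.1) (x c.2) with h | h
  · refine ⟨1, funext fun w => ?_⟩
    simp only [applyComparator, min_eq_left h, max_eq_right h]
    split_ifs with h1 h2 <;> simp_all
  · refine ⟨Equiv.swap c.1 c.2, funext fun w => ?_⟩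
    simp only [applyComparator, min_eq_right h, max_eq_left h, Function.comp]
    split_ifs with h1 h2
    · simp [h1]
    · simp [h2]
    · rw [Equiv.swap_apply_of_ne_of_ne h1 h2]

theorem ComparatorNetwork.run_eq_comp_perm (N : ComparatorNetwork n) (x : Fin n → α) :
    ∃ π : Equiv.Perm (Fin n), N.run x = x ∘ π := by
  rw [run_eq_foldl_flatten]
  generalize N.layers.flatten = cs
  induction cs generalizing x with
  | nil => exact ⟨1, by simp⟩
  | cons c cs ih =>
    obtain ⟨π, hπ⟩ := applyComparator_eq_comp_perm x c
    obtain ⟨ρ, hρ⟩ := ih (applyComparator x c)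
    exact ⟨π * ρ, by rw [List.foldl_cons, hρ, hπ]; rfl⟩

/-- If all comparators join a wire below `k` to a wire that is not, then the contents of the wires
below `k` decrease and those of the others increase. -/
theorem foldl_applyComparator_bipartite {k : ℕ} (cs : List (Fin n × Fin n))
    (hcs : ∀ c ∈ cs, c.1.val < k ∧ k ≤ c.2.val) (x : Fin n → α) :
    (∀ w : Fin n, w.val < k → cs.foldl applyComparator x w ≤ x w) ∧
    (∀ w : Fin n, k ≤ w.val → x w ≤ cs.foldl applyComparator x w) ∧
    ∀ c ∈ cs, cs.foldl applyComparator x c.1 ≤ cs.foldl applyComparator x c.2 := by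
  induction cs generalizing x with
  | nil => simp
  | cons c cs ih =>
    obtain ⟨h1, h2, h3⟩ := ih (fun c hc => hcs c (by simp [hc])) (applyComparator x c)
    obtain ⟨hc1, hc2⟩ := hcs c (by simp)
    have hne : c.2 ≠ c.1 := fun h => by rw [h] at hc2; omega
    simp only [List.foldl_cons]
    refine ⟨fun w hw => (h1 w hw).trans ?_, fun w hw => le_trans ?_ (h2 w hw), ?_⟩
    · simp only [applyComparator]
      split_ifs with e1 e2
      · rw [e1]; exact min_le_left _ _
      · rw [e2] at hw; omega
      · exact le_rfl
    · simp only [applyComparator]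
      split_ifs with e1 e2
      · rw [e1] at hw; omega
      · rw [e2]; exact le_max_right _ _
      · exact le_rfl
    · intro c' hc'
      rcases List.mem_cons.1 hc' with rfl | hc'
      -- A comparator orders its two wires when it acts; afterwards its left wire can only decrease
      -- and its right wire only increase.
      · calc _ ≤ applyComparator x c' c'.1 := h1 _ hc1
          _ ≤ applyComparator x c' c'.2 := by simp [applyComparator, hne]
          _ ≤ _ := h2 _ hc2
      · exact h3 c' hc'

theorem ComparatorNetwork.card_run_filter (N : ComparatorNetwork n) (x : Fin n → α) (v : α) :
    (Finset.univ.filter fun w => N.run x w = v).card = (Finset.univ.filter fun w => x w = v).card := by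
  obtain ⟨π, hπ⟩ := N.run_eq_comp_perm x
  rw [hπ]
  refine Finset.card_bij (fun w _ => π w) ?_ (fun _ _ _ _ h => π.injective h) ?_
  · intro w hw; simpa using hw
  · intro w hw; exact ⟨π.symm w, by simpa using hw, by simp⟩

end Networks

/-! ### Expander networks are halvers -/

/-- Here `u` counts misplaced items, `g` their neighbours and `z` all items of that kind. If `u`
exceeded `ε * z`, expansion would give `g ≥ (1 - ε) * z`, and `u + g` would exceed `z`. -/
theorem le_mul_of_expansion {ε u g z k : ℝ} (hε : 0 < ε) (hε1 : ε ≤ 1) (hz : z ≤ k)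
    (hexp : (1 - ε) * min (ε * k) u ≤ ε * g) (h : u + g ≤ z) : u ≤ ε * z := by
  by_contra hcon
  rw [not_le] at hcon
  have h1 : ε * z ≤ min (ε * k) u := le_min (by gcongr) hcon.le
  have h2 : (1 - ε) * (ε * z) ≤ ε * g := le_trans (by gcongr) hexp
  have h3 : (1 - ε) * z ≤ g := by
    have : ε * ((1 - ε) * z) ≤ ε * g := by linarith
    exact le_of_mul_le_mul_left this hε
  linarith

section ExpanderHalver

variable {k : ℕ} {N : ComparatorNetwork (2 * k)} {d₀ : ℕ} {ε : ℝ}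

theorem IsExpanderNetwork.run_le_of_neighbor (h : IsExpanderNetwork d₀ ε N)
    {α : Type*} [LinearOrder α] (x : Fin (2 * k) → α) {c : Fin (2 * k) × Fin (2 * k)}
    (hc : c ∈ N.layers.flatten) : N.run x c.1 ≤ N.run x c.2 := by
  rw [N.run_eq_foldl_flatten]
  exact (foldl_applyComparator_bipartite _ h.bipartite x).2.2 c hc

/-- Compared wires end up in order, so the neighbours of left wires that end with a one also end
with a one. They lie on the right, hence are disjoint from those left wires, and the number of ones
is preserved. -/
theorem IsExpanderNetwork.card_true_left_le (h : IsExpanderNetwork d₀ ε N) (hε : 0 < ε)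
    (hε1 : ε ≤ 1) (x : Fin (2 * k) → Bool) (hz : (Finset.univ.filter fun w => x w = true).card ≤ k) :
    ((Finset.univ.filter fun w => w.val < k ∧ N.run x w = true).card : ℝ) ≤
      ε * (Finset.univ.filter fun w => x w = true).card := by
  classical
  set U : Finset (Fin (2 * k)) := Finset.univ.filter fun w => w.val < k ∧ N.run x w = true with hU
  have hexp := h.expansion (U : Set (Fin (2 * k))) (Or.inl (by simp [hU]; tauto))
  rw [Set.ncard_coe_finset] at hexp
  refine le_mul_of_expansion hε hε1 (by exact_mod_cast hz) hexp ?_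
  have hfin : (N.neighbors (U : Set (Fin (2 * k)))).Finite := Set.toFinite _
  rw [Set.ncard_eq_toFinset_card _ hfin, ← N.card_run_filter x true]
  norm_cast
  rw [← Finset.card_union_of_disjoint]
  · apply Finset.card_le_card
    intro w hw
    rcases Finset.mem_union.1 hw with hw | hw
    · simp only [hU, Finset.mem_filter] at hw ⊢; tauto
    · rw [Set.Finite.mem_toFinset] at hw
      obtain ⟨u, hu, hc | hc⟩ := hw
      · have h1 := h.run_le_of_neighbor x hc
        simp only [hU, Finset.coe_filter, Set.mem_ofPred_eq] at hu
        rw [hu.2.2] at h1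
        simpa using top_le_iff.1 h1
      · have h1 := h.bipartite _ hc
        simp only [hU, Finset.coe_filter, Set.mem_ofPred_eq] at hu
        have := h1.2
        simp only at this
        omega
  · rw [Finset.disjoint_left]
    intro w hw hw'
    rw [Set.Finite.mem_toFinset] at hw'
    simp only [hU, Finset.mem_filter] at hw
    obtain ⟨u, hu, hc | hc⟩ := hw'
    · have h1 := (h.bipartite _ hc).2
      simp only at h1
      omega
    · have h1 := (h.bipartite _ hc).2
      simp only [hU, Finset.coe_filter, Set.mem_ofPred_eq] at hu h1
      omega

theorem IsExpanderNetwork.card_false_right_le (h : IsExpanderNetwork d₀ ε N) (hε : 0 < ε)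
    (hε1 : ε ≤ 1) (x : Fin (2 * k) → Bool)
    (hz : (Finset.univ.filter fun w => x w = false).card ≤ k) :
    ((Finset.univ.filter fun w => k ≤ w.val ∧ N.run x w = false).card : ℝ) ≤
      ε * (Finset.univ.filter fun w => x w = false).card := by
  classical
  set U : Finset (Fin (2 * k)) := Finset.univ.filter fun w => k ≤ w.val ∧ N.run x w = false with hU
  have hexp := h.expansion (U : Set (Fin (2 * k))) (Or.inr (by simp [hU]; tauto))
  rw [Set.ncard_coe_finset] at hexp
  refine le_mul_of_expansion hε hε1 (by exact_mod_cast hz) hexp ?_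
  have hfin : (N.neighbors (U : Set (Fin (2 * k)))).Finite := Set.toFinite _
  rw [Set.ncard_eq_toFinset_card _ hfin, ← N.card_run_filter x false]
  norm_cast
  rw [← Finset.card_union_of_disjoint]
  · apply Finset.card_le_card
    intro w hw
    rcases Finset.mem_union.1 hw with hw | hw
    · simp only [hU, Finset.mem_filter] at hw ⊢; tauto
    · rw [Set.Finite.mem_toFinset] at hw
      obtain ⟨u, hu, hc | hc⟩ := hw
      · have h1 := h.bipartite _ hc
        simp only [hU, Finset.coe_filter, Set.mem_ofPred_eq] at hu
        have := h1.1
        simp only at this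
        omega
      · have h1 := h.run_le_of_neighbor x hc
        simp only [hU, Finset.coe_filter, Set.mem_ofPred_eq] at hu
        rw [hu.2.2] at h1
        simpa using le_bot_iff.1 h1
  · rw [Finset.disjoint_left]
    intro w hw hw'
    rw [Set.Finite.mem_toFinset] at hw'
    simp only [hU, Finset.mem_filter] at hw
    obtain ⟨u, hu, hc | hc⟩ := hw'
    · have h1 := (h.bipartite _ hc).1
      simp only [hU, Finset.coe_filter, Set.mem_ofPred_eq] at hu h1
      omega
    · have h1 := (h.bipartite _ hc).1
      simp only at h1
      omega

/-- The smallest member of the set is exceeded by all its other members. -/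
theorem card_few_above_le {m : ℕ} {x : Fin m → ℝ} (hx : Function.Injective x) (z : ℕ) :
    (Finset.univ.filter fun w => {i | x w < x i}.ncard < z).card ≤ z := by
  classical
  set S := Finset.univ.filter fun w => {i | x w < x i}.ncard < z with hS
  by_contra hcon
  rw [not_le] at hcon
  obtain ⟨i, hi, hmin⟩ := S.exists_min_image x (Finset.card_pos.1 (by omega))
  have h1 : (S.erase i : Set (Fin m)) ⊆ {i' | x i < x i'} := by
    intro j hj
    have hj := Finset.mem_erase.1 (Finset.mem_coe.1 hj)
    exact lt_of_le_of_ne (hmin j hj.2) fun h => hj.1 (hx h).symm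
  have h2 := Set.ncard_le_ncard h1
  rw [Set.ncard_coe_finset, Finset.card_erase_of_mem hi] at h2
  have h3 : {i' | x i < x i'}.ncard < z := by simpa [hS] using hi
  omega

/-- Having fewer than `z` inputs above is a monotone 0-1 function of the value, so the bounds for
zeros and ones apply to its composition with the input. -/
theorem IsExpanderNetwork.isHalver (h : IsExpanderNetwork d₀ ε N) (hε : 0 < ε) (hε1 : ε ≤ 1) :
    IsHalver ε N := by
  classical
  intro x hx z hz1 hzk
  constructor
  · let f : ℝ → Bool := fun r => decide ({i | r < x i}.ncard < z)
    have hf : Monotone f := by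
      intro r s hrs
      simp only [f]
      rw [Bool.le_iff_imp]
      simp only [decide_eq_true_eq]
      intro hr
      refine lt_of_le_of_lt (Set.ncard_le_ncard fun i hi => ?_) hr
      exact lt_of_le_of_lt hrs hi
    have hcard : (Finset.univ.filter fun w => (f ∘ x) w = true).card ≤ z := by
      simpa [f] using card_few_above_le hx z
    have := h.card_true_left_le hε hε1 (f ∘ x) (hcard.trans hzk)
    rw [N.run_map hf] at this
    rw [Set.ncard_eq_toFinset_card']
    simp only [Set.toFinset_ofPred]
    refine le_trans (le_of_eq ?_) (this.trans ?_)
    · simp [f]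
    · gcongr
  · let f : ℝ → Bool := fun r => !decide ({i | x i < r}.ncard < z)
    have hf : Monotone f := by
      intro r s hrs
      simp only [f]
      rw [Bool.le_iff_imp]
      simp only [Bool.not_eq_true', decide_eq_false_iff_not, not_lt]
      intro hr
      refine hr.trans (Set.ncard_le_ncard fun i hi => ?_)
      exact lt_of_lt_of_le hi hrs
    have hcard : (Finset.univ.filter fun w => (f ∘ x) w = false).card ≤ z := by
      have := card_few_above_le (x := fun i => - x i) (neg_injective.comp hx) z
      simpa [f] using this
    have := h.card_false_right_le hε hε1 (f ∘ x) (hcard.trans hzk)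
    rw [N.run_map hf] at this
    rw [Set.ncard_eq_toFinset_card']
    simp only [Set.toFinset_ofPred]
    refine le_trans (le_of_eq ?_) (this.trans ?_)
    · simp [f]
    · gcongr

end ExpanderHalver

/-! ### Networks of perfect matchings -/

section ExpanderNetwork

variable {k d : ℕ}

/-- The left wire number `a`. -/
def leftWire (a : Fin k) : Fin (2 * k) := ⟨a, by omega⟩

/-- The right wire number `a`. -/
def rightWire (a : Fin k) : Fin (2 * k) := ⟨k + a, by omega⟩

/-- The layer of comparators given by a perfect matching. -/
def matchingLayer (σ : Equiv.Perm (Fin k)) : List (Fin (2 * k) × Fin (2 * k)) :=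
  (List.finRange k).map fun a => (leftWire a, rightWire (σ a))

theorem countP_matchingLayer (σ : Equiv.Perm (Fin k)) (w : Fin (2 * k)) :
    (matchingLayer σ).countP (fun c => decide (c.1 = w ∨ c.2 = w)) = 1 := by
  rw [matchingLayer, List.countP_map]
  have key : ∃ a : Fin k, ∀ b : Fin k, (leftWire b = w ∨ rightWire (σ b) = w) ↔ b = a := by
    rcases lt_or_ge w.val k with hw | hw
    · refine ⟨⟨w, hw⟩, fun b => ?_⟩
      simp only [leftWire, rightWire, Fin.ext_iff]
      omega
    · refine ⟨σ.symm ⟨w - k, by omega⟩, fun b => ?_⟩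
      rw [Equiv.eq_symm_apply]
      simp only [leftWire, rightWire, Fin.ext_iff]
      omega
  obtain ⟨a, ha⟩ := key
  have : ((fun c : Fin (2 * k) × Fin (2 * k) => decide (c.1 = w ∨ c.2 = w)) ∘
      fun b => (leftWire b, rightWire (σ b))) = fun b => b == a := by
    funext b
    simp only [Function.comp, ha]
    rfl
  rw [this]
  exact List.count_eq_one_of_mem (List.nodup_finRange k) (List.mem_finRange a)

/-- The comparator network of a union of perfect matchings. -/
def matchingNetwork (σ : Fin d → Equiv.Perm (Fin k)) : ComparatorNetwork (2 * k) where
  layers := List.ofFn fun i => matchingLayer (σ i)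
  disjoint := by
    intro ℓ hℓ
    obtain ⟨i, rfl⟩ := (List.mem_ofFn' _ _).1 hℓ
    simp only [matchingLayer]
    rw [List.flatMap_map, List.nodup_flatMap]
    constructor
    · intro a _
      simp [leftWire, rightWire, Fin.ext_iff]
      omega
    · refine (List.nodup_finRange k).pairwise_of_forall_ne ?_
      intro a _ b _ hab
      have h1 : (σ i a).val ≠ (σ i b).val := fun h => hab ((σ i).injective (Fin.ext h))
      have h2 : a.val ≠ b.val := fun h => hab (Fin.ext h)
      simp [Function.onFun, leftWire, rightWire, Fin.ext_iff]
      omega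

theorem mem_matchingNetwork_flatten (σ : Fin d → Equiv.Perm (Fin k))
    (c : Fin (2 * k) × Fin (2 * k)) :
    c ∈ (matchingNetwork σ).layers.flatten ↔ ∃ i a, c = (leftWire a, rightWire (σ i a)) := by
  simp only [matchingNetwork, List.mem_flatten, List.mem_ofFn', Set.mem_range]
  constructor
  · rintro ⟨ℓ, ⟨i, rfl⟩, hc⟩
    simp only [matchingLayer, List.mem_map] at hc
    obtain ⟨a, -, rfl⟩ := hc
    exact ⟨i, a, rfl⟩
  · rintro ⟨i, a, rfl⟩
    exact ⟨_, ⟨i, rfl⟩, List.mem_map.2 ⟨a, List.mem_finRange a, rfl⟩⟩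

-- The neighbours of a left set are its images under the permutations, those of a right set its
-- preimages; this is why expansion is needed for the inverses too. With `ε = 1 / (A + 1)` the ratio
-- `(1 - ε) / ε` is `A`.
open Finset in
theorem isExpanderNetwork_matchingNetwork {A : ℕ} (σ : Fin d → Equiv.Perm (Fin k))
    (hσ : ∀ U : Finset (Fin k),
      (A * min ((k : ℝ) / (A + 1)) U.card ≤
        (univ.biUnion fun i => U.map (σ i).toEmbedding).card) ∧
      (A * min ((k : ℝ) / (A + 1)) U.card ≤
        (univ.biUnion fun i => U.map (σ i).symm.toEmbedding).card)) :
    IsExpanderNetwork d (1 / (A + 1)) (matchingNetwork σ) where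
  depth_le := by simp [ComparatorNetwork.depth, matchingNetwork]
  bipartite := by
    intro c hc
    obtain ⟨i, a, rfl⟩ := (mem_matchingNetwork_flatten σ c).1 hc
    simp [leftWire, rightWire]
  regular := by
    intro w
    rw [List.countP_flatten]
    simp only [matchingNetwork, List.map_ofFn]
    rw [show (List.countP (fun c : Fin (2 * k) × Fin (2 * k) => decide (c.1 = w ∨ c.2 = w)) ∘
      fun i => matchingLayer (σ i)) = fun _ => 1 from funext fun i => countP_matchingLayer (σ i) w]
    simp
  expansion := by
    classical
    intro U hU
    have hA : (0 : ℝ) < A + 1 := by positivity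
    suffices h : A * min ((k : ℝ) / (A + 1)) U.ncard ≤
        (((matchingNetwork σ).neighbors U).ncard : ℝ) by
      have e : (1 - 1 / ((A : ℝ) + 1)) * min (1 / ((A : ℝ) + 1) * (k : ℝ)) (U.ncard : ℝ) =
          1 / (A + 1) * (A * min ((k : ℝ) / (A + 1)) U.ncard) := by
        rw [one_div_mul_eq_div]
        field_simp
        ring_nf
      rw [e]
      gcongr
    have hl : Function.Injective (leftWire (k := k)) := fun a b h => by
      simpa [leftWire, Fin.ext_iff] using h
    have hr : Function.Injective (rightWire (k := k)) := fun a b h => by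
      simpa [rightWire, Fin.ext_iff] using h
    rcases hU with hU | hU
    · set V : Finset (Fin k) := univ.filter fun a => leftWire a ∈ U with hV
      have hUV : U = (V.map ⟨leftWire, hl⟩ : Finset (Fin (2 * k))) := by
        ext u
        simp only [hV, coe_map, Function.Embedding.coeFn_mk, coe_filter, mem_univ, true_and,
          Set.mem_image, Set.mem_ofPred_eq]
        constructor
        · intro hu
          exact ⟨⟨u, hU u hu⟩, by simpa [leftWire] using hu, by simp [leftWire]⟩
        · rintro ⟨a, ha, rfl⟩
          exact ha
      have hc : U.ncard = V.card := by rw [hUV, Set.ncard_coe_finset, card_map]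
      rw [hc]
      refine (hσ V).1.trans ?_
      norm_cast
      rw [← card_map ⟨rightWire, hr⟩, ← Set.ncard_coe_finset]
      refine Set.ncard_le_ncard ?_
      intro w hw
      simp only [coe_map, Function.Embedding.coeFn_mk, Set.mem_image, mem_coe, mem_biUnion,
        mem_univ, true_and, mem_map] at hw
      obtain ⟨_, ⟨i, a, ha, rfl⟩, rfl⟩ := hw
      refine ⟨leftWire a, by simpa [hV] using ha, Or.inl ?_⟩
      exact (mem_matchingNetwork_flatten σ _).2 ⟨i, a, rfl⟩
    · set V : Finset (Fin k) := univ.filter fun a => rightWire a ∈ U with hV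
      have hUV : U = (V.map ⟨rightWire, hr⟩ : Finset (Fin (2 * k))) := by
        ext u
        simp only [hV, coe_map, Function.Embedding.coeFn_mk, coe_filter, mem_univ, true_and,
          Set.mem_image, Set.mem_ofPred_eq]
        constructor
        · intro hu
          have e : rightWire ⟨u - k, by have := hU u hu; omega⟩ = u := by
            have := hU u hu
            simp [rightWire, Fin.ext_iff]; omega
          exact ⟨⟨u - k, by have := hU u hu; omega⟩, by rwa [e], e⟩
        · rintro ⟨a, ha, rfl⟩
          exact ha
      have hc : U.ncard = V.card := by rw [hUV, Set.ncard_coe_finset, card_map]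
      rw [hc]
      refine (hσ V).2.trans ?_
      norm_cast
      rw [← card_map ⟨leftWire, hl⟩, ← Set.ncard_coe_finset]
      refine Set.ncard_le_ncard ?_
      intro w hw
      simp only [coe_map, Function.Embedding.coeFn_mk, Set.mem_image, mem_coe, mem_biUnion,
        mem_univ, true_and, mem_map] at hw
      obtain ⟨_, ⟨i, a, ha, rfl⟩, rfl⟩ := hw
      refine ⟨rightWire a, by simpa [hV] using ha, Or.inr ?_⟩
      exact (mem_matchingNetwork_flatten σ _).2 ⟨i, (σ i).symm a, by simp⟩

end ExpanderNetwork

/-- Families of expander networks of bounded depth on all even numbers of wires. -/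
theorem exists_expanderNetwork_family (A : ℕ) (hA : 0 < A) :
    ∃ (d : ℕ) (hal : (k : ℕ) → ComparatorNetwork (2 * k)),
      ∀ k, IsExpanderNetwork d (1 / ((A : ℝ) + 1)) (hal k) := by
  obtain ⟨d, h⟩ := exists_expander A hA
  choose σ hσ using h
  exact ⟨d, fun k => matchingNetwork (σ k), fun k => isExpanderNetwork_matchingNetwork (σ k) (hσ k)⟩

/-! ### The four outputs of a separator -/

section Arrays

variable {β γ : Type*}

theorem leftHalf_append_rightHalf (a : List β) : leftHalf a ++ rightHalf a = a :=
  List.take_append_drop _ _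

theorem outA1_append_outA2 (a : List β) : outA1 a ++ outA2 a = leftHalf a := by
  have h : outA1 a = (leftHalf a).take (outA1 a).length := by
    unfold outA1
    generalize leftHalf a = l
    simp only [leftHalf, List.take_take, List.length_take]
    congr 1
    omega
  conv_lhs => rw [h, outA2]
  exact List.take_append_drop _ _

theorem outA3_append_outA4 (a : List β) : outA3 a ++ outA4 a = rightHalf a := by
  have h : outA4 a = (rightHalf a).drop ((rightHalf a).length - (outA4 a).length) := by
    unfold outA4
    generalize rightHalf a = l
    simp only [rightHalf, List.drop_drop, List.length_drop]
    congr 1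
    omega
  calc outA3 a ++ outA4 a = (rightHalf a).take ((rightHalf a).length - (outA4 a).length) ++
        (rightHalf a).drop ((rightHalf a).length - (outA4 a).length) := by rw [← h]; rfl
    _ = rightHalf a := List.take_append_drop _ _

theorem outs_append (a : List β) : outA1 a ++ outA2 a ++ (outA3 a ++ outA4 a) = a := by
  rw [outA1_append_outA2, outA3_append_outA4, leftHalf_append_rightHalf]

theorem leftHalf_map (f : β → γ) (a : List β) : leftHalf (a.map f) = (leftHalf a).map f := by
  simp [leftHalf]

theorem rightHalf_map (f : β → γ) (a : List β) : rightHalf (a.map f) = (rightHalf a).map f := by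
  simp [rightHalf]

theorem outA1_map (f : β → γ) (a : List β) : outA1 (a.map f) = (outA1 a).map f := by
  simp [outA1, leftHalf_map]

theorem outA4_map (f : β → γ) (a : List β) : outA4 (a.map f) = (outA4 a).map f := by
  simp [outA4, rightHalf_map]

theorem outA2_map (f : β → γ) (a : List β) : outA2 (a.map f) = (outA2 a).map f := by
  simp [outA2, outA1_map, leftHalf_map]

theorem outA3_map (f : β → γ) (a : List β) : outA3 (a.map f) = (outA3 a).map f := by
  simp [outA3, outA4_map, rightHalf_map]

theorem toChild_map (f : β → γ) (b : Bool) (a : List β) :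
    toChild b (a.map f) = (toChild b a).map f := by
  cases b <;> simp [toChild, outA2_map, outA3_map]

theorem length_leftHalf (a : List β) : (leftHalf a).length = a.length / 2 := by
  simp [leftHalf]; omega

theorem length_rightHalf (a : List β) : (rightHalf a).length = a.length - a.length / 2 := by
  simp [rightHalf]

theorem length_outs {a : List β} {x : ℕ} (h : a.length = 16 * x) :
    (outA1 a).length = x ∧ (outA2 a).length = 7 * x ∧ (outA3 a).length = 7 * x ∧
      (outA4 a).length = x := by
  have h1 : (outA1 a).length = x := by simp only [outA1, length_leftHalf]; omega
  have h4 : (outA4 a).length = x := by simp only [outA4, length_rightHalf]; omega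
  refine ⟨h1, ?_, ?_, h4⟩
  · rw [outA2, List.length_drop, h1, length_leftHalf]; omega
  · rw [outA3, List.length_take, h4, length_rightHalf]; omega

theorem length_toChild {a : List β} {x : ℕ} (h : a.length = 16 * x) (b : Bool) :
    (toChild b a).length = 7 * x := by
  obtain ⟨-, h2, h3, -⟩ := length_outs h
  cases b <;> simp [toChild, h2, h3]

end Arrays

/-! ### The unbounded tree recursion -/

section Trees

variable {β : Type*}

/-- The arrays of layer `0` of the unbounded tree of separators, if a separator turns the contents `a`
into `S a`. -/
def treeZero (S : List β → List β) (root : List β) : List Bool → List β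
  | [] => root
  | b :: p => toChild b (S (treeZero S root p))

/-- The arrays of a layer of the unbounded tree of separators, from those of the layer before. -/
def treeSucc (S : List β → List β) (prev : List Bool → List β) : List Bool → List β
  | [] => (outA1 (S (prev [false])) ++ outA4 (S (prev [false]))) ++
      (outA1 (S (prev [])) ++ outA4 (S (prev []))) ++
      (outA1 (S (prev [true])) ++ outA4 (S (prev [true])))
  | b :: p => (outA1 (S (prev (false :: b :: p))) ++ outA4 (S (prev (false :: b :: p)))) ++
      toChild b (S (treeSucc S prev p)) ++
      (outA1 (S (prev (true :: b :: p))) ++ outA4 (S (prev (true :: b :: p))))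

/-- `treeArray S root j p` is the array that enters the separator at node `p` of layer `j` of the
unbounded network of separators. -/
def treeArray (S : List β → List β) (root : List β) : ℕ → List Bool → List β
  | 0 => treeZero S root
  | j + 1 => treeSucc S (treeArray S root j)

/-- With `S = id` the recursion routes the wires themselves. Whatever is shown for general `S`, such
as lengths and conservation, thus holds both for wires and for contents. -/
theorem sepInput_eq_treeArray (n j : ℕ) (p : List Bool) :
    sepInput n j p = treeArray id (List.finRange n) j p := by
  induction j generalizing p with
  | zero =>
    simp only [sepInput, treeArray]
    induction p with
    | nil => rfl
    | cons b p ih => simp only [inputZero, treeZero, ih, id]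
  | succ j ih =>
    simp only [sepInput, treeArray]
    have h : sepInput n j = treeArray id (List.finRange n) j := funext ih
    induction p with
    | nil => simp only [inputSucc, treeSucc, h, id]
    | cons b p ih' =>
      simp only [inputSucc, treeSucc, ih', id]
      simp only [h]

end Trees

/-! ### Sums over the nodes of a given depth -/

section SumAt

variable {M : Type*} [AddCommMonoid M]

/-- The sum of `f` over all nodes of depth `d`. -/
def sumAt : ℕ → (List Bool → M) → M
  | 0, f => f []
  | d + 1, f => sumAt d fun p => f (false :: p) + f (true :: p)

theorem sumAt_add (d : ℕ) (f g : List Bool → M) :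
    sumAt d (fun p => f p + g p) = sumAt d f + sumAt d g := by
  induction d generalizing f g with
  | zero => rfl
  | succ d ih =>
    simp only [sumAt]
    rw [← ih]
    congr 1; funext p; exact add_add_add_comm _ _ _ _

theorem sum_map_nodesAt (d : ℕ) (f : List Bool → M) : ((nodesAt d).map f).sum = sumAt d f := by
  induction d generalizing f with
  | zero => simp [nodesAt, sumAt]
  | succ d ih =>
    rw [nodesAt, sumAt, ← ih, List.map_flatMap, List.flatMap_def, List.sum_flatten, List.map_map]
    congr 2
    funext p
    simp

theorem length_of_mem_nodesAt {d : ℕ} {p : List Bool} (h : p ∈ nodesAt d) : p.length = d := by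
  induction d generalizing p with
  | zero => simpa [nodesAt] using h
  | succ d ih =>
    simp only [nodesAt, List.mem_flatMap] at h
    obtain ⟨q, hq, hp⟩ := h
    have := ih hq
    simp only [List.mem_cons, List.not_mem_nil, or_false] at hp
    rcases hp with rfl | rfl <;> simp [this]

theorem mem_nodesAt (p : List Bool) : p ∈ nodesAt p.length := by
  induction p with
  | nil => simp [nodesAt]
  | cons b p ih =>
    simp only [nodesAt, List.length_cons, List.mem_flatMap]
    exact ⟨p, ih, by cases b <;> simp⟩

theorem sumAt_congr {d : ℕ} {f g : List Bool → M} (h : ∀ p, p.length = d → f p = g p) :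
    sumAt d f = sumAt d g := by
  rw [← sum_map_nodesAt, ← sum_map_nodesAt]
  congr 1
  exact List.map_congr_left fun p hp => h p (length_of_mem_nodesAt hp)

/-- The nodes below a root, by the side of the root on which they are. -/
theorem sumAt_succ_sides (d : ℕ) (f : List Bool → M) :
    sumAt (d + 1) f = sumAt d (fun q => f (q ++ [false])) + sumAt d (fun q => f (q ++ [true])) := by
  induction d generalizing f with
  | zero => rfl
  | succ d ih =>
    rw [sumAt, ih]
    rfl

theorem sumAt_const (d : ℕ) (m : M) : sumAt d (fun _ => m) = 2 ^ d • m := by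
  induction d generalizing m with
  | zero => simp [sumAt]
  | succ d ih => simp only [sumAt]; rw [ih, ← two_nsmul, ← mul_nsmul', pow_succ]

theorem sumAt_zero_fun (d : ℕ) : sumAt d (fun _ => (0 : M)) = 0 := by
  rw [sumAt_const]; simp

theorem sumAt_mul_left {R : Type*} [NonUnitalNonAssocSemiring R] (d : ℕ) (a : R)
    (f : List Bool → R) : sumAt d (fun p => a * f p) = a * sumAt d f := by
  induction d generalizing f with
  | zero => rfl
  | succ d ih => simp only [sumAt]; rw [← ih]; simp [mul_add]

theorem sumAt_cast (d : ℕ) (f : List Bool → ℕ) :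
    ((sumAt d f : ℕ) : ℝ) = sumAt d (fun p => (f p : ℝ)) := by
  induction d generalizing f with
  | zero => rfl
  | succ d ih => simp only [sumAt]; rw [ih]; simp

theorem sumAt_mono {N : Type*} [AddCommMonoid N] [PartialOrder N] [IsOrderedAddMonoid N] {d : ℕ}
    {f g : List Bool → N} (h : ∀ p, p.length = d → f p ≤ g p) : sumAt d f ≤ sumAt d g := by
  rw [← sum_map_nodesAt, ← sum_map_nodesAt]
  exact List.sum_le_sum fun p hp => h p (length_of_mem_nodesAt hp)

theorem le_sumAt {d : ℕ} (f : List Bool → ℕ) {p : List Bool} (h : p.length = d) :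
    f p ≤ sumAt d f := by
  rw [← sum_map_nodesAt]
  exact List.single_le_sum (by simp) _ (List.mem_map_of_mem (h ▸ mem_nodesAt p))

end SumAt

/-! ### Conservation laws for flows through the trees -/

section Flow

/-- Amounts `c j p` that enter the separator at node `p` of layer `j`, and are split there into `up j p`
for the parent in the next layer and `dn b j p` for the child on side `b`. -/
structure TreeFlow (c up : ℕ → List Bool → ℕ) (dn : Bool → ℕ → List Bool → ℕ) (tot : ℕ) : Prop where
  split : ∀ j p, c j p = up j p + (dn false j p + dn true j p)
  zero_nil : c 0 [] = tot
  zero_cons : ∀ b p, c 0 (b :: p) = dn b 0 p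
  succ_nil : ∀ j, c (j + 1) [] = up j [] + (up j [false] + up j [true])
  succ_cons : ∀ j b p, c (j + 1) (b :: p) =
    dn b (j + 1) p + (up j (false :: b :: p) + up j (true :: b :: p))

variable {c up : ℕ → List Bool → ℕ} {dn : Bool → ℕ → List Bool → ℕ} {tot : ℕ}

namespace TreeFlow

theorem sumAt_split (h : TreeFlow c up dn tot) (j d : ℕ) :
    sumAt d (c j) = sumAt d (up j) + sumAt d (fun p => dn false j p + dn true j p) := by
  rw [← sumAt_add]
  exact sumAt_congr fun p _ => h.split j p

theorem sumAt_zero_succ (h : TreeFlow c up dn tot) (d : ℕ) :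
    sumAt (d + 1) (c 0) = sumAt d (fun p => dn false 0 p + dn true 0 p) := by
  rw [sumAt]
  exact sumAt_congr fun p _ => by rw [h.zero_cons, h.zero_cons]

theorem sumAt_succ_zero (h : TreeFlow c up dn tot) (j : ℕ) :
    sumAt 0 (c (j + 1)) = sumAt 0 (up j) + sumAt 1 (up j) := h.succ_nil j

theorem sumAt_succ_succ (h : TreeFlow c up dn tot) (j d : ℕ) :
    sumAt (d + 1) (c (j + 1)) =
      sumAt d (fun p => dn false (j + 1) p + dn true (j + 1) p) + sumAt (d + 2) (up j) := by
  simp only [sumAt]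
  rw [← sumAt_add]
  refine sumAt_congr fun p _ => ?_
  rw [h.succ_cons, h.succ_cons]
  exact add_add_add_comm _ _ _ _

/-- One step in time. Trees `0, …, j` in slot `2 * j + e + 1` hold what they sent down in slot `2 *
j + e` and what trees `i < j` sent up then; what tree `j` sends up goes to tree `j + 1` and is left
out. -/
theorem sum_diagonal (h : TreeFlow c up dn tot) (j e : ℕ) :
    ∑ i ∈ Finset.range (j + 1), sumAt (2 * (j - i) + e + 1) (c i) =
      ∑ i ∈ Finset.range (j + 1), sumAt (2 * (j - i) + e) (fun p => dn false i p + dn true i p) +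
      ∑ i ∈ Finset.range j, sumAt (2 * (j - i) + e) (up i) := by
  rw [Finset.sum_range_succ', Finset.sum_range_succ' _ j, h.sumAt_zero_succ, add_right_comm,
    ← Finset.sum_add_distrib]
  congr 1
  refine Finset.sum_congr rfl fun i hi => ?_
  rw [h.sumAt_succ_succ]
  have : i < j := Finset.mem_range.1 hi
  congr 2
  omega

/-- In slot `2 * j` everything is in one of the trees `0, …, j`. In slot `2 * j + 1` the extreme
outputs of root `j` are in no separator: they wait until root `j + 1` takes them in slot `2 * j +
2`. -/
theorem conservation (h : TreeFlow c up dn tot) (j : ℕ) :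
    (∑ i ∈ Finset.range j, sumAt (2 * (j - i)) (c i) + c j [] = tot) ∧
    (∑ i ∈ Finset.range (j + 1), sumAt (2 * (j - i) + 1) (c i) + up j [] = tot) := by
  have odd_of_even : ∀ j, ∑ i ∈ Finset.range j, sumAt (2 * (j - i)) (c i) + c j [] = tot →
      ∑ i ∈ Finset.range (j + 1), sumAt (2 * (j - i) + 1) (c i) + up j [] = tot := by
    intro j hj
    have := h.sum_diagonal j 0
    simp only [add_zero] at this
    rw [this, ← hj, Finset.sum_range_succ]
    simp only [h.sumAt_split, Finset.sum_add_distrib, h.split j []]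
    simp only [Nat.sub_self, mul_zero, sumAt]
    ring
  induction j with
  | zero =>
    have h0 : ∑ i ∈ Finset.range 0, sumAt (2 * (0 - i)) (c i) + c 0 [] = tot := by
      simp [h.zero_nil]
    exact ⟨h0, odd_of_even 0 h0⟩
  | succ j ih =>
    have h1 : ∑ i ∈ Finset.range (j + 1), sumAt (2 * (j + 1 - i)) (c i) + c (j + 1) [] = tot := by
      have := h.sum_diagonal j 1
      have e : ∑ i ∈ Finset.range (j + 1), sumAt (2 * (j + 1 - i)) (c i) =
          ∑ i ∈ Finset.range (j + 1), sumAt (2 * (j - i) + 1 + 1) (c i) := by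
        refine Finset.sum_congr rfl fun i hi => ?_
        have : i < j + 1 := Finset.mem_range.1 hi
        congr 1; omega
      rw [e, this, ← ih.2]
      simp only [h.sumAt_split, Finset.sum_add_distrib, h.succ_nil j]
      rw [Finset.sum_range_succ (fun i => sumAt (2 * (j - i) + 1) (up i)) j]
      simp only [Nat.sub_self, mul_zero, sumAt]
      ring
    exact ⟨h1, odd_of_even _ h1⟩

/-- What leaves the network when layer `j` is cut off below depth `D - j`. -/
theorem truncated_conservation (h : TreeFlow c up dn tot) (D : ℕ) {J : ℕ} (hJ : J ≤ D) :
    ∑ j ∈ Finset.range (J + 1), sumAt (D - j) (fun p => dn false j p + dn true j p) +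
      ∑ d ∈ Finset.range (D - J + 1), sumAt d (up J) = tot := by
  induction J with
  | zero =>
    have h1 : ∑ d ∈ Finset.range (D + 1), sumAt d (c 0) =
        ∑ d ∈ Finset.range D, sumAt d (fun p => dn false 0 p + dn true 0 p) + tot := by
      rw [Finset.sum_range_succ']
      congr 1
      · exact Finset.sum_congr rfl fun d _ => h.sumAt_zero_succ d
      · exact h.zero_nil
    simp only [h.sumAt_split, Finset.sum_add_distrib] at h1
    rw [Finset.sum_range_succ (fun d => sumAt d (fun p => dn false 0 p + dn true 0 p))] at h1
    simp only [zero_add, Finset.sum_range_one, Nat.sub_zero]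
    omega
  | succ J ih =>
    have ih := ih (by omega)
    obtain ⟨E, rfl⟩ : ∃ E, D = E + J + 1 := ⟨D - J - 1, by omega⟩
    rw [Finset.sum_range_succ, ← ih]
    have e1 : E + J + 1 - (J + 1) = E := by omega
    have e2 : E + J + 1 - J = E + 1 := by omega
    rw [e1, e2]
    -- Down to depth `E`, tree `J + 1` is fed by exactly what tree `J` sends up from depths up to `E
    -- + 1`, which is all that it sends up within the cut network. So the new tree replaces these
    -- outputs by its own.
    have h1 : ∑ d ∈ Finset.range (E + 1), sumAt d (c (J + 1)) =
        ∑ d ∈ Finset.range E, sumAt d (fun p => dn false (J + 1) p + dn true (J + 1) p) +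
        ∑ d ∈ Finset.range (E + 2), sumAt d (up J) := by
      rw [Finset.sum_range_succ', Finset.sum_range_succ' _ (E + 1), Finset.sum_range_succ' _ E,
        h.sumAt_succ_zero]
      simp only [h.sumAt_succ_succ, Finset.sum_add_distrib]
      simp only [zero_add]
      ring
    simp only [h.sumAt_split, Finset.sum_add_distrib] at h1
    rw [Finset.sum_range_succ (fun d => sumAt d (fun p => dn false (J + 1) p + dn true (J + 1) p))]
      at h1
    rw [show E + 1 + 1 = E + 2 by ring]
    omega

end TreeFlow

variable {β : Type*}

/-- An additive quantity that separators preserve flows through the tree. -/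
theorem treeFlow_of_additive {μ : List β → ℕ} (hμ : ∀ a b, μ (a ++ b) = μ a + μ b)
    {S : List β → List β} (hS : ∀ a, μ (S a) = μ a) (root : List β) :
    TreeFlow (fun j p => μ (treeArray S root j p))
      (fun j p => μ (outA1 (S (treeArray S root j p))) + μ (outA4 (S (treeArray S root j p))))
      (fun b j p => μ (toChild b (S (treeArray S root j p)))) (μ root) where
  split j p := by
    rw [← hS]
    conv_lhs => rw [← outs_append (S (treeArray S root j p))]
    simp only [hμ, toChild]
    simp
    ring
  zero_nil := rfl
  zero_cons b p := by simp only [treeArray, treeZero]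
  succ_nil j := by
    simp only [treeArray, treeSucc, hμ]
    ring
  succ_cons j b p := by
    simp only [treeArray, treeSucc, hμ]
    ring

end Flow

/-! ### Sizes of the separators -/

section Lengths

variable {β : Type*} {S : List β → List β} {root : List β} {M : ℕ}

/-- The relative sizes of the separators: those at depth `d` of layer `j` work on `n * sepSize j d`
wires. -/
noncomputable def sepSizeSucc (prev : ℕ → ℝ) : ℕ → ℝ
  | 0 => prev 0 / 8 + prev 1 / 4
  | d + 1 => 7 / 16 * sepSizeSucc prev d + prev (d + 2) / 4

noncomputable def sepSize : ℕ → ℕ → ℝ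
  | 0, d => (7 / 16) ^ d
  | j + 1, d => sepSizeSucc (sepSize j) d

theorem sepSize_zero (d : ℕ) : sepSize 0 d = (7 / 16) ^ d := rfl

theorem sepSize_succ_zero (j : ℕ) :
    sepSize (j + 1) 0 = sepSize j 0 / 8 + sepSize j 1 / 4 := rfl

theorem sepSize_succ_succ (j d : ℕ) :
    sepSize (j + 1) (d + 1) = 7 / 16 * sepSize (j + 1) d + sepSize j (d + 2) / 4 := rfl

theorem sepSize_pos (j d : ℕ) : 0 < sepSize j d := by
  induction j generalizing d with
  | zero => rw [sepSize_zero]; positivity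
  | succ j ih =>
    induction d with
    | zero =>
      rw [sepSize_succ_zero]
      have := ih 0; have := ih 1; positivity
    | succ d ihd =>
      rw [sepSize_succ_succ]
      have := ih (d + 2); positivity

/-- One tree later the factor is at most `1 / 8 + 1 / 4` at the root and `7 / 32 + 1 / 4 = 15 / 32`
below it. -/
theorem sepSize_le (j d : ℕ) : sepSize j d ≤ (1 / 2) ^ j := by
  induction j generalizing d with
  | zero => rw [sepSize_zero, pow_zero]; exact pow_le_one₀ (by norm_num) (by norm_num)
  | succ j ih =>
    have hp : (0 : ℝ) < (1 / 2) ^ j := by positivity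
    induction d with
    | zero =>
      rw [sepSize_succ_zero, pow_succ]
      have := ih 0; have := ih 1; linarith
    | succ d ihd =>
      rw [sepSize_succ_succ]
      rw [pow_succ] at ihd ⊢
      have := ih (d + 2); linarith

/-- A child receives `7 / 16` of its parent's array, and possibly more from the previous tree. -/
theorem pow_mul_sepSize_le (j d : ℕ) : (7 / 16) ^ d * sepSize j 0 ≤ sepSize j d := by
  induction d with
  | zero => simp
  | succ d ih =>
    have h : 7 / 16 * sepSize j d ≤ sepSize j (d + 1) := by
      cases j with
      | zero => simp only [sepSize_zero, pow_succ]; linarith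
      | succ j => rw [sepSize_succ_succ]; linarith [sepSize_pos j (d + 2)]
    calc (7 / 16) ^ (d + 1) * sepSize j 0 = 7 / 16 * ((7 / 16) ^ d * sepSize j 0) := by ring
      _ ≤ 7 / 16 * sepSize j d := by gcongr
      _ ≤ _ := h

/-- The next root keeps at least `1 / 8 + 1 / 4 * (7 / 16) = 15 / 64`. -/
theorem sepSize_root_le (j : ℕ) : sepSize j 0 ≤ 64 / 15 * sepSize (j + 1) 0 := by
  have := pow_mul_sepSize_le j 1
  rw [sepSize_succ_zero]
  linarith

theorem sepSize_root_le_pow (i k : ℕ) : sepSize i 0 ≤ (64 / 15) ^ k * sepSize (i + k) 0 := by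
  induction k with
  | zero => simp
  | succ k ih =>
    refine ih.trans ?_
    rw [pow_succ, mul_assoc, ← add_assoc]
    gcongr
    exact sepSize_root_le _

theorem pow_dvd_outs {m : ℕ} {a : List β} (h : 16 ^ (m + 1) ∣ a.length) :
    16 ^ m ∣ (outA1 a).length ∧ 16 ^ m ∣ (outA4 a).length ∧ ∀ b, 16 ^ m ∣ (toChild b a).length := by
  obtain ⟨x, hx⟩ := h
  have h16 : a.length = 16 * (16 ^ m * x) := by rw [hx, pow_succ]; ring
  obtain ⟨h1, -, -, h4⟩ := length_outs h16
  refine ⟨⟨x, h1⟩, ⟨x, h4⟩, fun b => ?_⟩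
  rw [length_toChild h16]
  exact ⟨7 * x, by ring⟩

/-- Each time slot uses up at most one factor 16, so the split into sixteenths is exact in all slots
before `M`. -/
theorem pow_dvd_length_treeArray (hS : ∀ a, (S a).length = a.length)
    (hM : 16 ^ M ∣ root.length) (j : ℕ) (p : List Bool) (hp : p.length + 2 * j ≤ M) :
    16 ^ (M - (p.length + 2 * j)) ∣ (treeArray S root j p).length := by
  have step : ∀ {m m' : ℕ} {a : List β}, m' < m → 16 ^ m ∣ a.length →
      16 ^ m' ∣ (outA1 (S a)).length ∧ 16 ^ m' ∣ (outA4 (S a)).length ∧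
        ∀ b, 16 ^ m' ∣ (toChild b (S a)).length := by
    intro m m' a hm h
    exact pow_dvd_outs (by rw [hS]; exact (pow_dvd_pow 16 hm).trans h)
  induction j generalizing p with
  | zero =>
    induction p with
    | nil => simpa [treeArray, treeZero] using hM
    | cons b p ih =>
      simp only [List.length_cons] at hp ⊢
      exact (step (by omega) (ih (by omega))).2.2 b
  | succ j ihj =>
    have up : ∀ q : List Bool, q.length ≤ p.length + 1 →
        16 ^ (M - (p.length + 2 * (j + 1))) ∣ (outA1 (S (treeArray S root j q)) ++
          outA4 (S (treeArray S root j q))).length := by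
      intro q hq
      obtain ⟨h1, h4, -⟩ := step (m' := M - (p.length + 2 * (j + 1))) (by omega)
        (ihj q (by omega))
      rw [List.length_append]
      exact dvd_add h1 h4
    induction p with
    | nil =>
      rw [treeArray, treeSucc, List.length_append, List.length_append]
      exact dvd_add (dvd_add (up _ (by simp)) (up _ (by simp))) (up _ (by simp))
    | cons b p ih =>
      rw [treeArray, treeSucc, List.length_append, List.length_append]
      refine dvd_add (dvd_add (up _ (by simp)) ?_) (up _ (by simp))
      simp only [List.length_cons] at hp ⊢
      exact (step (m := M - (p.length + 2 * (j + 1))) (by omega) (ih (by omega) fun q hq => by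
        obtain ⟨h1, h4, -⟩ := step (m' := M - (p.length + 2 * (j + 1))) (by omega)
          (ihj q (by omega))
        rw [List.length_append]
        exact dvd_add h1 h4)).2.2 b

theorem exists_length_treeArray (hS : ∀ a, (S a).length = a.length)
    (hM : 16 ^ M ∣ root.length) {j : ℕ} {p : List Bool} (hp : p.length + 2 * j < M) :
    ∃ x, (S (treeArray S root j p)).length = 16 * x := by
  have h := pow_dvd_length_treeArray hS hM j p hp.le
  rw [hS]
  exact (dvd_pow_self 16 (by omega)).trans h

theorem cast_length_outs {a : List β} (h : ∃ x, a.length = 16 * x) :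
    ((outA1 a).length : ℝ) = a.length / 16 ∧ ((outA4 a).length : ℝ) = a.length / 16 ∧
      ∀ b, ((toChild b a).length : ℝ) = 7 / 16 * a.length := by
  obtain ⟨x, hx⟩ := h
  obtain ⟨h1, -, -, h4⟩ := length_outs hx
  refine ⟨?_, ?_, fun b => ?_⟩
  · rw [h1, hx]; push_cast; ring
  · rw [h4, hx]; push_cast; ring
  · rw [length_toChild hx, hx]; push_cast; ring

theorem length_treeArray (hS : ∀ a, (S a).length = a.length)
    (hM : 16 ^ M ∣ root.length) (j : ℕ) (p : List Bool) (hp : p.length + 2 * j ≤ M) :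
    ((treeArray S root j p).length : ℝ) = root.length * sepSize j p.length := by
  have outs := fun (j : ℕ) (p : List Bool) (hp : p.length + 2 * j < M) =>
    cast_length_outs (exists_length_treeArray hS hM hp)
  simp only [hS] at outs
  induction j generalizing p with
  | zero =>
    induction p with
    | nil => simp [treeArray, treeZero, sepSize_zero]
    | cons b p ih =>
      simp only [List.length_cons] at hp ⊢
      have h := (outs 0 p (by omega)).2.2 b
      have ih := ih (by omega)
      simp only [treeArray, treeZero, sepSize_zero] at h ih ⊢
      rw [h, ih, pow_succ]
      ring
  | succ j ihj =>
    have up : ∀ q : List Bool, q.length + 2 * j < M →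
        ((outA1 (S (treeArray S root j q)) ++ outA4 (S (treeArray S root j q))).length : ℝ) =
          root.length * (sepSize j q.length / 8) := by
      intro q hq
      obtain ⟨h1, h4, -⟩ := outs j q hq
      rw [List.length_append, Nat.cast_add, h1, h4, ihj q hq.le]
      ring
    induction p with
    | nil =>
      rw [treeArray, treeSucc, List.length_append, List.length_append, Nat.cast_add, Nat.cast_add,
        up _ (by simp at hp ⊢; omega), up _ (by simp at hp ⊢; omega),
        up _ (by simp at hp ⊢; omega)]
      simp only [List.length_nil, List.length_cons, zero_add, sepSize_succ_zero]
      ring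
    | cons b p ih =>
      simp only [List.length_cons] at hp
      have h := (outs (j + 1) p (by omega)).2.2 b
      rw [ih (by omega), treeArray] at h
      rw [treeArray, treeSucc, List.length_append, List.length_append, Nat.cast_add, Nat.cast_add,
        up _ (by simp; omega), up _ (by simp; omega), h]
      simp only [List.length_cons, sepSize_succ_succ]
      ring

end Lengths

/-! ### The action of a separator on an array -/

section Separator

variable {β : Type*}

/-- The left (`false`) or right (`true`) half of an array. -/
def half (b : Bool) (a : List β) : List β := if b then rightHalf a else leftHalf a

/-- Apply `f` to one of the halves of an array. -/
def onHalf (b : Bool) (f : List β → List β) (a : List β) : List β :=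
  if b then leftHalf a ++ f (rightHalf a) else f (leftHalf a) ++ rightHalf a

/-- The four layers of a separator that consists of the halvers `h`. -/
def sepStage (h : List β → List β) : ℕ → List β → List β
  | 0, a => h a
  | 1, a => onHalf false h (onHalf true h a)
  | 2, a => onHalf false (onHalf false h) (onHalf true (onHalf true h) a)
  | 3, a => onHalf false (onHalf false (onHalf false h))
      (onHalf true (onHalf true (onHalf true h)) a)
  | _, a => a

/-- The effect of a separator that consists of the halvers `h`. -/
def sepFun (h : List β → List β) (a : List β) : List β :=
  sepStage h 3 (sepStage h 2 (sepStage h 1 (sepStage h 0 a)))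

variable {f h : List β → List β}

theorem half_onHalf_self (hf : ∀ a, (f a).length = a.length) (b : Bool) (a : List β) :
    half b (onHalf b f a) = f (half b a) := by
  cases b
  · have h1 : (f (leftHalf a) ++ rightHalf a).length / 2 = (f (leftHalf a)).length := by
      rw [List.length_append, hf, length_leftHalf, length_rightHalf]; omega
    simp only [half, onHalf, Bool.false_eq_true, if_false]
    rw [leftHalf, h1, List.take_left']
    rfl
  · have h1 : (leftHalf a ++ f (rightHalf a)).length / 2 = (leftHalf a).length := by
      rw [List.length_append, hf, length_leftHalf, length_rightHalf]; omega
    simp only [half, onHalf, if_true]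
    rw [rightHalf, h1, List.drop_left']
    rfl

theorem half_onHalf_not (hf : ∀ a, (f a).length = a.length) (b : Bool) (a : List β) :
    half (!b) (onHalf b f a) = half (!b) a := by
  cases b
  · have h1 : (f (leftHalf a) ++ rightHalf a).length / 2 = (f (leftHalf a)).length := by
      rw [List.length_append, hf, length_leftHalf, length_rightHalf]; omega
    simp only [half, onHalf, Bool.false_eq_true, if_false, Bool.not_false, if_true]
    rw [rightHalf, h1, List.drop_left']
    rfl
  · have h1 : (leftHalf a ++ f (rightHalf a)).length / 2 = (leftHalf a).length := by
      rw [List.length_append, hf, length_leftHalf, length_rightHalf]; omega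
    simp only [half, onHalf, if_true, Bool.not_true, Bool.false_eq_true, if_false]
    rw [leftHalf, h1, List.take_left']
    rfl

theorem perm_onHalf (hf : ∀ a, (f a).Perm a) (b : Bool) (a : List β) : (onHalf b f a).Perm a := by
  conv_rhs => rw [← leftHalf_append_rightHalf a]
  cases b
  · exact (hf _).append_right _
  · exact (hf _).append_left _

theorem perm_sepStage (hh : ∀ a, (h a).Perm a) (s : ℕ) (a : List β) :
    (sepStage h s a).Perm a := by
  match s with
  | 0 => exact hh a
  | 1 => exact (perm_onHalf hh _ _).trans (perm_onHalf hh _ _)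
  | 2 => exact (perm_onHalf (perm_onHalf hh _) _ _).trans (perm_onHalf (perm_onHalf hh _) _ _)
  | 3 =>
    exact (perm_onHalf (perm_onHalf (perm_onHalf hh _) _) _ _).trans
      (perm_onHalf (perm_onHalf (perm_onHalf hh _) _) _ _)
  | _ + 4 => exact List.Perm.refl _

theorem perm_sepFun (hh : ∀ a, (h a).Perm a) (a : List β) : (sepFun h a).Perm a :=
  (perm_sepStage hh _ _).trans ((perm_sepStage hh _ _).trans
    ((perm_sepStage hh _ _).trans (perm_sepStage hh _ _)))

/-- What a separator does to one half of the array after its first layer. -/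
def halfFun (h : List β → List β) (b : Bool) (a : List β) : List β :=
  onHalf b (onHalf b h) (onHalf b h (h a))

/-- After the first halver the two halves of the array no longer interact. -/
theorem half_sepFun (hh : ∀ a, (h a).Perm a) (b : Bool) (a : List β) :
    half b (sepFun h a) = halfFun h b (half b (h a)) := by
  have l0 : ∀ a, (h a).length = a.length := fun a => (hh a).length_eq
  have l1 : ∀ b a, (onHalf b h a).length = a.length := fun b a => (perm_onHalf hh b a).length_eq
  have l2 : ∀ b b' a, (onHalf b' (onHalf b h) a).length = a.length :=
    fun b b' a => (perm_onHalf (perm_onHalf hh b) b' a).length_eq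
  have key : ∀ (f : Bool → List β → List β), (∀ b a, (f b a).length = a.length) → ∀ a,
      half b (onHalf false (f false) (onHalf true (f true) a)) = f b (half b a) := by
    intro f hf a
    cases b
    · rw [half_onHalf_self (hf _)]
      congr 1
      exact half_onHalf_not (hf _) true a
    · rw [← half_onHalf_self (hf _)]
      exact half_onHalf_not (hf _) false _
  simp only [sepFun, sepStage, halfFun]
  rw [key (fun b => onHalf b (onHalf b h)) (fun b => l2 b b), key (fun b => onHalf b h) l1,
    key (fun _ => h) (fun _ => l0)]

theorem count_half_add {β : Type*} [BEq β] (v : β) (b : Bool) (a : List β) :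
    (half b a).count v + (half (!b) a).count v = a.count v := by
  conv_rhs => rw [← leftHalf_append_rightHalf a, List.count_append]
  cases b <;> simp [half, add_comm]

theorem count_toChild_add {β : Type*} [BEq β] (v : β) (b : Bool) (a : List β) :
    (toChild b a).count v + (half b (half b (half b (half b a)))).count v = (half b a).count v := by
  cases b
  · simp only [half, Bool.false_eq_true, if_false, toChild]
    conv_rhs => rw [← outA1_append_outA2 a, List.count_append, add_comm]
    rfl
  · simp only [half, if_true, toChild]
    conv_rhs => rw [← outA3_append_outA4 a, List.count_append]
    rfl

theorem length_half {a : List β} {x : ℕ} (ha : a.length = 2 * x) (b : Bool) :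
    (half b a).length = x := by
  cases b <;> simp [half, length_leftHalf, length_rightHalf] <;> omega

end Separator

/-- `h` acts on arrays of zeros and ones like an `ε`-halver. -/
structure IsArrayHalver (ε : ℝ) (h : List Bool → List Bool) : Prop where
  perm : ∀ a, (h a).Perm a
  halves : ∀ (v : Bool) (a : List Bool) (k : ℕ), a.length = 2 * k → a.count v ≤ k →
    ((half (!v) (h a)).count v : ℝ) ≤ ε * a.count v

/-! ### Error bounds for one separator -/

section SeparatorCounts

variable {ε : ℝ} {h : List Bool → List Bool}

/-- The bound used at a root, where `!w` is the value that does not belong on side `w`. Only the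
first halver matters, and an excess `e` of `!w` over half the array is passed on in full at worst.
-/
theorem IsArrayHalver.count_toChild_le (hh : IsArrayHalver ε h) (hε : 0 ≤ ε) {a : List Bool} {k : ℕ}
    (ha : a.length = 2 * k) (w : Bool) {e : ℝ} (he0 : 0 ≤ e) (he : (a.count (!w) : ℝ) ≤ k + e) :
    ((toChild w (sepFun h a)).count (!w) : ℝ) ≤ ε * k + e := by
  have h1 : (toChild w (sepFun h a)).count (!w) ≤ (half w (h a)).count (!w) := by
    have := count_toChild_add (!w) w (sepFun h a)
    have h2 : (half w (sepFun h a)).count (!w) = (half w (h a)).count (!w) := by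
      rw [half_sepFun hh.perm]
      exact ((perm_onHalf (perm_onHalf hh.perm _) _ _).trans
        ((perm_onHalf hh.perm _ _).trans (hh.perm _))).count_eq _
    omega
  refine (Nat.cast_le.2 h1).trans ?_
  rcases le_total (a.count (!w)) k with hk | hk
  · have := hh.halves (!w) a k ha hk
    rw [Bool.not_not] at this
    have hk' : (a.count (!w) : ℝ) ≤ k := by exact_mod_cast hk
    calc _ ≤ ε * (a.count (!w) : ℝ) := this
      _ ≤ ε * k := by gcongr
      _ ≤ _ := by linarith
  -- With too many `!w` for the halver guarantee, the guarantee is applied to `w`: few `w` end on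
  -- side `!w`, so this side is almost filled by `!w`, and the rest of the `!w` is what is left for
  -- side `w`.
  · have hsum := List.count_not_add_count a w
    have hw : a.count w ≤ k := by omega
    have hle := hh.halves w a k ha hw
    have hlen : (half (!w) (h a)).length = k := length_half (by rw [(hh.perm a).length_eq, ha]) _
    have hs2 := List.count_not_add_count (half (!w) (h a)) w
    have hs3 := count_half_add (!w) w (h a)
    rw [(hh.perm a).count_eq] at hs3
    have e1 : ((half w (h a)).count (!w) : ℝ) + (half (!w) (h a)).count (!w) = a.count (!w) := by
      exact_mod_cast hs3
    have e2 : ((half (!w) (h a)).count (!w) : ℝ) + (half (!w) (h a)).count w = k := by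
      rw [hlen] at hs2; exact_mod_cast hs2
    have hw' : (a.count w : ℝ) ≤ k := by exact_mod_cast hw
    have : ε * (a.count w : ℝ) ≤ ε * k := by gcongr
    linarith

/-- An item `v` that goes to its proper side in the four nested halvers ends in the extreme
sixteenth on that side and reaches no child. Each halver lets at most `ε * a.count v` of them slip.
The capacity `x` of the innermost half makes the guarantee applicable to all four. -/
theorem IsArrayHalver.count_children_le (hh : IsArrayHalver ε h) (hε : 0 ≤ ε) {a : List Bool} {x : ℕ}
    (ha : a.length = 16 * x) (v : Bool) (hv : a.count v ≤ x) :
    (((toChild false (sepFun h a)).count v + (toChild true (sepFun h a)).count v : ℕ) : ℝ) ≤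
      4 * ε * a.count v := by
  have l0 : ∀ a, (h a).length = a.length := fun a => (hh.perm a).length_eq
  have l1 : ∀ a, (onHalf v h a).length = a.length :=
    fun a => (perm_onHalf hh.perm v a).length_eq
  set r := half v (h a) with hr
  set q := half v (h r) with hq
  set e := half v (h q) with he
  have lr : r.length = 8 * x := by
    apply length_half; rw [l0]; omega
  have lq : q.length = 4 * x := by
    apply length_half; rw [l0]; omega
  have le' : e.length = 2 * x := by
    apply length_half; rw [l0]; omega
  have cr := count_half_add v v (h a)
  have cq := count_half_add v v (h r)
  have ce := count_half_add v v (h q)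
  have cf := count_half_add v v (h e)
  rw [(hh.perm _).count_eq] at cr cq ce cf
  rw [← hr] at cr
  rw [← hq] at cq
  rw [← he] at ce
  have b0 := hh.halves v a (8 * x) (by omega) (by omega)
  have b1 := hh.halves v r (4 * x) (by omega) (by omega)
  have b2 := hh.halves v q (2 * x) (by omega) (by omega)
  have b3 := hh.halves v e x le' (by omega)
  have hext : half v (half v (half v (half v (sepFun h a)))) = half v (h e) := by
    rw [half_sepFun hh.perm, halfFun, half_onHalf_self l1, half_onHalf_self l0,
      half_onHalf_self l0]
  have hpv := count_toChild_add v v (sepFun h a)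
  have hpn := count_toChild_add v (!v) (sepFun h a)
  have hperm : ∀ b, (half b (sepFun h a)).count v = (half b (h a)).count v := by
    intro b
    rw [half_sepFun hh.perm]
    exact ((perm_onHalf (perm_onHalf hh.perm _) _ _).trans
      ((perm_onHalf hh.perm _ _).trans (hh.perm _))).count_eq _
  rw [hext, hperm, ← hr] at hpv
  rw [hperm] at hpn
  have htot : (toChild false (sepFun h a)).count v + (toChild true (sepFun h a)).count v =
      (toChild v (sepFun h a)).count v + (toChild (!v) (sepFun h a)).count v := by
    cases v <;> simp [add_comm]
  rw [htot]
  have hN : (toChild v (sepFun h a)).count v + (toChild (!v) (sepFun h a)).count v ≤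
      (half (!v) (h a)).count v + (half (!v) (h r)).count v + (half (!v) (h q)).count v +
        (half (!v) (h e)).count v := by omega
  have hR := (Nat.cast_le (α := ℝ)).2 hN
  push_cast at hR
  have m1 : ε * (r.count v : ℝ) ≤ ε * a.count v := by
    gcongr; omega
  have m2 : ε * (q.count v : ℝ) ≤ ε * a.count v := by
    gcongr; omega
  have m3 : ε * (e.count v : ℝ) ≤ ε * a.count v := by
    gcongr; omega
  push_cast
  linarith

end SeparatorCounts

/-! ### Bounding the strangers in the trees -/

section Strangers

/-- The number of items at depth `d + 1` of layer `j` that are on the side `b` of the root but belong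
on the other. -/
def strangers (h : List Bool → List Bool) (root : List Bool) (b : Bool) (j d : ℕ) : ℕ :=
  sumAt d fun q => (treeArray (sepFun h) root j (q ++ [b])).count (!b)

variable {h : List Bool → List Bool} {root : List Bool} {M : ℕ}

theorem IsArrayHalver.treeFlow_count {ε : ℝ} (hh : IsArrayHalver ε h) (root : List Bool) (v : Bool) :
    TreeFlow (fun j p => (treeArray (sepFun h) root j p).count v)
      (fun j p => (outA1 (sepFun h (treeArray (sepFun h) root j p))).count v +
        (outA4 (sepFun h (treeArray (sepFun h) root j p))).count v)
      (fun b j p => (toChild b (sepFun h (treeArray (sepFun h) root j p))).count v)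
      (root.count v) :=
  treeFlow_of_additive (fun _ _ => List.count_append) (fun a => (perm_sepFun hh.perm a).count_eq v) root

theorem IsArrayHalver.length_sepFun {ε : ℝ} (hh : IsArrayHalver ε h) (a : List Bool) :
    (sepFun h a).length = a.length := (perm_sepFun hh.perm a).length_eq

theorem IsArrayHalver.treeFlow_length {ε : ℝ} (hh : IsArrayHalver ε h) (root : List Bool) :
    TreeFlow (fun j p => (treeArray (sepFun h) root j p).length)
      (fun j p => (outA1 (sepFun h (treeArray (sepFun h) root j p))).length +
        (outA4 (sepFun h (treeArray (sepFun h) root j p))).length)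
      (fun b j p => (toChild b (sepFun h (treeArray (sepFun h) root j p))).length)
      root.length :=
  treeFlow_of_additive (fun _ _ => List.length_append) hh.length_sepFun root

theorem sumAt_length_sides {ε : ℝ} (hh : IsArrayHalver ε h) (hM : 16 ^ M ∣ root.length) {i d : ℕ}
    (hd : d + 1 + 2 * i ≤ M) (b : Bool) :
    ((sumAt (d + 1) fun p => (treeArray (sepFun h) root i p).length : ℕ) : ℝ) =
      2 * (sumAt d fun q => (treeArray (sepFun h) root i (q ++ [b])).length : ℕ) := by
  have hside : ∀ b, ((sumAt d fun q => (treeArray (sepFun h) root i (q ++ [b])).length : ℕ) : ℝ) =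
      sumAt d fun _ => (root.length * sepSize i (d + 1) : ℝ) := by
    intro b
    rw [sumAt_cast]
    refine sumAt_congr fun q hq => ?_
    rw [length_treeArray hh.length_sepFun hM _ _ (by simp [hq]; omega)]
    simp [hq]
  rw [sumAt_succ_sides, Nat.cast_add, hside, hside, hside, two_mul]

/-- The imbalance at a root is at most the number of strangers below it. -/
theorem count_root_le {ε : ℝ} (hh : IsArrayHalver ε h) (hM : 16 ^ M ∣ root.length)
    {v : Bool} (hroot : 2 * root.count v = root.length) {j : ℕ} (hj : 2 * j ≤ M) :
    ((treeArray (sepFun h) root j []).count v : ℝ) ≤ (treeArray (sepFun h) root j []).length / 2 +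
      ∑ i ∈ Finset.range j, (strangers h root v i (2 * (j - i) - 1) : ℝ) := by
  have c1 := ((hh.treeFlow_count root v).conservation j).1
  have c2 := ((hh.treeFlow_length root).conservation j).1
  -- In slot `2 * j` half of the wires of tree `i < j` lie on side `v` of its root, and all of these
  -- except the strangers hold `v`. So the trees before `j` hold almost their fair share of `v`, and
  -- not much more than half of root `j` is left for it.
  have key : ∀ i ∈ Finset.range j,
      ((sumAt (2 * (j - i)) fun p => (treeArray (sepFun h) root i p).length : ℕ) : ℝ) ≤
        2 * ((sumAt (2 * (j - i)) fun p => (treeArray (sepFun h) root i p).count v : ℕ) : ℝ) +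
        2 * (strangers h root v i (2 * (j - i) - 1) : ℝ) := by
    intro i hi
    have hi' : i < j := Finset.mem_range.1 hi
    obtain ⟨d, hd⟩ : ∃ d, 2 * (j - i) = d + 1 := ⟨2 * (j - i) - 1, by omega⟩
    rw [hd, Nat.add_sub_cancel, sumAt_length_sides hh hM (by omega) v, ← mul_add]
    gcongr
    rw [strangers, ← Nat.cast_add]
    apply Nat.cast_le.2
    rw [sumAt_succ_sides]
    have e1 : (sumAt d fun q => (treeArray (sepFun h) root i (q ++ [v])).length) =
        (sumAt d fun q => (treeArray (sepFun h) root i (q ++ [v])).count v) +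
        sumAt d fun q => (treeArray (sepFun h) root i (q ++ [v])).count (!v) := by
      rw [← sumAt_add]
      refine sumAt_congr fun q _ => ?_
      rw [add_comm, List.count_not_add_count]
    rw [e1]
    gcongr
    cases v <;> simp
  have s := Finset.sum_le_sum key
  rw [Finset.sum_add_distrib, ← Finset.mul_sum, ← Finset.mul_sum] at s
  have c1' := congrArg (Nat.cast : ℕ → ℝ) c1
  have c2' := congrArg (Nat.cast : ℕ → ℝ) c2
  have hr' := congrArg (Nat.cast : ℕ → ℝ) hroot
  push_cast at c1' c2' hr'
  linarith

/-- Strangers just below a root were either sent down by it or had already been strangers one level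
deeper in the previous tree. -/
theorem strangers_succ_zero_le {ε : ℝ} (hh : IsArrayHalver ε h) (root : List Bool) (b : Bool)
    (j : ℕ) : strangers h root b (j + 1) 0 ≤
      (toChild b (sepFun h (treeArray (sepFun h) root (j + 1) []))).count (!b) +
        strangers h root b j 1 := by
  have h1 := (hh.treeFlow_count root (!b)).succ_cons j b []
  have h2 := (hh.treeFlow_count root (!b)).split j [false, b]
  have h3 := (hh.treeFlow_count root (!b)).split j [true, b]
  simp only [strangers, sumAt, List.nil_append, List.cons_append]
  omega

theorem strangers_zero_succ {ε : ℝ} (hh : IsArrayHalver ε h) (root : List Bool) (b : Bool)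
    (d : ℕ) : strangers h root b 0 (d + 1) =
      sumAt d fun q => (toChild false (sepFun h (treeArray (sepFun h) root 0 (q ++ [b])))).count (!b) +
        (toChild true (sepFun h (treeArray (sepFun h) root 0 (q ++ [b])))).count (!b) := by
  rw [strangers, sumAt]
  refine sumAt_congr fun q _ => ?_
  have := (hh.treeFlow_count root (!b)).zero_cons
  simp only [List.cons_append, this]

theorem strangers_succ_succ_le {ε : ℝ} (hh : IsArrayHalver ε h) (root : List Bool) (b : Bool)
    (j d : ℕ) : strangers h root b (j + 1) (d + 1) ≤
      (sumAt d fun q =>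
        (toChild false (sepFun h (treeArray (sepFun h) root (j + 1) (q ++ [b])))).count (!b) +
        (toChild true (sepFun h (treeArray (sepFun h) root (j + 1) (q ++ [b])))).count (!b)) +
      strangers h root b j (d + 2) := by
  simp only [strangers, sumAt]
  rw [← sumAt_add]
  refine sumAt_mono fun q _ => ?_
  have h1 := (hh.treeFlow_count root (!b)).succ_cons j
  have h2 := (hh.treeFlow_count root (!b)).split j
  simp only [List.cons_append, h1]
  have := h2 (false :: false :: (q ++ [b]))
  have := h2 (false :: true :: (q ++ [b]))
  have := h2 (true :: false :: (q ++ [b]))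
  have := h2 (true :: true :: (q ++ [b]))
  omega

/-- The ratio is `1 / 32 * (64 / 15)`: the decay of strangers with depth against the shrinking of
the roots. -/
theorem sum_geom_le (j : ℕ) : ∑ i ∈ Finset.range j, (2 / 15 : ℝ) ^ (j - i) ≤ 2 / 13 := by
  have h : ∀ j : ℕ, ∑ i ∈ Finset.range j, (2 / 15 : ℝ) ^ (j - i) = 2 / 13 - 2 / 13 * (2 / 15) ^ j := by
    intro j
    induction j with
    | zero => simp
    | succ j ih =>
      rw [Finset.sum_range_succ]
      have : ∑ i ∈ Finset.range j, (2 / 15 : ℝ) ^ (j + 1 - i) =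
          2 / 15 * ∑ i ∈ Finset.range j, (2 / 15 : ℝ) ^ (j - i) := by
        rw [Finset.mul_sum]
        refine Finset.sum_congr rfl fun i hi => ?_
        have : j + 1 - i = (j - i) + 1 := by have := Finset.mem_range.1 hi; omega
        rw [this, pow_succ]; ring
      rw [this, ih, Nat.add_sub_cancel_left, pow_succ]
      ring
  rw [h]
  have : (0 : ℝ) ≤ 2 / 13 * (2 / 15) ^ j := by positivity
  linarith

/-- Few strangers at a depth lead to few strangers among what is sent down from there. -/
theorem sum_children_le (hh : IsArrayHalver (1 / 175) h) (hM : 16 ^ M ∣ root.length) (b : Bool)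
    {j d : ℕ} (hd : d + 1 + 2 * j < M)
    (hW : (strangers h root b j d : ℝ) ≤
      root.length * (1 / 200 * (1 / 32) ^ d * sepSize j 0)) :
    ((sumAt d fun q =>
        (toChild false (sepFun h (treeArray (sepFun h) root j (q ++ [b])))).count (!b) +
        (toChild true (sepFun h (treeArray (sepFun h) root j (q ++ [b])))).count (!b) : ℕ) : ℝ) ≤
      4 / 175 * strangers h root b j d := by
  rw [strangers, sumAt_cast, sumAt_cast, ← sumAt_mul_left]
  refine sumAt_mono fun q hq => ?_
  have hlen : (q ++ [b]).length = d + 1 := by simp [hq]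
  obtain ⟨x, hx⟩ := exists_length_treeArray hh.length_sepFun hM (j := j) (p := q ++ [b])
    (by rw [hlen]; exact hd)
  rw [hh.length_sepFun] at hx
  have hx' := length_treeArray hh.length_sepFun hM j (q ++ [b]) (by rw [hlen]; exact hd.le)
  rw [hx, hlen] at hx'
  push_cast at hx'
  -- Even all strangers of this depth together fit into a sixteenth of one separator: `1 / 200 < 1 /
  -- 16 * (7 / 16)`, and `1 / 32 < 7 / 16` for each further level.
  have hcap : (treeArray (sepFun h) root j (q ++ [b])).count (!b) ≤ x := by
    have h1 : ((treeArray (sepFun h) root j (q ++ [b])).count (!b) : ℝ) ≤ strangers h root b j d := by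
      rw [strangers]
      exact_mod_cast le_sumAt (fun q => (treeArray (sepFun h) root j (q ++ [b])).count (!b)) hq
    have h2 := pow_mul_sepSize_le j (d + 1)
    have h3 : (1 / 200 : ℝ) * (1 / 32) ^ d * sepSize j 0 ≤
        1 / 16 * ((7 / 16) ^ (d + 1) * sepSize j 0) := by
      rw [pow_succ, ← mul_assoc]
      apply mul_le_mul_of_nonneg_right _ (sepSize_pos j 0).le
      have : (1 / 32 : ℝ) ^ d ≤ (7 / 16) ^ d :=
        pow_le_pow_left₀ (by norm_num) (by norm_num) d
      have h0 : (0 : ℝ) ≤ (7 / 16) ^ d := by positivity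
      linarith
    have h4 : (root.length : ℝ) * (1 / 200 * (1 / 32) ^ d * sepSize j 0) ≤
        root.length * (1 / 16 * sepSize j (d + 1)) :=
      mul_le_mul_of_nonneg_left (by linarith) (Nat.cast_nonneg _)
    have : ((treeArray (sepFun h) root j (q ++ [b])).count (!b) : ℝ) ≤ x := by linarith
    exact_mod_cast this
  have := hh.count_children_le (by norm_num) hx (!b) hcap
  linarith

/-- Strong induction on the tree `j`, because the imbalance of its root involves all earlier trees
and the opposite side; within a tree, induction on the depth. The constants `1 / 200` and `1 / 32`
are chosen so that each of the three cases below closes with some slack. -/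
theorem strangers_le (hh : IsArrayHalver (1 / 175) h) (hM : 16 ^ M ∣ root.length)
    (hroot : ∀ v, 2 * root.count v = root.length) (b : Bool) (j d : ℕ) (hd : d + 1 + 2 * j ≤ M) :
    (strangers h root b j d : ℝ) ≤ root.length * (1 / 200 * (1 / 32) ^ d * sepSize j 0) := by
  induction j using Nat.strong_induction_on generalizing b d with
  | _ j IH =>
  have hn : (0 : ℝ) ≤ root.length := Nat.cast_nonneg _
  have hq := sepSize_pos j 0
  -- What the root sends to the wrong side: `1 / 350` of it by the halver acting on half of its
  -- array, plus the imbalance, estimated by the geometric series over the earlier trees.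
  have hdn : ((toChild b (sepFun h (treeArray (sepFun h) root j []))).count (!b) : ℝ) ≤
      root.length * ((1 / 350 + 1 / 200 * (2 / 13)) * sepSize j 0) := by
    obtain ⟨x, hx⟩ := exists_length_treeArray hh.length_sepFun hM (j := j) (p := [])
      (by simp; omega)
    rw [hh.length_sepFun] at hx
    have hx' := length_treeArray hh.length_sepFun hM j [] (by simp; omega)
    have hc := count_root_le hh hM (hroot (!b)) (j := j) (by omega)
    rw [hx] at hx' hc
    simp only [List.length_nil] at hx'
    push_cast at hx' hc
    have hs : ∑ i ∈ Finset.range j, (strangers h root (!b) i (2 * (j - i) - 1) : ℝ) ≤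
        root.length * (1 / 200 * (2 / 13) * sepSize j 0) := by
      calc _ ≤ ∑ i ∈ Finset.range j, (root.length * (1 / 200 * sepSize j 0)) *
            (2 / 15 : ℝ) ^ (j - i) := by
            refine Finset.sum_le_sum fun i hi => ?_
            have hij : i < j := Finset.mem_range.1 hi
            refine (IH i hij (!b) (2 * (j - i) - 1) (by omega)).trans ?_
            have h1 := sepSize_root_le_pow i (j - i)
            rw [Nat.add_sub_of_le hij.le] at h1
            -- Half of the exponent is given away; what remains still beats the growth `64 / 15` per
            -- tree.
            have h2 : (1 / 32 : ℝ) ^ (2 * (j - i) - 1) ≤ (1 / 32) ^ (j - i) :=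
              pow_le_pow_of_le_one (by norm_num) (by norm_num) (by omega)
            calc root.length * (1 / 200 * (1 / 32 : ℝ) ^ (2 * (j - i) - 1) * sepSize i 0)
                ≤ root.length * (1 / 200 * (1 / 32 : ℝ) ^ (j - i) *
                  ((64 / 15) ^ (j - i) * sepSize j 0)) := by
                  gcongr
                  exact (sepSize_pos i 0).le
              _ = (root.length * (1 / 200 * sepSize j 0)) *
                  ((1 / 32 : ℝ) ^ (j - i) * (64 / 15) ^ (j - i)) := by ring
              _ = _ := by rw [← mul_pow]; norm_num
        _ ≤ (root.length * (1 / 200 * sepSize j 0)) * (2 / 13) := by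
            rw [← Finset.mul_sum]
            gcongr
            exact sum_geom_le j
        _ = _ := by ring
    have hs0 : 0 ≤ ∑ i ∈ Finset.range j, (strangers h root (!b) i (2 * (j - i) - 1) : ℝ) :=
      Finset.sum_nonneg fun _ _ => Nat.cast_nonneg _
    have := hh.count_toChild_le (by norm_num) (a := treeArray (sepFun h) root j [])
      (k := 8 * x) (by omega) b hs0
      (by push_cast; linarith)
    push_cast at this
    linarith
  induction d with
  | zero =>
    rw [pow_zero, mul_one]
    cases j with
    | zero =>
      have e : strangers h root b 0 0 =
          (toChild b (sepFun h (treeArray (sepFun h) root 0 []))).count (!b) :=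
        (hh.treeFlow_count root (!b)).zero_cons b []
      rw [e]
      refine hdn.trans ?_
      gcongr
      norm_num
    | succ j =>
      have h1 := (Nat.cast_le (α := ℝ)).2 (strangers_succ_zero_le hh root b j)
      have h2 := IH j (by omega) b 1 (by omega)
      have h3 : (root.length : ℝ) * (1 / 200 * (1 / 32) ^ 1 * sepSize j 0) ≤
          root.length * (1 / 200 * (1 / 32) ^ 1 * (64 / 15 * sepSize (j + 1) 0)) := by
        gcongr
        exact sepSize_root_le j
      push_cast at h1
      have h4 : (0 : ℝ) ≤ root.length * sepSize (j + 1) 0 := by positivity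
      -- `1 / 350 + 1 / 1300` from the root and `1 / 1500` from the previous tree add up to less
      -- than `1 / 200`.
      linarith
  | succ d ihd =>
    have ihd := ihd (by omega)
    have hch := sum_children_le hh hM b (by omega) ihd
    have h0 : (0 : ℝ) ≤ root.length * ((1 / 32) ^ d * sepSize j 0) := by positivity
    cases j with
    | zero =>
      rw [strangers_zero_succ hh, pow_succ]
      linarith
    | succ j =>
      have h1 := (Nat.cast_le (α := ℝ)).2 (strangers_succ_succ_le hh root b j d)
      have h2 := IH j (by omega) b (d + 2) (by omega)
      have h3 : (root.length : ℝ) * (1 / 200 * (1 / 32) ^ (d + 2) * sepSize j 0) ≤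
          root.length * (1 / 200 * (1 / 32) ^ (d + 2) * (64 / 15 * sepSize (j + 1) 0)) := by
        gcongr
        exact sepSize_root_le j
      rw [Nat.cast_add] at h1
      rw [pow_succ] at h3 ⊢
      rw [pow_succ] at h3 h2
      rw [pow_succ] at h2
      -- Relative to the target, the strangers sent down contribute `32 * 4 / 175` and those sent up
      -- `1 / 32 * (64 / 15) = 2 / 15`; the sum is below 1.
      linarith

/-- Few strangers leave the network at the leaves on the side `b`. -/
theorem leaf_strangers_le (hh : IsArrayHalver (1 / 175) h) (hM : 16 ^ M ∣ root.length)
    (hroot : ∀ v, 2 * root.count v = root.length) (b : Bool) (j d : ℕ) (hd : d + 1 + 2 * j < M) :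
    ((sumAt d fun q =>
        (toChild false (sepFun h (treeArray (sepFun h) root j (q ++ [b])))).count (!b) +
        (toChild true (sepFun h (treeArray (sepFun h) root j (q ++ [b])))).count (!b) : ℕ) : ℝ) ≤
      root.length * (1 / 200 * (1 / 32) ^ (d + 1)) := by
  have hW := strangers_le hh hM hroot b j d hd.le
  have h1 := sum_children_le hh hM b hd hW
  have h2 : sepSize j 0 ≤ 1 := (sepSize_le j 0).trans (pow_le_one₀ (by norm_num) (by norm_num))
  have h3 : (root.length : ℝ) * (1 / 200 * (1 / 32) ^ d * sepSize j 0) ≤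
      root.length * (1 / 200 * (1 / 32) ^ d * 1) := by gcongr
  have h0 : (0 : ℝ) ≤ root.length * ((1 / 32) ^ d) := by positivity
  rw [pow_succ]
  -- One more separator at the leaf gains a factor `4 / 175 < 1 / 32`.
  linarith

end Strangers

/-! ### Expander networks as operations on arrays -/

section Halve

variable {α : Type*} [LinearOrder α]

/-- The effect of the halvers `hal` on an array of any length. -/
def halve (hal : (k : ℕ) → ComparatorNetwork (2 * k)) (b : List α) : List α :=
  List.ofFn ((hal (b.length / 2)).run fun i => b.get ⟨i.val, by have := i.isLt; omega⟩) ++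
    b.drop (2 * (b.length / 2))

variable {hal : (k : ℕ) → ComparatorNetwork (2 * k)}

theorem halve_eq {b : List α} {k : ℕ} (hk : b.length / 2 = k) :
    halve hal b =
      List.ofFn ((hal k).run fun i => b.get ⟨i.val, by have := i.isLt; omega⟩) ++
        b.drop (2 * k) := by
  subst hk; rfl

theorem take_eq_ofFn {β : Type*} (b : List β) {m : ℕ} (hm : m ≤ b.length) :
    b.take m = List.ofFn fun i : Fin m => b.get ⟨i.val, by omega⟩ := by
  apply List.ext_getElem
  · simp [hm]
  · intro i h1 h2; simp

theorem perm_halve (b : List α) : (halve hal b).Perm b := by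
  obtain ⟨π, hπ⟩ := (hal (b.length / 2)).run_eq_comp_perm
    fun i => b.get ⟨i.val, by have := i.isLt; omega⟩
  conv_rhs => rw [← List.take_append_drop (2 * (b.length / 2)) b]
  rw [halve, hπ, take_eq_ofFn b (by omega)]
  exact (Equiv.Perm.ofFn_comp_perm π _).append_right _

theorem count_take_ofFn {β : Type*} [DecidableEq β] {n : ℕ} (f : Fin n → β) (m : ℕ) (v : β) :
    ((List.ofFn f).take m).count v = (Finset.univ.filter fun w => w.val < m ∧ f w = v).card := by
  induction n generalizing m with
  | zero => simp
  | succ n ih =>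
    cases m with
    | zero => simp
    | succ m =>
      rw [List.ofFn_succ, List.take_succ_cons, List.count_cons, ih, Fin.card_filter_univ_succ]
      by_cases h : f 0 = v <;> simp [h]

theorem count_drop_ofFn {β : Type*} [DecidableEq β] {n : ℕ} (f : Fin n → β) (m : ℕ) (v : β) :
    ((List.ofFn f).drop m).count v = (Finset.univ.filter fun w => m ≤ w.val ∧ f w = v).card := by
  induction n generalizing m with
  | zero => simp
  | succ n ih =>
    cases m with
    | zero =>
      have := count_take_ofFn f (n + 1) v
      rw [List.take_of_length_le (by simp)] at this
      rw [List.drop_zero, this]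
      congr 1
      exact Finset.filter_congr fun w _ => by simp [w.isLt]
    | succ m =>
      rw [List.ofFn_succ, List.drop_succ_cons, ih, Fin.card_filter_univ_succ]
      simp

theorem count_ofFn {β : Type*} [DecidableEq β] {n : ℕ} (f : Fin n → β) (v : β) :
    (List.ofFn f).count v = (Finset.univ.filter fun w => f w = v).card := by
  simpa using count_drop_ofFn f 0 v

theorem isArrayHalver_halve {ε : ℝ} {d₀ : ℕ} (hε : 0 < ε) (hε1 : ε ≤ 1)
    (hhal : ∀ k, IsExpanderNetwork d₀ ε (hal k)) : IsArrayHalver ε (halve hal) where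
  perm := perm_halve
  halves := by
    intro v a k hlen hc
    have hk : a.length / 2 = k := by omega
    have hle : 2 * k ≤ a.length := by omega
    have hcount : (Finset.univ.filter fun w : Fin (2 * k) =>
        a.get ⟨w.val, by have := w.isLt; omega⟩ = v).card = a.count v := by
      rw [← count_ofFn, ← take_eq_ofFn a hle, List.take_of_length_le hlen.le]
    have hlen' : (halve hal a).length / 2 = k := by rw [(perm_halve a).length_eq, hk]
    have hd : a.drop (2 * k) = [] := List.drop_of_length_le hlen.le
    cases v
    · have := (hhal k).card_false_right_le hε hε1 _ (hcount.trans_le hc)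
      rw [hcount] at this
      simp only [half, Bool.not_false, if_true]
      rw [rightHalf, hlen', halve_eq hk, hd, List.append_nil, count_drop_ofFn]
      exact this
    · have := (hhal k).card_true_left_le hε hε1 _ (hcount.trans_le hc)
      rw [hcount] at this
      simp only [half, Bool.not_true, Bool.false_eq_true, if_false]
      rw [leftHalf, hlen', halve_eq hk, hd, List.append_nil, count_take_ofFn]
      exact this

end Halve

/-! ### Halvers placed on disjoint arrays of wires -/

section Placement

variable {n : ℕ} {α : Type*} [LinearOrder α]

theorem applyComparator_embed {m : ℕ} {e : Fin m → Fin n} (he : Function.Injective e)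
    (v : Fin n → α) (c : Fin m × Fin m) :
    applyComparator v (e c.1, e c.2) ∘ e = applyComparator (v ∘ e) c := by
  funext i
  simp only [applyComparator, Function.comp, he.eq_iff]

theorem applyComparator_of_ne {v : Fin n → α} {c : Fin n × Fin n} {w : Fin n} (h1 : w ≠ c.1)
    (h2 : w ≠ c.2) : applyComparator v c w = v w := by
  simp [applyComparator, h1, h2]

theorem foldl_applyComparator_embed {m : ℕ} {e : Fin m → Fin n} (he : Function.Injective e)
    (cs : List (Fin m × Fin m)) (v : Fin n → α) :
    ((cs.map fun c => (e c.1, e c.2)).foldl applyComparator v) ∘ e =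
      cs.foldl applyComparator (v ∘ e) := by
  induction cs generalizing v with
  | nil => rfl
  | cons c cs ih =>
    rw [List.map_cons, List.foldl_cons, List.foldl_cons, ih, applyComparator_embed he]

theorem foldl_applyComparator_of_notMem (cs : List (Fin n × Fin n)) (v : Fin n → α) {w : Fin n}
    (hw : ∀ c ∈ cs, w ≠ c.1 ∧ w ≠ c.2) : cs.foldl applyComparator v w = v w := by
  induction cs generalizing v with
  | nil => rfl
  | cons c cs ih =>
    rw [List.foldl_cons, ih _ fun c hc => hw c (by simp [hc]),
      applyComparator_of_ne (hw c (by simp)).1 (hw c (by simp)).2]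

/-- The wires of an array on which a halver is placed. -/
def arrayWire (a : List (Fin n)) (i : Fin (2 * (a.length / 2))) : Fin n :=
  a.get ⟨i.val, by have := i.isLt; omega⟩

theorem arrayWire_mem (a : List (Fin n)) (i : Fin (2 * (a.length / 2))) : arrayWire a i ∈ a :=
  List.get_mem _ _

theorem arrayWire_injective {a : List (Fin n)} (ha : a.Nodup) :
    Function.Injective (arrayWire a) := by
  intro i j h
  have := (List.nodup_iff_injective_get.1 ha) h
  simpa [Fin.ext_iff] using this

theorem placeLayer_eq (a : List (Fin n)) (N : ComparatorNetwork (2 * (a.length / 2))) (r : ℕ) :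
    placeLayer a N r = (N.layers.getD r []).map fun c => (arrayWire a c.1, arrayWire a c.2) := rfl

variable (hal : (k : ℕ) → ComparatorNetwork (2 * k))

theorem notMem_placeLayer {a : List (Fin n)} {r : ℕ} {w : Fin n}
    (hw : ∀ i, w ≠ arrayWire a i) :
    ∀ c ∈ placeLayer a (hal (a.length / 2)) r, w ≠ c.1 ∧ w ≠ c.2 := by
  intro c hc
  rw [placeLayer_eq, List.mem_map] at hc
  obtain ⟨c, -, rfl⟩ := hc
  exact ⟨hw _, hw _⟩

/-- Layer `r` of the halvers on the arrays `ℓ`. -/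
def placedLayer (ℓ : List (List (Fin n))) (r : ℕ) : List (Fin n × Fin n) :=
  ℓ.flatMap fun a => placeLayer a (hal (a.length / 2)) r

theorem foldl_placedLayer_of_notMem (ℓ : List (List (Fin n))) (r : ℕ) (v : Fin n → α) {w : Fin n}
    (hw : ∀ a ∈ ℓ, ∀ i, w ≠ arrayWire a i) :
    (placedLayer hal ℓ r).foldl applyComparator v w = v w := by
  apply foldl_applyComparator_of_notMem
  intro c hc
  obtain ⟨a, ha, hc⟩ := List.mem_flatMap.1 hc
  exact notMem_placeLayer hal (hw a ha) c hc

theorem foldl_placedLayer {ℓ : List (List (Fin n))} (hℓ : ℓ.flatten.Nodup) (r : ℕ)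
    (v : Fin n → α) {a : List (Fin n)} (ha : a ∈ ℓ) :
    (placedLayer hal ℓ r).foldl applyComparator v ∘ arrayWire a =
      ((hal (a.length / 2)).layers.getD r []).foldl applyComparator (v ∘ arrayWire a) := by
  induction ℓ generalizing v with
  | nil => simp at ha
  | cons b ℓ ih =>
    rw [List.flatten_cons, List.nodup_append'] at hℓ
    obtain ⟨hb, hℓ', hdis⟩ := hℓ
    have hsplit : (placedLayer hal (b :: ℓ) r).foldl applyComparator v =
        (placedLayer hal ℓ r).foldl applyComparator
          ((placeLayer b (hal (b.length / 2)) r).foldl applyComparator v) := by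
      simp [placedLayer, List.foldl_append]
    rw [hsplit]
    by_cases hab : a ∈ ℓ
    · rw [ih hℓ' _ hab]
      congr 1
      funext i
      apply foldl_applyComparator_of_notMem
      apply notMem_placeLayer
      intro i' h
      exact hdis (arrayWire_mem b i')
        (h ▸ List.mem_flatten.2 ⟨a, hab, arrayWire_mem a i⟩)
    · obtain rfl : a = b := by simpa [hab] using ha
      have h1 : (placedLayer hal ℓ r).foldl applyComparator
          ((placeLayer a (hal (a.length / 2)) r).foldl applyComparator v) ∘ arrayWire a =
          (placeLayer a (hal (a.length / 2)) r).foldl applyComparator v ∘ arrayWire a := by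
        funext i
        apply foldl_placedLayer_of_notMem
        intro c hc i' h
        exact hdis (arrayWire_mem a i)
          (List.mem_flatten.2 ⟨c, hc, h ▸ arrayWire_mem c i'⟩)
      rw [h1, placeLayer_eq, foldl_applyComparator_embed (arrayWire_injective hb)]

/-- The comparator layers of a layer of halvers. -/
def placedHalvers (d₀ : ℕ) (ℓ : List (List (Fin n))) : List (List (Fin n × Fin n)) :=
  (List.range d₀).map fun r => placedLayer hal ℓ r

/-- Process layers of comparators. -/
def runLayers (L : List (List (Fin n × Fin n))) (v : Fin n → α) : Fin n → α :=
  L.foldl (fun y ℓ => ℓ.foldl applyComparator y) v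

theorem runLayers_append (L L' : List (List (Fin n × Fin n))) (v : Fin n → α) :
    runLayers (L ++ L') v = runLayers L' (runLayers L v) := List.foldl_append

variable {hal}

theorem runLayers_placedHalvers_of_notMem (d₀ : ℕ) (ℓ : List (List (Fin n))) (v : Fin n → α)
    {w : Fin n} (hw : ∀ a ∈ ℓ, ∀ i, w ≠ arrayWire a i) :
    runLayers (placedHalvers hal d₀ ℓ) v w = v w := by
  induction d₀ with
  | zero => rfl
  | succ d ih =>
    rw [placedHalvers, List.range_succ, List.map_append, runLayers_append]
    exact (foldl_placedLayer_of_notMem hal ℓ d _ hw).trans ih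

theorem runLayers_placedHalvers_comp {d₀ : ℕ} (hd : ∀ k, (hal k).depth ≤ d₀)
    {ℓ : List (List (Fin n))} (hℓ : ℓ.flatten.Nodup) (v : Fin n → α) {a : List (Fin n)} (ha : a ∈ ℓ) :
    runLayers (placedHalvers hal d₀ ℓ) v ∘ arrayWire a =
      (hal (a.length / 2)).run (v ∘ arrayWire a) := by
  have key : ∀ r, runLayers (placedHalvers hal r ℓ) v ∘ arrayWire a =
      runLayers ((hal (a.length / 2)).layers.take r) (v ∘ arrayWire a) := by
    intro r
    induction r with
    | zero => simp [placedHalvers, runLayers]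
    | succ r ih =>
      rw [placedHalvers, List.range_succ, List.map_append, runLayers_append, List.take_add_one,
        runLayers_append, ← ih]
      refine (foldl_placedLayer hal hℓ r _ ha).trans ?_
      -- A halver of depth less than `d₀` is padded by the default empty layer, which does nothing.
      rw [List.getD_eq_getElem?_getD]
      cases (hal (a.length / 2)).layers[r]? <;> rfl
  rw [key, List.take_of_length_le (hd _)]
  rfl

/-- Disjoint arrays do not interfere. The last wire of an array of odd length is on no comparator,
which matches the tail that `halve` copies. -/
theorem map_runLayers_placedHalvers {d₀ : ℕ} (hd : ∀ k, (hal k).depth ≤ d₀)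
    {ℓ : List (List (Fin n))} (hℓ : ℓ.flatten.Nodup) (v : Fin n → α) {a : List (Fin n)} (ha : a ∈ ℓ) :
    a.map (runLayers (placedHalvers hal d₀ ℓ) v) = halve hal (a.map v) := by
  have hsplit : a = List.ofFn (arrayWire a) ++ a.drop (2 * (a.length / 2)) := by
    conv_lhs => rw [← List.take_append_drop (2 * (a.length / 2)) a]
    rw [take_eq_ofFn a (by omega)]
    rfl
  rw [halve_eq (k := a.length / 2) (by simp)]
  conv_lhs => rw [hsplit, List.map_append, List.map_ofFn, runLayers_placedHalvers_comp hd hℓ v ha]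
  congr 1
  · congr 2
    funext i
    simp [arrayWire]
  · rw [← List.map_drop]
    refine List.map_congr_left fun w hw => ?_
    apply runLayers_placedHalvers_of_notMem
    intro b hb i hwi
    rw [List.nodup_flatten] at hℓ
    have hand := hℓ.1 a ha
    rw [hsplit, List.nodup_append'] at hand
    by_cases hab : b = a
    · subst hab
      exact hand.2.2 ((List.mem_ofFn' _ _).2 ⟨i, hwi.symm⟩) hw
    · have : Std.Symm (List.Disjoint (α := Fin n)) := ⟨fun _ _ h => h.symm⟩
      exact hℓ.2.forall hb ha hab (hwi ▸ arrayWire_mem b i) (List.mem_of_mem_drop hw)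

end Placement

/-! ### The four layers of a separator on wires and on contents -/

section Stages

variable {β γ : Type*} {h : List γ → List γ}

theorem onHalf_false_true {f g : List γ → List γ} (hg : ∀ a, (g a).length = a.length) (a : List γ) :
    onHalf false f (onHalf true g a) = f (leftHalf a) ++ g (rightHalf a) := by
  have h1 : leftHalf (onHalf true g a) = leftHalf a := half_onHalf_not hg true a
  have h2 : rightHalf (onHalf true g a) = g (rightHalf a) := half_onHalf_self hg true a
  conv_lhs => rw [onHalf]
  simp [h1, h2]

/-- A change of the contents that acts as `h` on the arrays of stage `s` and fixes the other wires
is `sepStage`. Distinctness of the wires ensures that the remaining blocks of the array avoid the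
halvers. -/
theorem map_eq_sepStage (hh : ∀ a, (h a).Perm a) {s : ℕ} (hs : s < 4) (a : List β)
    (v v' : β → γ) (h1 : ∀ b ∈ (separatorStages a).getD s [], b.map v' = h (b.map v))
    (h2 : ∀ w ∈ a, (∀ b ∈ (separatorStages a).getD s [], w ∉ b) → v' w = v w) (ha : a.Nodup) :
    a.map v' = sepStage h s (a.map v) := by
  have l0 : ∀ a, (h a).length = a.length := fun a => (hh a).length_eq
  have l1 : ∀ b a, (onHalf b h a).length = a.length := fun b a => (perm_onHalf hh b a).length_eq
  have l2 : ∀ b b' a, (onHalf b' (onHalf b h) a).length = a.length :=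
    fun b b' a => (perm_onHalf (perm_onHalf hh b) b' a).length_eq
  have fix : ∀ u : List β, (∀ w ∈ u, w ∈ a ∧ ∀ b ∈ (separatorStages a).getD s [], w ∉ b) →
      u.map v' = u.map v := fun u hu => List.map_congr_left fun w hw => h2 w (hu w hw).1 (hu w hw).2
  have eL := leftHalf_append_rightHalf a
  have eLL := leftHalf_append_rightHalf (leftHalf a)
  have eRR := leftHalf_append_rightHalf (rightHalf a)
  have eLLL := leftHalf_append_rightHalf (leftHalf (leftHalf a))
  have eRRR := leftHalf_append_rightHalf (rightHalf (rightHalf a))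
  interval_cases s
  · exact h1 a (by simp [separatorStages])
  · simp only [separatorStages, List.getD_cons_succ, List.getD_cons_zero, List.mem_cons,
      List.not_mem_nil, or_false, forall_eq_or_imp, forall_eq] at h1
    rw [sepStage, onHalf_false_true l0, leftHalf_map, rightHalf_map, ← h1.1, ← h1.2,
      ← List.map_append, eL]
  · simp only [separatorStages, List.getD_cons_succ, List.getD_cons_zero, List.mem_cons,
      List.not_mem_nil, or_false, forall_eq_or_imp, forall_eq] at h1 fix
    rw [sepStage, onHalf_false_true (l1 _)]
    simp only [onHalf, Bool.false_eq_true, if_false, if_true, leftHalf_map, rightHalf_map]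
    have nd : (leftHalf (leftHalf a) ++ rightHalf (leftHalf a) ++
        (leftHalf (rightHalf a) ++ rightHalf (rightHalf a))).Nodup := by rwa [eLL, eRR, eL]
    have mem : ∀ w, w ∈ a ↔ w ∈ (leftHalf (leftHalf a) ++ rightHalf (leftHalf a) ++
        (leftHalf (rightHalf a) ++ rightHalf (rightHalf a))) := by rw [eLL, eRR, eL]; simp
    simp only [List.nodup_append', List.mem_append, List.Disjoint] at nd mem
    rw [← h1.1, ← h1.2, ← fix (rightHalf (leftHalf a)), ← fix (leftHalf (rightHalf a)),
      ← List.map_append, ← List.map_append, ← List.map_append, eLL, eRR, eL]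
    · intro w hw
      refine ⟨(mem w).2 (by tauto), fun h => ?_, fun h => ?_⟩
      · exact nd.2.2 (Or.inl h) (Or.inl hw)
      · exact nd.2.1.2.2 hw h
    · intro w hw
      refine ⟨(mem w).2 (by tauto), fun h => ?_, fun h => ?_⟩
      · exact nd.1.2.2 h hw
      · exact nd.2.2 (Or.inr hw) (Or.inr h)
  · simp only [separatorStages, List.getD_cons_succ, List.getD_cons_zero, List.mem_cons,
      List.not_mem_nil, or_false, forall_eq_or_imp, forall_eq] at h1 fix
    rw [sepStage, onHalf_false_true (l2 _ _)]
    simp only [onHalf, Bool.false_eq_true, if_false, if_true, leftHalf_map, rightHalf_map]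
    have nd : ((leftHalf (leftHalf (leftHalf a)) ++ rightHalf (leftHalf (leftHalf a))) ++
        rightHalf (leftHalf a) ++ (leftHalf (rightHalf a) ++
          (leftHalf (rightHalf (rightHalf a)) ++ rightHalf (rightHalf (rightHalf a))))).Nodup := by
      rwa [eLLL, eRRR, eLL, eRR, eL]
    have mem : ∀ w, w ∈ a ↔
        w ∈ ((leftHalf (leftHalf (leftHalf a)) ++ rightHalf (leftHalf (leftHalf a))) ++
        rightHalf (leftHalf a) ++ (leftHalf (rightHalf a) ++
          (leftHalf (rightHalf (rightHalf a)) ++ rightHalf (rightHalf (rightHalf a))))) := by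
      rw [eLLL, eRRR, eLL, eRR, eL]; simp
    simp only [List.nodup_append', List.mem_append, List.Disjoint] at nd mem
    obtain ⟨⟨⟨-, -, n1⟩, -, n2⟩, ⟨-, ⟨-, -, n3⟩, n4⟩, n5⟩ := nd
    rw [← h1.1, ← h1.2, ← fix (rightHalf (leftHalf a)), ← fix (leftHalf (rightHalf a)),
      ← fix (rightHalf (leftHalf (leftHalf a))), ← fix (leftHalf (rightHalf (rightHalf a))),
      ← List.map_append, ← List.map_append, ← List.map_append, ← List.map_append,
      ← List.map_append, eLLL, eRRR, eLL, eRR, eL]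
    · intro w hw
      refine ⟨(mem w).2 (by tauto), fun h => ?_, fun h => ?_⟩
      · exact n5 (Or.inl (Or.inl h)) (Or.inr (Or.inl hw))
      · exact n3 hw h
    · intro w hw
      refine ⟨(mem w).2 (by tauto), fun h => ?_, fun h => ?_⟩
      · exact n1 h hw
      · exact n5 (Or.inl (Or.inr hw)) (Or.inr (Or.inr h))
    · intro w hw
      refine ⟨(mem w).2 (by tauto), fun h => ?_, fun h => ?_⟩
      · exact n5 (Or.inl (Or.inl h)) (Or.inl hw)
      · exact n4 hw (Or.inr h)
    · intro w hw
      refine ⟨(mem w).2 (by tauto), fun h => ?_, fun h => ?_⟩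
      · exact n2 (Or.inl h) hw
      · exact n5 (Or.inr hw) (Or.inr (Or.inr h))

theorem flatten_separatorStages_sublist (a : List β) (s : ℕ) :
    ((separatorStages a).getD s []).flatten.Sublist a := by
  have eL := leftHalf_append_rightHalf a
  have sl : ∀ a : List β, (leftHalf a).Sublist a := fun a => List.take_sublist _ _
  have sr : ∀ a : List β, (rightHalf a).Sublist a := fun a => List.drop_sublist _ _
  match s with
  | 0 => simp [separatorStages]
  | 1 => simp [separatorStages, eL]
  | 2 =>
    simp only [separatorStages, List.getD_cons_succ, List.getD_cons_zero, List.flatten_cons,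
      List.flatten_nil, List.append_nil]
    conv_rhs => rw [← eL]
    exact (sl _).append (sr _)
  | 3 =>
    simp only [separatorStages, List.getD_cons_succ, List.getD_cons_zero, List.flatten_cons,
      List.flatten_nil, List.append_nil]
    conv_rhs => rw [← eL]
    exact ((sl _).trans (sl _)).append ((sr _).trans (sr _))
  | s + 4 => simp [separatorStages]

end Stages

/-! ### Separators of one time slot use disjoint wires -/

section Wires

variable {n : ℕ}

theorem mem_separatorsAt {J D t : ℕ} {j : ℕ} {p : List Bool} :
    (j, p) ∈ separatorsAt J D t ↔ j ≤ J ∧ p.length ≤ D - j ∧ p.length + 2 * j = t := by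
  simp only [separatorsAt, List.mem_flatMap, List.mem_range]
  constructor
  · rintro ⟨j', hj', d, hd, h⟩
    split_ifs at h with hc
    · simp only [List.mem_map, Prod.mk.injEq] at h
      obtain ⟨p', hp', rfl, rfl⟩ := h
      have := length_of_mem_nodesAt hp'
      omega
    · simp at h
  · rintro ⟨h1, h2, h3⟩
    refine ⟨j, by omega, p.length, by omega, ?_⟩
    rw [if_pos h3]
    exact List.mem_map_of_mem (mem_nodesAt p)

/-- The number of occurrences of a wire is additive, so it flows through the trees with total 1;
conservation then becomes disjointness. -/
theorem treeFlow_wires (n : ℕ) (w : Fin n) :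
    TreeFlow (fun j p => (sepInput n j p).count w)
      (fun j p => (outA1 (sepInput n j p)).count w + (outA4 (sepInput n j p)).count w)
      (fun b j p => (toChild b (sepInput n j p)).count w) 1 := by
  have h := treeFlow_of_additive (μ := List.count w) (fun _ _ => List.count_append) (S := id)
    (fun _ => rfl) (List.finRange n)
  rw [List.count_eq_one_of_mem (List.nodup_finRange n) (List.mem_finRange w)] at h
  simpa only [id, ← sepInput_eq_treeArray] using h

theorem TreeFlow.sum_slot_le {c up : ℕ → List Bool → ℕ} {dn : Bool → ℕ → List Bool → ℕ} {tot : ℕ}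
    (h : TreeFlow c up dn tot) (J t : ℕ) :
    ∑ j ∈ Finset.range (J + 1), (if 2 * j ≤ t then sumAt (t - 2 * j) (c j) else 0) ≤ tot := by
  rw [← Finset.sum_filter]
  have hsub : (Finset.range (J + 1)).filter (fun j => 2 * j ≤ t) ⊆ Finset.range (t / 2 + 1) := by
    intro j hj
    simp only [Finset.mem_filter, Finset.mem_range] at hj ⊢
    omega
  refine (Finset.sum_le_sum_of_subset hsub).trans ?_
  obtain ⟨m, rfl | rfl⟩ : ∃ m, t = 2 * m ∨ t = 2 * m + 1 := ⟨t / 2, by omega⟩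
  · rw [show 2 * m / 2 = m by omega, Finset.sum_range_succ, ← (h.conservation m).1]
    have : sumAt (2 * m - 2 * m) (c m) = c m [] := by rw [Nat.sub_self]; rfl
    rw [this]
    refine le_of_eq (congrArg (· + _) (Finset.sum_congr rfl fun i _ => ?_))
    rw [Nat.mul_sub]
  · rw [show (2 * m + 1) / 2 = m by omega, ← (h.conservation m).2]
    refine le_trans (le_of_eq (Finset.sum_congr rfl fun i hi => ?_)) (Nat.le_add_right _ _)
    have := Finset.mem_range.1 hi
    congr 1
    omega

/-- The separators of slot `t` in the cut trees are among those of the unbounded trees, where a wire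
occurs at most once per slot. -/
theorem nodup_slot (J D t : ℕ) :
    ((separatorsAt J D t).flatMap fun q => sepInput n q.1 q.2).Nodup := by
  rw [List.nodup_iff_count_le_one]
  intro w
  refine le_trans ?_ ((treeFlow_wires n w).sum_slot_le J t)
  rw [separatorsAt, List.flatMap_assoc, List.count_flatMap]
  change _ ≤ ((List.range (J + 1)).map _).sum
  refine List.sum_le_sum fun j _ => ?_
  simp only [Function.comp]
  rw [List.flatMap_assoc, List.count_flatMap]
  have h1 : ∀ d, (List.count w ∘ fun d => (if d + 2 * j = t then
      (nodesAt d).map fun p => (j, p) else []).flatMap fun q => sepInput n q.1 q.2) d =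
      if d + 2 * j = t then sumAt d (fun p => (sepInput n j p).count w) else 0 := by
    intro d
    simp only [Function.comp]
    split_ifs
    · rw [List.flatMap_map, List.count_flatMap, ← sum_map_nodesAt]
      rfl
    · rfl
  rw [funext h1]
  change ∑ d ∈ Finset.range (D - j + 1), _ ≤ _
  rw [← Finset.sum_filter]
  split_ifs with hj
  · have hsub : (Finset.range (D - j + 1)).filter (fun d => d + 2 * j = t) ⊆ {t - 2 * j} := by
      intro d hd
      simp only [Finset.mem_filter, Finset.mem_range, Finset.mem_singleton] at hd ⊢
      omega
    exact (Finset.sum_le_sum_of_subset hsub).trans (by simp)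
  · rw [Finset.filter_eq_empty_iff.2 (fun d _ => by omega)]
    simp

theorem nodup_sepInput (j : ℕ) (p : List Bool) : (sepInput n j p).Nodup :=
  -- These parameters just include the node `p` of tree `j`.
  (List.nodup_flatMap.1 (nodup_slot (n := n) j (p.length + j) (p.length + 2 * j))).1 (j, p)
    (mem_separatorsAt.2 ⟨le_rfl, by omega, rfl⟩)

/-- In each time slot a wire belongs to at most one separator. -/
theorem sepInput_unique {j j' : ℕ} {p p' : List Bool} {w : Fin n}
    (ht : p.length + 2 * j = p'.length + 2 * j') (h : w ∈ sepInput n j p)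
    (h' : w ∈ sepInput n j' p') : j = j' ∧ p = p' := by
  by_contra hne
  have := (List.nodup_flatMap.1 (nodup_slot (n := n) (j + j') (p.length + j + p'.length + j')
    (p.length + 2 * j))).2
  have hs : Std.Symm (Function.onFun List.Disjoint
      fun q : ℕ × List Bool => sepInput n q.1 q.2) := ⟨fun _ _ h => h.symm⟩
  refine this.forall (a := (j, p)) (b := (j', p')) (mem_separatorsAt.2 (by omega))
    (mem_separatorsAt.2 (by omega)) (fun h => hne ?_) h h'
  simpa using h

/-- The extreme outputs of a root pass by one time slot. -/
theorem root_outputs_disjoint {j j' : ℕ} {p' : List Bool} {w : Fin n}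
    (ht : p'.length + 2 * j' = 2 * j + 1)
    (h : w ∈ outA1 (sepInput n j []) ∨ w ∈ outA4 (sepInput n j []))
    (h' : w ∈ sepInput n j' p') : False := by
  have hc := ((treeFlow_wires n w).conservation j).2
  have h1 : 1 ≤ (sepInput n j' p').count w := List.count_pos_iff.2 h'
  have h2 : 1 ≤ (outA1 (sepInput n j [])).count w + (outA4 (sepInput n j [])).count w := by
    rcases h with h | h
    · have := List.count_pos_iff.2 h; omega
    · have := List.count_pos_iff.2 h; omega
  have h3 := le_sumAt (d := 2 * (j - j') + 1) (fun p => (sepInput n j' p).count w) (p := p')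
    (by omega)
  have h4 := Finset.single_le_sum
    (f := fun i => sumAt (2 * (j - i) + 1) (fun p => (sepInput n i p).count w))
    (fun _ _ => Nat.zero_le _) (Finset.mem_range.2 (show j' < j + 1 by omega))
  omega

end Wires

/-! ### The network follows the tree recursion -/

section Slots

variable {n : ℕ} {hal : (k : ℕ) → ComparatorNetwork (2 * k)} {J D d₀ : ℕ}

/-- The arrays of the halvers in layer `s` of time slot `t`. -/
def slotArrays (n J D t s : ℕ) : List (List (Fin n)) :=
  (separatorsAt J D t).flatMap fun q => (separatorStages (sepInput n q.1 q.2)).getD s []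

/-- The layers of comparators of time slot `t`. -/
def slotLayers (hal : (k : ℕ) → ComparatorNetwork (2 * k)) (n J D d₀ t : ℕ) :
    List (List (Fin n × Fin n)) :=
  (List.range 4).flatMap fun s => placedHalvers hal d₀ (slotArrays n J D t s)

theorem aksLayers_eq : aksLayers n J D d₀ hal =
    (List.range (D + J + 1)).flatMap (slotLayers hal n J D d₀) := by
  rw [aksLayers, halverLayers, List.flatMap_assoc]
  congr 1

theorem flatten_flatMap_sublist {ι β : Type*} (l : List ι) (f : ι → List (List β)) (g : ι → List β)
    (h : ∀ i, (f i).flatten.Sublist (g i)) : (l.flatMap f).flatten.Sublist (l.flatMap g) := by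
  induction l with
  | nil => simp
  | cons i l ih =>
    rw [List.flatMap_cons, List.flatMap_cons, List.flatten_append]
    exact (h i).append ih

theorem slotArrays_sublist (t s : ℕ) : (slotArrays n J D t s).flatten.Sublist
    ((separatorsAt J D t).flatMap fun q => sepInput n q.1 q.2) :=
  flatten_flatMap_sublist _ _ _ fun _ => flatten_separatorStages_sublist _ _

theorem nodup_slotArrays (t s : ℕ) : (slotArrays n J D t s).flatten.Nodup :=
  (slotArrays_sublist t s).nodup (nodup_slot J D t)

variable {α : Type*} [LinearOrder α]

theorem runLayers_slot_of_notMem {t : ℕ} {w : Fin n} (v : Fin n → α)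
    (hw : ∀ q ∈ separatorsAt J D t, w ∉ sepInput n q.1 q.2) :
    runLayers (slotLayers hal n J D d₀ t) v w = v w := by
  have key : ∀ S : List ℕ, runLayers (S.flatMap fun s =>
      placedHalvers hal d₀ (slotArrays n J D t s)) v w = v w := by
    intro S
    induction S generalizing v with
    | nil => rfl
    | cons s S ih =>
      rw [List.flatMap_cons, runLayers_append, ih]
      apply runLayers_placedHalvers_of_notMem
      intro a ha i hwi
      have : w ∈ (slotArrays n J D t s).flatten :=
        List.mem_flatten.2 ⟨a, ha, hwi ▸ arrayWire_mem a i⟩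
      obtain ⟨q, hq, hwq⟩ := List.mem_flatMap.1 ((slotArrays_sublist t s).subset this)
      exact hw q hq hwq
  exact key _

theorem map_runLayers_slot (hd : ∀ k, (hal k).depth ≤ d₀) {t j : ℕ} {p : List Bool}
    (hq : (j, p) ∈ separatorsAt J D t) (v : Fin n → α) :
    (sepInput n j p).map (runLayers (slotLayers hal n J D d₀ t) v) =
      sepFun (halve hal) ((sepInput n j p).map v) := by
  have stage : ∀ s < 4, ∀ v : Fin n → α,
      (sepInput n j p).map (runLayers (placedHalvers hal d₀ (slotArrays n J D t s)) v) =
        sepStage (halve hal) s ((sepInput n j p).map v) := by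
    intro s hs v
    refine map_eq_sepStage perm_halve hs _ v _ (fun b hb => ?_) (fun w hw hwb => ?_)
      (nodup_sepInput j p)
    · exact map_runLayers_placedHalvers hd (nodup_slotArrays t s) v
        (List.mem_flatMap.2 ⟨(j, p), hq, hb⟩)
    · apply runLayers_placedHalvers_of_notMem
      intro a ha i hwi
      have hwa : w ∈ a := hwi ▸ arrayWire_mem a i
      obtain ⟨⟨j', p'⟩, hq', ha'⟩ := List.mem_flatMap.1 ha
      have hw' : w ∈ sepInput n j' p' :=
        (flatten_separatorStages_sublist _ s).subset (List.mem_flatten.2 ⟨a, ha', hwa⟩)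
      have h1 := mem_separatorsAt.1 hq
      have h2 := mem_separatorsAt.1 hq'
      obtain ⟨rfl, rfl⟩ := sepInput_unique (by omega) hw hw'
      exact hwb a ha' hwa
  have e : slotLayers hal n J D d₀ t =
      placedHalvers hal d₀ (slotArrays n J D t 0) ++ (placedHalvers hal d₀ (slotArrays n J D t 1) ++
        (placedHalvers hal d₀ (slotArrays n J D t 2) ++
          placedHalvers hal d₀ (slotArrays n J D t 3))) := by
    simp [slotLayers, List.range_succ]
  rw [e, runLayers_append, runLayers_append, runLayers_append, stage 3 (by norm_num),
    stage 2 (by norm_num), stage 1 (by norm_num), stage 0 (by norm_num)]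
  rfl

/-- The contents of the wires before time slot `t`. -/
def stateAt (hal : (k : ℕ) → ComparatorNetwork (2 * k)) (J D d₀ : ℕ) (x : Fin n → α) (t : ℕ) :
    Fin n → α :=
  runLayers ((List.range t).flatMap (slotLayers hal n J D d₀)) x

variable {x : Fin n → α}

theorem stateAt_succ (t : ℕ) : stateAt hal J D d₀ x (t + 1) =
    runLayers (slotLayers hal n J D d₀ t) (stateAt hal J D d₀ x t) := by
  rw [stateAt, List.range_succ, List.flatMap_append, runLayers_append]
  simp [stateAt]

/-- Before time slot `t` the wire `w` has left the part of the tree that the network has. -/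
def HasLeft (n J D t : ℕ) (w : Fin n) : Prop :=
  (∃ j p, p.length + 2 * j = t ∧ (J < j ∨ D < p.length + j) ∧ w ∈ sepInput n j p) ∨
  ∃ j, J ≤ j ∧ 2 * j + 1 = t ∧ (w ∈ outA1 (sepInput n j []) ∨ w ∈ outA4 (sepInput n j []))

theorem mem_sepInput_cons {j : ℕ} {b : Bool} {p : List Bool} {w : Fin n}
    (h : w ∈ toChild b (sepInput n j p)) : w ∈ sepInput n j (b :: p) := by
  cases j with
  | zero => exact h
  | succ j =>
    simp only [sepInput] at h ⊢
    simp [inputSucc, h]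

theorem mem_sepInput_succ {j : ℕ} {b : Bool} {p : List Bool} {w : Fin n}
    (h : w ∈ outA1 (sepInput n j (b :: p)) ∨ w ∈ outA4 (sepInput n j (b :: p))) :
    w ∈ sepInput n (j + 1) p := by
  cases p <;> simp only [sepInput, inputSucc, List.mem_append] <;> cases b <;> tauto

theorem mem_sepInput_succ_nil {j : ℕ} {w : Fin n}
    (h : w ∈ outA1 (sepInput n j []) ∨ w ∈ outA4 (sepInput n j [])) :
    w ∈ sepInput n (j + 1) [] := by
  simp only [sepInput, inputSucc, List.mem_append]; tauto

theorem mem_outs {β : Type*} {a : List β} {w : β} (h : w ∈ a) :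
    (w ∈ outA1 a ∨ w ∈ outA4 a) ∨ ∃ b, w ∈ toChild b a := by
  rw [← outs_append a] at h
  simp only [List.mem_append] at h
  rcases h with (h | h) | (h | h)
  · exact Or.inl (Or.inl h)
  · exact Or.inr ⟨false, by simpa [toChild] using h⟩
  · exact Or.inr ⟨true, by simpa [toChild] using h⟩
  · exact Or.inl (Or.inr h)

/-- Moving up to the next tree keeps `p.length + j` and increases `j`; moving down increases
`p.length + j`. So a wire beyond one of the cuts stays beyond it, and its content is final. -/
theorem HasLeft.succ (hJ : J ≤ D) {t : ℕ} {w : Fin n} (h : HasLeft n J D t w) :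
    HasLeft n J D (t + 1) w := by
  rcases h with ⟨j, p, ht, hout, hw⟩ | ⟨j, hj, ht, hw⟩
  · rcases mem_outs hw with hw | ⟨b, hw⟩
    · cases p with
      | nil =>
        simp only [List.length_nil] at ht hout
        exact Or.inr ⟨j, by omega, by omega, hw⟩
      | cons b p =>
        simp only [List.length_cons] at ht hout
        exact Or.inl ⟨j + 1, p, by omega, by omega, mem_sepInput_succ hw⟩
    · exact Or.inl ⟨j, b :: p, by simp; omega, by simp; omega, mem_sepInput_cons hw⟩
  · exact Or.inl ⟨j + 1, [], by simp; omega, by omega, mem_sepInput_succ_nil hw⟩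

theorem HasLeft.notMem (hJ : J ≤ D) {t : ℕ} {w : Fin n} (h : HasLeft n J D t w) :
    ∀ q ∈ separatorsAt J D t, w ∉ sepInput n q.1 q.2 := by
  rintro ⟨j', p'⟩ hq (hw' : w ∈ sepInput n j' p')
  have h1 := mem_separatorsAt.1 hq
  rcases h with ⟨j, p, ht, hout, hw⟩ | ⟨j, hj, ht, hw⟩
  · obtain ⟨rfl, rfl⟩ := sepInput_unique (by omega) hw hw'
    omega
  · exact root_outputs_disjoint (by omega) hw hw'

theorem HasLeft.stateAt_eq (hJ : J ≤ D) {t : ℕ} {w : Fin n} (h : HasLeft n J D t w) (s : ℕ) :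
    stateAt hal J D d₀ x (t + s) w = stateAt hal J D d₀ x t w := by
  have key : HasLeft n J D (t + s) w ∧
      stateAt hal J D d₀ x (t + s) w = stateAt hal J D d₀ x t w := by
    induction s with
    | zero => exact ⟨h, rfl⟩
    | succ s ih =>
      refine ⟨ih.1.succ hJ, ?_⟩
      rw [← add_assoc, stateAt_succ, runLayers_slot_of_notMem _ (ih.1.notMem hJ), ih.2]
  exact key.2

/-- The contents of the arrays follow the tree. -/
theorem map_stateAt (hJ : J ≤ D) (hd : ∀ k, (hal k).depth ≤ d₀) (t : ℕ) :
    ∀ {j : ℕ} {p : List Bool}, j ≤ J → p.length ≤ D - j → p.length + 2 * j = t →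
      (sepInput n j p).map (stateAt hal J D d₀ x t) =
        treeArray (sepFun (halve hal)) (List.ofFn x) j p := by
  induction t using Nat.strong_induction_on with
  | _ t IH =>
  intro j p hj hp ht
  -- All arrays that feed a separator inside the cut come from separators inside the cut: a child in
  -- the previous tree has depth at most `D - j + 1`, which that tree still contains.
  have after : ∀ {s i : ℕ} {q : List Bool}, s + 1 ≤ t → i ≤ J → q.length ≤ D - i →
      q.length + 2 * i = s → (sepInput n i q).map (stateAt hal J D d₀ x (s + 1)) =
        sepFun (halve hal) (treeArray (sepFun (halve hal)) (List.ofFn x) i q) := by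
    intro s i q hs hi hq hsq
    rw [stateAt_succ, map_runLayers_slot hd (mem_separatorsAt.2 ⟨hi, hq, hsq⟩),
      IH s (by omega) hi hq hsq]
  have up : ∀ {i : ℕ} {q : List Bool}, i ≤ J → q.length ≤ D - i → q.length + 2 * i + 1 = t →
      (outA1 (sepInput n i q) ++ outA4 (sepInput n i q)).map (stateAt hal J D d₀ x t) =
        outA1 (sepFun (halve hal) (treeArray (sepFun (halve hal)) (List.ofFn x) i q)) ++
        outA4 (sepFun (halve hal) (treeArray (sepFun (halve hal)) (List.ofFn x) i q)) := by
    intro i q hi hq ht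
    rw [← after ht.le hi hq rfl, outA1_map, outA4_map, List.map_append]
    subst ht; rfl
  have down : ∀ {i : ℕ} {q : List Bool} (b : Bool), i ≤ J → q.length ≤ D - i →
      q.length + 2 * i + 1 = t → (toChild b (sepInput n i q)).map (stateAt hal J D d₀ x t) =
        toChild b (sepFun (halve hal) (treeArray (sepFun (halve hal)) (List.ofFn x) i q)) := by
    intro i q b hi hq ht
    rw [← after ht.le hi hq rfl, toChild_map]
    subst ht; rfl
  cases j with
  | zero =>
    cases p with
    | nil =>
      obtain rfl : t = 0 := by simpa using ht.symm
      simp [sepInput, inputZero, treeArray, treeZero, stateAt, runLayers, List.ofFn_eq_map]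
    | cons b p =>
      simp only [List.length_cons] at hp ht
      have h := down (i := 0) (q := p) b (Nat.zero_le _) (by omega) (by omega)
      simp only [sepInput, inputZero, treeArray, treeZero] at h ⊢
      exact h
  | succ j =>
    cases p with
    | nil =>
      simp only [List.length_nil] at hp ht
      -- The extreme outputs of the root arrive two slots later; the slot between does not touch
      -- them.
      have hroot : (outA1 (sepInput n j []) ++ outA4 (sepInput n j [])).map
          (stateAt hal J D d₀ x t) =
          outA1 (sepFun (halve hal) (treeArray (sepFun (halve hal)) (List.ofFn x) j [])) ++
          outA4 (sepFun (halve hal) (treeArray (sepFun (halve hal)) (List.ofFn x) j [])) := by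
        rw [← after (s := 2 * j) (by omega) (by omega) (by simp) (by simp), outA1_map, outA4_map,
          ← List.map_append]
        refine List.map_congr_left fun w hw => ?_
        obtain rfl : t = 2 * j + 1 + 1 := by omega
        rw [stateAt_succ]
        apply runLayers_slot_of_notMem
        rintro ⟨j', p'⟩ hq (hw' : w ∈ sepInput n j' p')
        exact root_outputs_disjoint (mem_separatorsAt.1 hq).2.2 (List.mem_append.1 hw) hw'
      rw [sepInput, inputSucc, treeArray, treeSucc, List.map_append, List.map_append, hroot,
        up (by omega) (by simp; omega) (by simp; omega),
        up (by omega) (by simp; omega) (by simp; omega)]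
    | cons b p =>
      simp only [List.length_cons] at hp ht
      have hdown := down (i := j + 1) (q := p) b hj (by omega) (by omega)
      rw [sepInput, treeArray] at hdown
      rw [sepInput, inputSucc, treeArray, treeSucc, List.map_append, List.map_append, hdown,
        up (by omega) (by simp; omega) (by simp; omega),
        up (by omega) (by simp; omega) (by simp; omega)]

theorem map_stateAt_succ (hJ : J ≤ D) (hd : ∀ k, (hal k).depth ≤ d₀) {j : ℕ} {p : List Bool}
    (hj : j ≤ J) (hp : p.length ≤ D - j) :
    (sepInput n j p).map (stateAt hal J D d₀ x (p.length + 2 * j + 1)) =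
      sepFun (halve hal) (treeArray (sepFun (halve hal)) (List.ofFn x) j p) := by
  rw [stateAt_succ, map_runLayers_slot hd (mem_separatorsAt.2 ⟨hj, hp, rfl⟩),
    map_stateAt hJ hd _ hj hp rfl]

/-- The final contents of the outputs of the leaves. -/
theorem map_final_leaf (hJ : J ≤ D) (hd : ∀ k, (hal k).depth ≤ d₀) {j : ℕ} {p : List Bool}
    (hj : j ≤ J) (hp : p.length = D - j) (b : Bool) :
    (toChild b (sepInput n j p)).map (stateAt hal J D d₀ x (D + J + 1)) =
      toChild b (sepFun (halve hal) (treeArray (sepFun (halve hal)) (List.ofFn x) j p)) := by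
  rw [← map_stateAt_succ hJ hd hj hp.le, toChild_map]
  refine List.map_congr_left fun w hw => ?_
  obtain ⟨s, hs⟩ : ∃ s, D + J + 1 = p.length + 2 * j + 1 + s := ⟨J - j, by omega⟩
  rw [hs]
  refine HasLeft.stateAt_eq hJ (Or.inl ⟨j, b :: p, ?_, ?_, mem_sepInput_cons hw⟩) s
  · simp; omega
  · simp; omega

end Slots

/-! ### The reduced network and its depth -/

section ReducedNetwork

variable {n J D d₀ : ℕ} {hal : (k : ℕ) → ComparatorNetwork (2 * k)}

theorem nodup_placedLayer {ℓ : List (List (Fin n))} (hℓ : ℓ.flatten.Nodup) (r : ℕ) :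
    ((placedLayer hal ℓ r).flatMap fun c => [c.1, c.2]).Nodup := by
  have hmap : ∀ a : List (Fin n), ((placeLayer a (hal (a.length / 2)) r).flatMap
      fun c => [c.1, c.2]) =
      (((hal (a.length / 2)).layers.getD r []).flatMap fun c => [c.1, c.2]).map (arrayWire a) := by
    intro a
    rw [placeLayer_eq, List.flatMap_map, List.map_flatMap]
    rfl
  rw [List.nodup_flatten] at hℓ
  rw [placedLayer, List.flatMap_assoc, List.nodup_flatMap]
  constructor
  · intro a ha
    rw [hmap]
    refine List.Nodup.map (arrayWire_injective (hℓ.1 a ha)) ?_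
    rw [List.getD_eq_getElem?_getD]
    cases h : (hal (a.length / 2)).layers[r]? with
    | none => simp
    | some l => exact (hal (a.length / 2)).disjoint l (List.mem_of_getElem? h)
  · refine hℓ.2.imp fun {a b} hab => ?_
    simp only [Function.onFun, hmap]
    intro w hwa hwb
    obtain ⟨i, -, rfl⟩ := List.mem_map.1 hwa
    obtain ⟨i', -, hi'⟩ := List.mem_map.1 hwb
    exact hab (arrayWire_mem a i) (hi' ▸ arrayWire_mem b i')

/-- The reduced network of separators made of the halvers `hal`. -/
def aksNetwork (hal : (k : ℕ) → ComparatorNetwork (2 * k)) (n J D d₀ : ℕ) : ComparatorNetwork n where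
  layers := aksLayers n J D d₀ hal
  disjoint := by
    intro ℓ hℓ
    rw [aksLayers_eq] at hℓ
    simp only [List.mem_flatMap, slotLayers, placedHalvers, List.mem_map] at hℓ
    obtain ⟨t, -, s, -, r, -, rfl⟩ := hℓ
    exact nodup_placedLayer (nodup_slotArrays t s) r

theorem run_aksNetwork {α : Type*} [LinearOrder α] (x : Fin n → α) :
    (aksNetwork hal n J D d₀).run x = stateAt hal J D d₀ x (D + J + 1) := by
  change runLayers (aksLayers n J D d₀ hal) x = _
  rw [aksLayers_eq]
  rfl

theorem length_halverLayers (n J D : ℕ) : (halverLayers n J D).length = 4 * (D + J + 1) := by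
  simp [halverLayers, mul_comm]

theorem depth_aksNetwork : (aksNetwork hal n J D d₀).depth = d₀ * (halverLayers n J D).length := by
  simp [ComparatorNetwork.depth, aksNetwork, aksLayers, mul_comm]

end ReducedNetwork

/-! ### The output order -/

section Collect

variable {n J D : ℕ}

/-- The outputs on one side. -/
def toSide {β : Type*} (b : Bool) (p : List Bool) (x y : List β) : List β :=
  if b then toR p x y else toL p x y

theorem toSide_append {β : Type*} (b : Bool) (q : List Bool) (x y : List β) :
    toSide b (q ++ [b]) x y = x ++ y ∧ toSide b (q ++ [!b]) x y = [] := by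
  cases b <;> simp [toSide, toL, toR]

theorem toSide_sublist {β : Type*} (b : Bool) (p : List Bool) (x y : List β) :
    (toSide b p x y).Sublist (x ++ y) := by
  unfold toSide toL toR
  cases b <;> rcases p.getLast? with _ | _ | _ <;> simp

theorem additive_nil {β : Type*} {μ : List β → ℕ} (hμ : ∀ a b, μ (a ++ b) = μ a + μ b) :
    μ [] = 0 := by
  have := hμ [] []
  rw [List.append_nil] at this
  omega

theorem additive_flatMap {β ι : Type*} {μ : List β → ℕ} (hμ : ∀ a b, μ (a ++ b) = μ a + μ b)
    (l : List ι) (f : ι → List β) : μ (l.flatMap f) = (l.map fun i => μ (f i)).sum := by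
  induction l with
  | nil => simpa using additive_nil hμ
  | cons i l ih => simp [hμ, ih]

theorem additive_collect {μ : List (Fin n) → ℕ} (hμ : ∀ a b, μ (a ++ b) = μ a + μ b)
    (side : List Bool → List (Fin n) → List (Fin n) → List (Fin n)) :
    μ (collect n J D side) =
      ∑ j ∈ Finset.range (J + 1), sumAt (D - j)
        (fun p => μ (side p (outA2 (sepInput n j p)) (outA3 (sepInput n j p)))) +
      ∑ d ∈ Finset.range (D - J + 1), sumAt d
        (fun p => μ (side p (outA1 (sepInput n J p)) (outA4 (sepInput n J p)))) := by
  rw [collect, hμ, additive_flatMap hμ, additive_flatMap hμ]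
  simp only [additive_flatMap hμ, sum_map_nodesAt]
  rfl

theorem additive_sides {β : Type*} {μ : List β → ℕ} (hμ : ∀ a b, μ (a ++ b) = μ a + μ b)
    (p : List Bool) (x y : List β) : μ (toL p x y) + μ (toR p x y) = μ x + μ y := by
  have h0 := additive_nil hμ
  unfold toL toR
  rcases p.getLast? with _ | _ | _ <;> simp [hμ, h0]

/-- Conservation in the cut network for each single wire: it leaves exactly once, and goes to
exactly one side. -/
theorem collect_perm (hJ : J ≤ D) :
    (collect n J D toL ++ collect n J D toR).Perm (List.finRange n) := by
  rw [List.perm_iff_count]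
  intro w
  have hμ : ∀ a b : List (Fin n), (a ++ b).count w = a.count w + b.count w :=
    fun _ _ => List.count_append
  rw [List.count_eq_one_of_mem (List.nodup_finRange n) (List.mem_finRange w),
    ← (treeFlow_wires n w).truncated_conservation D hJ, List.count_append,
    additive_collect (μ := List.count w) hμ, additive_collect (μ := List.count w) hμ,
    add_add_add_comm, ← Finset.sum_add_distrib, ← Finset.sum_add_distrib]
  simp only [← sumAt_add, additive_sides (μ := List.count w) hμ]
  rfl

/-- Array sizes depend only on the depth and are mirror symmetric, so both sides of the root
contribute the same length; at the root itself the two outputs are split. -/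
theorem sumAt_length_toSide_eq {d : ℕ} {X Y : List Bool → List (Fin n)}
    (h : ∀ p p' : List Bool, p.length = d → p'.length = d → (X p).length = (X p').length)
    (hXY : ∀ p : List Bool, p.length = d → (X p).length = (Y p).length) :
    sumAt d (fun p => (toL p (X p) (Y p)).length) = sumAt d (fun p => (toR p (X p) (Y p)).length) := by
  cases d with
  | zero => exact hXY [] rfl
  | succ d =>
    rw [sumAt_succ_sides, sumAt_succ_sides]
    have e1 : ∀ q x y, toL (β := Fin n) (q ++ [false]) x y = x ++ y :=
      fun q x y => (toSide_append false q x y).1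
    have e2 : ∀ q x y, toL (β := Fin n) (q ++ [true]) x y = [] :=
      fun q x y => (toSide_append false q x y).2
    have e3 : ∀ q x y, toR (β := Fin n) (q ++ [true]) x y = x ++ y :=
      fun q x y => (toSide_append true q x y).1
    have e4 : ∀ q x y, toR (β := Fin n) (q ++ [false]) x y = [] :=
      fun q x y => (toSide_append true q x y).2
    simp only [e1, e2, e3, e4, List.length_nil, sumAt_zero_fun, add_zero, zero_add,
      List.length_append]
    refine sumAt_congr fun q hq => ?_
    have hl : ∀ b, (q ++ [b]).length = d + 1 := by simp [hq]
    rw [← hXY _ (hl _), ← hXY _ (hl _), h _ _ (hl false) (hl true)]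

theorem length_collect {M : ℕ} (hM : 16 ^ M ∣ n) (hDJ : D + J < M) (hJ : J ≤ D) :
    2 * (collect n J D toL).length = n ∧ 2 * (collect n J D toR).length = n := by
  have hM' : 16 ^ M ∣ (List.finRange n).length := by simpa using hM
  have outs : ∀ {j : ℕ} {p : List Bool}, p.length + 2 * j < M →
      ∃ x, (sepInput n j p).length = 16 * x := by
    intro j p hp
    have := exists_length_treeArray (S := id) (fun _ => rfl) hM' hp
    rwa [id, ← sepInput_eq_treeArray] at this
  have len : ∀ {j : ℕ} {p p' : List Bool}, p.length + 2 * j < M → p.length = p'.length →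
      (sepInput n j p).length = (sepInput n j p').length := by
    intro j p p' hp hpp
    have h1 := length_treeArray (S := id) (fun _ => rfl) hM' j p hp.le
    have h2 := length_treeArray (S := id) (fun _ => rfl) hM' j p' (by omega)
    rw [← hpp, ← h1, ← sepInput_eq_treeArray, ← sepInput_eq_treeArray] at h2
    exact_mod_cast h2.symm
  have hsum := (collect_perm (n := n) hJ).length_eq
  rw [List.length_append, List.length_finRange] at hsum
  have heq : (collect n J D toL).length = (collect n J D toR).length := by
    rw [additive_collect (μ := List.length) (fun _ _ => List.length_append),
      additive_collect (μ := List.length) (fun _ _ => List.length_append)]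
    congr 1
    · refine Finset.sum_congr rfl fun j hj => ?_
      have := Finset.mem_range.1 hj
      apply sumAt_length_toSide_eq
      · intro p p' hp hp'
        obtain ⟨x, hx⟩ := outs (j := j) (p := p) (by omega)
        obtain ⟨x', hx'⟩ := outs (j := j) (p := p') (by omega)
        have := len (j := j) (p := p) (p' := p') (by omega) (by omega)
        rw [(length_outs hx).2.1, (length_outs hx').2.1]
        omega
      · intro p hp
        obtain ⟨x, hx⟩ := outs (j := j) (p := p) (by omega)
        rw [(length_outs hx).2.1, (length_outs hx).2.2.1]
    · refine Finset.sum_congr rfl fun d hd => ?_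
      have := Finset.mem_range.1 hd
      apply sumAt_length_toSide_eq
      · intro p p' hp hp'
        obtain ⟨x, hx⟩ := outs (j := J) (p := p) (by omega)
        obtain ⟨x', hx'⟩ := outs (j := J) (p := p') (by omega)
        have := len (j := J) (p := p) (p' := p') (by omega) (by omega)
        rw [(length_outs hx).1, (length_outs hx').1]
        omega
      · intro p hp
        obtain ⟨x, hx⟩ := outs (j := J) (p := p) (by omega)
        rw [(length_outs hx).1, (length_outs hx).2.2.2]
  omega

end Collect

/-! ### Counting the wrong items in the output -/

section FinalCount

variable {n J D d₀ M : ℕ} {hal : (k : ℕ) → ComparatorNetwork (2 * k)}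

theorem sum_pow_le (P J : ℕ) :
    ∑ j ∈ Finset.range (J + 1), (1 / 32 : ℝ) ^ (P + J - j) ≤ 2 * (1 / 32) ^ P := by
  have h : ∀ J : ℕ, ∑ j ∈ Finset.range (J + 1), (1 / 32 : ℝ) ^ (P + J - j) ≤ 2 * (1 / 32) ^ P := by
    intro J
    induction J with
    | zero =>
      have : (0 : ℝ) ≤ (1 / 32) ^ P := by positivity
      simp only [zero_add, Finset.sum_range_one, add_zero, Nat.sub_zero]
      linarith
    | succ J ih =>
      rw [Finset.sum_range_succ]
      have e : ∑ j ∈ Finset.range (J + 1), (1 / 32 : ℝ) ^ (P + (J + 1) - j) =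
          1 / 32 * ∑ j ∈ Finset.range (J + 1), (1 / 32 : ℝ) ^ (P + J - j) := by
        rw [Finset.mul_sum]
        refine Finset.sum_congr rfl fun j hj => ?_
        have : P + (J + 1) - j = P + J - j + 1 := by have := Finset.mem_range.1 hj; omega
        rw [this, pow_succ]; ring
      rw [e, Nat.add_sub_cancel]
      have : (0 : ℝ) ≤ (1 / 32) ^ P := by positivity
      linarith
  exact h J

/-- The items on the wrong side of the output, for balanced inputs of zeros and ones. -/
theorem count_wrong_le (hhal : ∀ k, IsExpanderNetwork d₀ (1 / 175) (hal k))
    (hM : 16 ^ M ∣ n) (hDJ : D + J < M) (hJ : J < D) (x : Fin n → Bool)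
    (hx : ∀ v, 2 * (List.ofFn x).count v = n) (b : Bool) :
    ((((collect n J D (toSide b)).map
      ((aksNetwork hal n J D d₀).run x)).count (!b) : ℕ) : ℝ) ≤
      n * (1 / 100 * (1 / 32) ^ (D - J) + 1 / 4 * (2 ^ (D - J) * (1 / 2) ^ J)) := by
  have hd : ∀ k, (hal k).depth ≤ d₀ := fun k => (hhal k).depth_le
  have hh : IsArrayHalver (1 / 175) (halve (α := Bool) hal) :=
    isArrayHalver_halve (by norm_num) (by norm_num) hhal
  have hlen : (List.ofFn x).length = n := List.length_ofFn
  have hM' : 16 ^ M ∣ (List.ofFn x).length := by rwa [hlen]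
  have hroot : ∀ v, 2 * (List.ofFn x).count v = (List.ofFn x).length := by simpa [hlen] using hx
  set S := sepFun (halve (α := Bool) hal)
  set v := stateAt hal J D d₀ x (D + J + 1) with hv
  rw [run_aksNetwork, ← hv]
  have hμ : ∀ a c : List (Fin n), ((a ++ c).map v).count (!b) =
      (a.map v).count (!b) + (c.map v).count (!b) := by
    intro a c; rw [List.map_append, List.count_append]
  rw [additive_collect (μ := fun l => (l.map v).count (!b)) hμ, Nat.cast_add, mul_add]
  apply add_le_add
  · rw [Nat.cast_sum]
    have hterm : ∀ j ∈ Finset.range (J + 1), ((sumAt (D - j) (fun p => ((toSide b p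
        (outA2 (sepInput n j p)) (outA3 (sepInput n j p))).map v).count (!b)) : ℕ) : ℝ) ≤
        n * (1 / 200) * (1 / 32) ^ (D - j) := by
      intro j hj
      have hj' := Finset.mem_range.1 hj
      -- As `J < D`, no leaf is a root, so every leaf lies on a definite side.
      obtain ⟨d, hdj⟩ : ∃ d, D - j = d + 1 := ⟨D - j - 1, by omega⟩
      have hleaf := leaf_strangers_le hh hM' hroot b j d (by omega)
      rw [hdj]
      have e : (sumAt (d + 1) fun p => ((toSide b p
          (outA2 (sepInput n j p)) (outA3 (sepInput n j p))).map v).count (!b)) =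
          sumAt d fun q => (toChild false (S (treeArray S (List.ofFn x) j (q ++ [b])))).count (!b) +
            (toChild true (S (treeArray S (List.ofFn x) j (q ++ [b])))).count (!b) := by
        have e1 : (sumAt (d + 1) fun p => ((toSide b p
            (outA2 (sepInput n j p)) (outA3 (sepInput n j p))).map v).count (!b)) =
            (sumAt d fun q => ((toSide b (q ++ [b]) (outA2 (sepInput n j (q ++ [b])))
              (outA3 (sepInput n j (q ++ [b])))).map v).count (!b)) +
            sumAt d fun q => ((toSide b (q ++ [!b]) (outA2 (sepInput n j (q ++ [!b])))
              (outA3 (sepInput n j (q ++ [!b])))).map v).count (!b) := by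
          rw [sumAt_succ_sides]
          cases b
          · rfl
          · exact add_comm _ _
        rw [e1]
        simp only [toSide_append, List.map_nil, List.count_nil, sumAt_zero_fun, add_zero, hμ]
        refine sumAt_congr fun q hq => ?_
        have hl : (q ++ [b]).length = D - j := by simp [hq, hdj]
        have f1 := map_final_leaf (x := x) hJ.le hd (by omega : j ≤ J) hl false
        have f2 := map_final_leaf (x := x) hJ.le hd (by omega : j ≤ J) hl true
        rw [← f1, ← f2]
        rfl
      rw [e]
      rw [hlen] at hleaf
      linarith
    refine (Finset.sum_le_sum hterm).trans ?_
    rw [← Finset.mul_sum]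
    obtain ⟨P, rfl⟩ : ∃ P, D = P + J := ⟨D - J, by omega⟩
    have := sum_pow_le P J
    rw [Nat.add_sub_cancel]
    calc (n : ℝ) * (1 / 200) * ∑ j ∈ Finset.range (J + 1), (1 / 32 : ℝ) ^ (P + J - j)
        ≤ n * (1 / 200) * (2 * (1 / 32) ^ P) := by gcongr
      _ = _ := by ring
  · rw [Nat.cast_sum]
    -- The contents of these outputs are not analysed. Each of the `2 ^ d` separators has an eighth
    -- of its at most `n * (1 / 2) ^ J` wires in them, and all are charged as wrong.
    have hterm : ∀ d ∈ Finset.range (D - J + 1), ((sumAt d (fun p => ((toSide b p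
        (outA1 (sepInput n J p)) (outA4 (sepInput n J p))).map v).count (!b)) : ℕ) : ℝ) ≤
        n * (1 / 8) * (1 / 2) ^ J * 2 ^ d := by
      intro d hd'
      have hd'' := Finset.mem_range.1 hd'
      rw [sumAt_cast]
      have hle : sumAt d (fun p => ((((toSide b p
          (outA1 (sepInput n J p)) (outA4 (sepInput n J p))).map v).count (!b) : ℕ) : ℝ)) ≤
          sumAt d (fun _ => (n : ℝ) * (1 / 8) * (1 / 2) ^ J) := by
        refine sumAt_mono fun p hp => ?_
        have h1 : ((toSide b p (outA1 (sepInput n J p)) (outA4 (sepInput n J p))).map v).count (!b) ≤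
            (outA1 (sepInput n J p)).length + (outA4 (sepInput n J p)).length := by
          refine List.count_le_length.trans ?_
          rw [List.length_map, ← List.length_append]
          exact (toSide_sublist b p _ _).length_le
        have hMf : 16 ^ M ∣ (List.finRange n).length := by simpa using hM
        have h2 := cast_length_outs (exists_length_treeArray (S := id) (j := J) (p := p)
          (fun _ => rfl) hMf (by omega))
        have h3 := length_treeArray (S := id) (fun _ => rfl) hMf J p (by omega)
        rw [id, ← sepInput_eq_treeArray] at h2
        rw [← sepInput_eq_treeArray, List.length_finRange] at h3
        have h4 : (n : ℝ) * sepSize J p.length ≤ n * (1 / 2) ^ J := by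
          gcongr
          exact sepSize_le _ _
        have h5 := (Nat.cast_le (α := ℝ)).2 h1
        rw [Nat.cast_add, h2.1, h2.2.1] at h5
        linarith
      refine hle.trans (le_of_eq ?_)
      rw [sumAt_const, nsmul_eq_mul]
      push_cast
      ring
    refine (Finset.sum_le_sum hterm).trans ?_
    rw [← Finset.mul_sum, geom_sum_eq (by norm_num), pow_succ]
    have : (0 : ℝ) ≤ n * (1 / 8) * (1 / 2) ^ J := by positivity
    calc (n : ℝ) * (1 / 8) * (1 / 2) ^ J * ((2 ^ (D - J) * 2 - 1) / (2 - 1))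
        ≤ n * (1 / 8) * (1 / 2) ^ J * (2 ^ (D - J) * 2) := by
          gcongr
          linarith
      _ = _ := by ring

end FinalCount

/-! ### From balanced 0-1 inputs to arbitrary inputs -/

section WeakHalver

variable {n J D d₀ M : ℕ} {hal : (k : ℕ) → ComparatorNetwork (2 * k)}

theorem exists_perm_ofFn_eq {l : List (Fin n)} (hl : l.Perm (List.finRange n)) :
    ∃ out : Equiv.Perm (Fin n), List.ofFn out = l := by
  have hlen : l.length = n := by rw [hl.length_eq, List.length_finRange]
  have hnd : l.Nodup := hl.nodup_iff.2 (List.nodup_finRange n)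
  let f : Fin n → Fin n := fun i => l.get (Fin.cast hlen.symm i)
  have hf : Function.Injective f := fun i j h => by
    simpa using List.nodup_iff_injective_get.1 hnd h
  refine ⟨Equiv.ofBijective f (Finite.injective_iff_bijective.1 hf), ?_⟩
  apply List.ext_getElem
  · simp [hlen]
  · intro i h1 h2
    simp [f]

theorem card_true_add_false (y : Fin n → Bool) :
    (Finset.univ.filter fun i => y i = true).card + (Finset.univ.filter fun i => y i = false).card =
      n := by
  have := Finset.card_filter_add_card_filter_not (s := (Finset.univ : Finset (Fin n)))
    (fun i => y i = true)
  simpa using this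

theorem count_ofFn_of_card {y : Fin n → Bool}
    (hy : 2 * (Finset.univ.filter fun i => y i = true).card = n) (v : Bool) :
    2 * (List.ofFn y).count v = n := by
  rw [count_ofFn]
  have := card_true_add_false y
  cases v <;> omega

/-- An input of zeros and ones with at most half ones lies below a balanced one. -/
theorem exists_balanced_ge (hn : 2 ∣ n) {y : Fin n → Bool}
    (hy : 2 * (Finset.univ.filter fun i => y i = true).card ≤ n) :
    ∃ z : Fin n → Bool, y ≤ z ∧ ∀ v, 2 * (List.ofFn z).count v = n := by
  obtain ⟨m, hm⟩ := hn
  obtain ⟨s, hs1, -, hs2⟩ := Finset.exists_subsuperset_card_eq (n := m)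
    (Finset.subset_univ (Finset.univ.filter fun i => y i = true)) (by omega) (by simp; omega)
  refine ⟨fun i => decide (i ∈ s), fun i => ?_, count_ofFn_of_card ?_⟩
  · rw [Bool.le_iff_imp]
    intro h
    simpa using hs1 (by simpa using h)
  · simp [hs2, hm]

/-- An input of zeros and ones with at most half zeros lies above a balanced one. -/
theorem exists_balanced_le (hn : 2 ∣ n) {y : Fin n → Bool}
    (hy : 2 * (Finset.univ.filter fun i => y i = false).card ≤ n) :
    ∃ z : Fin n → Bool, z ≤ y ∧ ∀ v, 2 * (List.ofFn z).count v = n := by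
  have hsum := card_true_add_false y
  obtain ⟨m, hm⟩ := hn
  obtain ⟨s, -, hs1, hs2⟩ := Finset.exists_subsuperset_card_eq (n := m)
    (Finset.empty_subset (Finset.univ.filter fun i => y i = true)) (by simp) (by omega)
  refine ⟨fun i => decide (i ∈ s), fun i => ?_, count_ofFn_of_card ?_⟩
  · rw [Bool.le_iff_imp]
    intro h
    simpa using hs1 (by simpa using h)
  · simp [hs2, hm]

/-- The two halves of the output need different thresholds, `g < r` on the left and `g ≤ r` on the
right, since items equal to the median are wrong on neither side. Each 0-1 input is then moved to a
balanced one in the direction that can only increase the number of wrong items. -/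
theorem isWeakHalver_aksNetwork (hhal : ∀ k, IsExpanderNetwork d₀ (1 / 175) (hal k))
    (hM : 16 ^ M ∣ n) (hDJ : D + J < M) (hJ : J < D) {out : Equiv.Perm (Fin n)}
    (hout : List.ofFn out = collect n J D toL ++ collect n J D toR) {δ : ℝ}
    (hδ : 1 / 100 * (1 / 32) ^ (D - J) + 1 / 4 * (2 ^ (D - J) * (1 / 2) ^ J) ≤ δ) :
    IsWeakHalver δ (aksNetwork hal n J D d₀) out := by
  classical
  have hn : 2 ∣ n := (dvd_pow (by norm_num) (by omega)).trans hM
  obtain ⟨lenL, lenR⟩ := length_collect hM hDJ hJ.le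
  set H := aksNetwork hal n J D d₀
  have hn0 : (0 : ℝ) ≤ n := Nat.cast_nonneg n
  have hL : ∀ z : Fin n → Bool, (Finset.univ.filter fun i : Fin n =>
      i.val < n / 2 ∧ H.run z (out i) = true).card =
      ((collect n J D (toSide false)).map (H.run z)).count true := by
    intro z
    rw [← count_take_ofFn (fun i => H.run z (out i)),
      show (List.ofFn fun i => H.run z (out i)) = (List.ofFn out).map (H.run z) by
        rw [List.map_ofFn]; rfl, hout, List.map_append, List.take_left']
    · rfl
    · rw [List.length_map]; omega
  have hR : ∀ z : Fin n → Bool, (Finset.univ.filter fun i : Fin n =>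
      n / 2 ≤ i.val ∧ H.run z (out i) = false).card =
      ((collect n J D (toSide true)).map (H.run z)).count false := by
    intro z
    rw [← count_drop_ofFn (fun i => H.run z (out i)),
      show (List.ofFn fun i => H.run z (out i)) = (List.ofFn out).map (H.run z) by
        rw [List.map_ofFn]; rfl, hout, List.map_append, List.drop_left']
    · rfl
    · rw [List.length_map]; omega
  intro x g hg
  constructor
  · let f : ℝ → Bool := fun r => decide (g < r)
    have hf : Monotone f := by
      intro r s hrs
      rw [Bool.le_iff_imp]
      simpa [f] using fun h => lt_of_lt_of_le h hrs
    have hy : 2 * (Finset.univ.filter fun i => (f ∘ x) i = true).card ≤ n := by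
      have h1 := hg.1
      rw [Set.ncard_eq_toFinset_card', Set.toFinset_ofPred] at h1
      have h2 := card_true_add_false (f ∘ x)
      have h3 : (Finset.univ.filter fun i => (f ∘ x) i = false) =
          Finset.univ.filter fun i => x i ≤ g := by
        apply Finset.filter_congr; simp [f]
      rw [h3] at h2
      omega
    obtain ⟨z, hyz, hz⟩ := exists_balanced_ge hn hy
    have hrun := H.run_mono hyz
    rw [H.run_map hf] at hrun
    have hle : ({i | 2 * i.val < n ∧ g < H.run x (out i)} : Set (Fin n)).ncard ≤
        ((collect n J D (toSide false)).map (H.run z)).count true := by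
      rw [← hL, Set.ncard_eq_toFinset_card', Set.toFinset_ofPred]
      apply Finset.card_le_card
      intro i hi
      simp only [Finset.mem_filter, Finset.mem_univ, true_and] at hi ⊢
      refine ⟨by omega, ?_⟩
      have h1 : f (H.run x (out i)) ≤ H.run z (out i) := hrun (out i)
      exact Bool.le_iff_imp.1 h1 (by simpa [f] using hi.2)
    refine (Nat.cast_le.2 hle).trans ((count_wrong_le hhal hM hDJ hJ z hz false).trans ?_)
    exact mul_le_mul_of_nonneg_left hδ hn0
  · let f : ℝ → Bool := fun r => decide (g ≤ r)
    have hf : Monotone f := by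
      intro r s hrs
      rw [Bool.le_iff_imp]
      simpa [f] using fun h => le_trans h hrs
    have hy : 2 * (Finset.univ.filter fun i => (f ∘ x) i = false).card ≤ n := by
      have h1 := hg.2
      rw [Set.ncard_eq_toFinset_card', Set.toFinset_ofPred] at h1
      have h2 := card_true_add_false (f ∘ x)
      have h3 : (Finset.univ.filter fun i => (f ∘ x) i = true) =
          Finset.univ.filter fun i => g ≤ x i := by
        apply Finset.filter_congr; simp [f]
      rw [h3] at h2
      omega
    obtain ⟨z, hyz, hz⟩ := exists_balanced_le hn hy
    have hrun := H.run_mono hyz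
    rw [H.run_map hf] at hrun
    have hle : ({i | n ≤ 2 * i.val ∧ H.run x (out i) < g} : Set (Fin n)).ncard ≤
        ((collect n J D (toSide true)).map (H.run z)).count false := by
      rw [← hR, Set.ncard_eq_toFinset_card', Set.toFinset_ofPred]
      apply Finset.card_le_card
      intro i hi
      simp only [Finset.mem_filter, Finset.mem_univ, true_and] at hi ⊢
      refine ⟨by omega, ?_⟩
      have h1 : H.run z (out i) ≤ f (H.run x (out i)) := hrun (out i)
      by_contra hne
      have h2 := Bool.le_iff_imp.1 h1 (by simpa using hne)
      simp only [f, decide_eq_true_eq] at h2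
      exact absurd hi.2 (not_lt.2 h2)
    refine (Nat.cast_le.2 hle).trans ((count_wrong_le hhal hM hDJ hJ z hz true).trans ?_)
    exact mul_le_mul_of_nonneg_left hδ hn0

end WeakHalver

/-! ### Choice of the parameters -/

section Parameters

/-- The value is `2 - 1 / log 2`, about 0.557. The upper bound gives enough trees for the error, the
lower one few enough for the depth. -/
theorem logb_four_div_exp_one : 1 / 2 ≤ Real.logb 2 (4 / Real.exp 1) ∧
    Real.logb 2 (4 / Real.exp 1) ≤ 2 / 3 := by
  have h1 := Real.log_two_gt_d9
  have h2 := Real.log_two_lt_d9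
  have e : Real.log (4 / Real.exp 1) = 2 * Real.log 2 - 1 := by
    rw [Real.log_div (by norm_num) (Real.exp_pos 1).ne', Real.log_exp,
      show (4 : ℝ) = 2 ^ 2 by norm_num, Real.log_pow]
    norm_num
  rw [Real.logb, e]
  constructor
  · rw [le_div_iff₀ (by linarith)]; linarith
  · rw [div_le_iff₀ (by linarith)]; linarith

theorem lglg_two_pow (k : ℕ) : lglg (2 ^ k) = Real.logb 2 k := by
  rw [lglg, Nat.cast_pow, Nat.cast_ofNat, Real.logb_pow, Real.logb_self_eq_one (by norm_num),
    mul_one]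

/-- Bounds for the parameters when `L = lg lg n` is nonnegative. -/
theorem parameter_bounds {c : ℝ} (hc : 0 < c) {n : ℕ} (hL : 0 ≤ lglg n) :
    3 / 2 * (c * lglg n) ≤ jMax c n ∧ (jMax c n : ℝ) ≤ 2 * (c * lglg n) + 1 ∧
      c * lglg n / 5 ≤ (dMax c n - jMax c n : ℕ) ∧
      ((dMax c n - jMax c n : ℕ) : ℝ) ≤ c * lglg n / 5 + 1 := by
  obtain ⟨h1, h2⟩ := logb_four_div_exp_one
  set κ := Real.logb 2 (4 / Real.exp 1)
  have hcL : 0 ≤ c * lglg n := by positivity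
  have hκ : 0 < κ := by linarith
  have e1 : c / κ * lglg n = c * lglg n / κ := by ring
  have e2 : c / 5 * lglg n = c * lglg n / 5 := by ring
  have hlo : 3 / 2 * (c * lglg n) ≤ c * lglg n / κ := by
    rw [le_div_iff₀ hκ]; nlinarith
  have hhi : c * lglg n / κ ≤ 2 * (c * lglg n) := by
    rw [div_le_iff₀ hκ]; nlinarith
  have e3 : dMax c n - jMax c n = ⌈c / 5 * lglg n⌉₊ := by rw [dMax, Nat.add_sub_cancel]
  rw [e3, e2, jMax, e1]
  refine ⟨hlo.trans (Nat.le_ceil _), ?_, Nat.le_ceil _, ?_⟩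
  · have := Nat.ceil_lt_add_one (hcL.trans (by linarith) : 0 ≤ c * lglg n / κ)
    linarith
  · exact (Nat.ceil_lt_add_one (by linarith)).le

/-- The first power is `2 ^ (-5 * P) ≤ 2 ^ (-L)`. For `L ≥ 0` the second has exponent `P - J ≤ 1 -
13 / 10 * L`, so it is at most `2 * 2 ^ (-L)`. The weights sum to `1 / 100 + 1 / 2 < 1`. -/
theorem error_le {L : ℝ} {P J : ℕ} (h1 : 3 / 2 * L ≤ J) (h2 : L / 5 ≤ P) (h3 : P ≤ L / 5 + 1) :
    1 / 100 * (1 / 32) ^ P + 1 / 4 * (2 ^ P * (1 / 2) ^ J) ≤ (2 : ℝ) ^ (-L) := by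
  have e1 : ((1 : ℝ) / 32) ^ P = (2 : ℝ) ^ (-(5 * P) : ℝ) := by
    rw [Real.rpow_neg (by norm_num), Real.rpow_mul (by norm_num), Real.rpow_natCast, one_div,
      inv_pow]
    norm_num
  have e2 : (2 : ℝ) ^ P * (1 / 2) ^ J = (2 : ℝ) ^ ((P : ℝ) - J) := by
    rw [Real.rpow_sub (by norm_num), Real.rpow_natCast, Real.rpow_natCast, one_div, inv_pow,
      div_eq_mul_inv]
  have b1 : (2 : ℝ) ^ (-(5 * P) : ℝ) ≤ 2 ^ (-L) :=
    Real.rpow_le_rpow_of_exponent_le (by norm_num) (by linarith)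
  have b2 : (2 : ℝ) ^ ((P : ℝ) - J) ≤ 2 ^ (-L + 1) :=
    Real.rpow_le_rpow_of_exponent_le (by norm_num) (by
      have : (0 : ℝ) ≤ J := Nat.cast_nonneg J
      rcases le_total 0 L with h | h <;> linarith)
  rw [Real.rpow_add (by norm_num), Real.rpow_one] at b2
  have h0 : (0 : ℝ) < 2 ^ (-L) := by positivity
  rw [e1, e2]
  linarith

theorem eventually_logb_le (a b c : ℝ) : ∀ᶠ k : ℕ in Filter.atTop,
    c ≤ Real.logb 2 k ∧ a * Real.logb 2 k + b ≤ k := by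
  have hlog : Filter.Tendsto (fun k : ℕ => Real.logb 2 k) Filter.atTop Filter.atTop :=
    (Real.tendsto_logb_atTop (by norm_num)).comp tendsto_natCast_atTop_atTop
  have ho : (fun k : ℕ => a * Real.logb 2 k + b) =o[Filter.atTop] fun k : ℕ => (k : ℝ) := by
    have h1 : (fun x : ℝ => a * Real.logb 2 x + b) =o[Filter.atTop] fun x : ℝ => x := by
      refine Asymptotics.IsLittleO.add ?_ (Asymptotics.isLittleO_const_id_atTop b)
      have : (fun x : ℝ => a * Real.logb 2 x) = fun x => a / Real.log 2 * Real.log x := by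
        funext x; rw [Real.logb]; ring
      rw [this]
      exact Real.isLittleO_log_id_atTop.const_mul_left _
    exact h1.comp_tendsto tendsto_natCast_atTop_atTop
  filter_upwards [hlog.eventually_ge_atTop c, ho.bound (show (0 : ℝ) < 1 by norm_num)] with k h1 h2
  refine ⟨h1, (le_abs_self _).trans ?_⟩
  simpa using h2

end Parameters

theorem theorem2 :
    ∃ d₀ : ℕ, ∀ c : ℝ, 0 < c → ∃ N : ℕ, ∀ n : ℕ, N ≤ n → (∃ k : ℕ, n = 2 ^ k) →
      ∃ (H : ComparatorNetwork n) (out : Equiv.Perm (Fin n)),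
        IsReducedAKS (1 / 175) d₀ (jMax c n) (dMax c n) H out ∧
        IsWeakHalver ((Real.logb 2 n) ^ (-c)) H out ∧
        ((halverLayers n (jMax c n) (dMax c n)).length : ℝ) ≤ 22.34 * c * lglg n ∧
        (H.depth : ℝ) ≤ d₀ * (22.34 * c * lglg n) := by
  obtain ⟨d₀, hal, hhal⟩ := exists_expanderNetwork_family 174 (by norm_num)
  have hε : (1 : ℝ) / ((174 : ℕ) + 1) = 1 / 175 := by norm_num
  rw [hε] at hhal
  refine ⟨d₀, fun c hc => ?_⟩
  -- With `L = lg lg n` there are `4 * (D + J + 1) ≤ 16.8 * c * L + 16` layers of halvers. The bound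
  -- `c * L ≥ 3` puts this below `22.34 * c * L`, and `17 * c * L + 24 ≤ k` makes `n = 2 ^ k`
  -- divisible by `16 ^ (D + J + 1)`.
  obtain ⟨K, hK⟩ := Filter.eventually_atTop.1 (eventually_logb_le (17 * c) 24 (max 1 (3 / c)))
  refine ⟨2 ^ K, ?_⟩
  rintro n hn ⟨k, rfl⟩
  have hkK : K ≤ k := (Nat.pow_le_pow_iff_right (by norm_num)).1 hn
  obtain ⟨hlarge, hk⟩ := hK k hkK
  rw [← lglg_two_pow] at hlarge hk
  set n := 2 ^ k with hnk
  set L := lglg n with hLdef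
  have hL1 : 1 ≤ L := (le_max_left _ _).trans hlarge
  have hcL3 : 3 ≤ c * L := by
    have : 3 / c ≤ L := (le_max_right _ _).trans hlarge
    rw [div_le_iff₀ hc] at this
    linarith
  obtain ⟨hJ1, hJ2, hP1, hP2⟩ := parameter_bounds hc (n := n) (by rw [← hLdef]; linarith)
  rw [← hLdef] at hJ1 hJ2 hP1 hP2
  set J := jMax c n
  set D := dMax c n
  have hJD : J < D := by
    have : (0 : ℝ) < (D - J : ℕ) := by linarith
    have : 0 < D - J := by exact_mod_cast this
    omega
  have hDcast : (D : ℝ) = (D - J : ℕ) + J := by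
    rw [← Nat.cast_add, Nat.sub_add_cancel hJD.le]
  have hM : 16 ^ (D + J + 1) ∣ n := by
    rw [hnk, show (16 : ℕ) = 2 ^ 4 by norm_num, ← pow_mul]
    apply pow_dvd_pow
    have : ((4 * (D + J + 1) : ℕ) : ℝ) ≤ k := by
      push_cast
      linarith
    exact_mod_cast this
  have hlayers : ((halverLayers n J D).length : ℝ) ≤ 22.34 * c * L := by
    rw [length_halverLayers]
    push_cast
    norm_num
    linarith
  obtain ⟨out, hout⟩ := exists_perm_ofFn_eq (collect_perm (n := n) hJD.le)
  refine ⟨aksNetwork hal n J D d₀, out, ⟨⟨hal, fun k => ⟨?_, hhal k⟩, rfl⟩, hout⟩, ?_, hlayers, ?_⟩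
  · exact (hhal k).isHalver (by norm_num) (by norm_num)
  · refine isWeakHalver_aksNetwork hhal hM (by omega) hJD hout ?_
    have hk0 : (0 : ℝ) < Real.logb 2 n := by
      rw [hnk, Nat.cast_pow, Nat.cast_ofNat, Real.logb_pow, Real.logb_self_eq_one (by norm_num),
        mul_one]
      linarith
    have e : Real.logb 2 n ^ (-c) = (2 : ℝ) ^ (-(c * L)) := by
      have h2 : (2 : ℝ) ^ L = Real.logb 2 n := Real.rpow_logb (by norm_num) (by norm_num) hk0
      rw [← h2, ← Real.rpow_mul (by norm_num)]
      congr 1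
      ring
    rw [e]
    exact error_le hJ1 hP1 hP2
  · rw [depth_aksNetwork, Nat.cast_mul]
    gcongr
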